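/- Let $d \ge 0$ and $n \ge 0$ be integers and let $r, q$ be real numbers with $r \ge 1$, $q > 1 + d/2$ and $q \ge r$. Let $\hat u(\xi) = \int_{\mathbb R^d} e^{-2\pi i \langle x,\xi\rangle} u(x)\,dx$ be the Fourier transform (extended to $L^2$ by Plancherel). For $s \ge 0$ let $$H^s = \{ f \in L^2(\mathbb R^d;\mathbb C^d) : \|f\|_{H^s} := \|(1+|\xi|^2)^{s/2} \hat f\|_{L^2} < \infty \}, \qquad H^\infty = \bigcap_{s \ge 0} H^s ,$$ where elements of $H^\infty$ are identified with their smooth representatives. Let $A = a(D)$ be a Fourier multiplier of class $\mathcal S^r$: $a \in C^\infty(\mathbb R^d, \mathcal L(\mathbb C^d))$, for every multi-index $\alpha$ there is a constant $C_\alpha$ with $\|\partial^\alpha a(\xi)\| \le C_\alpha (1+|\xi|^2)^{(r-|\alpha|)/2}$ for all $\xi \in \mathbb R^d$, and $(Au)(x) = \int_{\mathbb R^d} e^{2\pi i\langle x,\xi\rangle} a(\xi)\hat u(\xi)\,d\xi$ for $u \in H^\infty$. With $\nabla_u w = \sum_{j=1}^d u_j\, \partial_j w$, define operators $A_m$ $(m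 \ge 0)$ on $(m+1)$-tuples of elements of $H^\infty$ inductively by $A_0 = A$ and $$A_{m+1}(u_0,\dots,u_{m+1}) = \nabla_{u_{m+1}}\big(A_m(u_0,\dots,u_m)\big) - \sum_{k=0}^m A_m(u_0,\dots,\nabla_{u_{m+1}}u_k,\dots,u_m).$$ Then $A_n$ maps $(H^\infty)^{n+1}$ into $H^\infty$ and extends to a bounded $(n+1)$-linear operator $$A_n : H^q \times \dots \times H^q \to H^{q-r}.$$ Moreover, if $A$ maps $\mathbb R^d$-valued elements of $H^\infty$ to $\mathbb R^d$-valued ones, then the extension maps $(n+1)$-tuples of $\mathbb R^d$-valued elements of $H^q$ to $\mathbb R^d$-valued elements of $H^{q-r}$; that is, it restricts to a bounded operator $H^q(\mathbb R^d,\mathbb R^d)^{n+1} \to H^{q-r}(\mathbb R^d,\mathbb R^d)$. -/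

import Mathlib

open MeasureTheory FourierTransform
open scoped ContDiff

noncomputable section

/-- The domain `ℝ^d`, with its Euclidean norm and Lebesgue measure `volume`. -/
abbrev Space (d : ℕ) : Type := EuclideanSpace ℝ (Fin d)

/-- `ℂ^d` with its Hermitian inner product. -/
abbrev CVec (d : ℕ) : Type := EuclideanSpace ℂ (Fin d)

/-- The space `L²(ℝ^d; ℂ^d)`. -/
abbrev L2Field (d : ℕ) : Type := Lp (α := Space d) (CVec d) 2 (volume : Measure (Space d))

/-- The weight `λ_s(ξ) = (1 + |ξ|²)^{s/2}`. -/
def lam {d : ℕ} (s : ℝ) (ξ : Space d) : ℝ := (1 + ‖ξ‖ ^ 2) ^ (s / 2)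

/-! ### Sobolev spaces -/

/-- `H^q(ℝ^d; ℂ^d)` as a subspace of `L²`: those `f ∈ L²` with `λ_q · 𝓕 f ∈ L²`, where `𝓕` is the
Fourier transform on `L²`, normalised by `(𝓕 f)(ξ) = ∫ e^{-2πi⟨x,ξ⟩} f(x) dx`.
(This is the space `H^q` for `q ≥ 0`, the only range in which it is used.) -/
def sobolevSubmodule (d : ℕ) (q : ℝ) : Submodule ℂ (L2Field d) where
  carrier := {f | MemLp (fun ξ => lam q ξ • (𝓕 f : L2Field d) ξ) 2 volume}
  zero_mem' := by
    have h : (𝓕 (0 : L2Field d) : L2Field d) = 0 :=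
      (Lp.fourierTransformₗᵢ (Space d) (CVec d)).map_zero
    change MemLp (fun ξ => lam q ξ • (𝓕 (0 : L2Field d) : L2Field d) ξ) 2 volume
    rw [h]
    refine (MemLp.zero (ε := CVec d)).ae_eq ?_
    filter_upwards [Lp.coeFn_zero (CVec d) 2 (volume : Measure (Space d))] with ξ hξ
    rw [hξ, Pi.zero_apply, smul_zero]
  add_mem' := by
    intro f g hf hg
    have h : (𝓕 (f + g) : L2Field d) = 𝓕 f + 𝓕 g :=
      (Lp.fourierTransformₗᵢ (Space d) (CVec d)).map_add f g
    change MemLp (fun ξ => lam q ξ • (𝓕 (f + g) : L2Field d) ξ) 2 volume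
    rw [h]
    refine (MemLp.add hf hg).ae_eq ?_
    filter_upwards [Lp.coeFn_add (𝓕 f : L2Field d) (𝓕 g)] with ξ hξ
    rw [hξ]
    exact (smul_add (lam q ξ) ((𝓕 f : L2Field d) ξ) ((𝓕 g : L2Field d) ξ)).symm
  smul_mem' := by
    intro c f hf
    have h : (𝓕 (c • f) : L2Field d) = c • 𝓕 f :=
      (Lp.fourierTransformₗᵢ (Space d) (CVec d)).map_smul c f
    change MemLp (fun ξ => lam q ξ • (𝓕 (c • f) : L2Field d) ξ) 2 volume
    rw [h]
    refine (MemLp.const_smul hf c).ae_eq ?_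
    filter_upwards [Lp.coeFn_smul c (𝓕 f : L2Field d)] with ξ hξ
    rw [hξ]
    exact smul_comm c (lam q ξ) ((𝓕 f : L2Field d) ξ)

/-- The Sobolev space `H^q(ℝ^d; ℂ^d)`, a type of its own because it carries the `H^q` norm and not
the `L²` norm. -/
def Sobolev (d : ℕ) (q : ℝ) : Type := ↥(sobolevSubmodule d q)

namespace Sobolev

instance instAddCommGroup (d : ℕ) (q : ℝ) : AddCommGroup (Sobolev d q) :=
  inferInstanceAs (AddCommGroup ↥(sobolevSubmodule d q))

instance instModule (d : ℕ) (q : ℝ) : Module ℂ (Sobolev d q) :=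
  inferInstanceAs (Module ℂ ↥(sobolevSubmodule d q))

/-- The inclusion `H^q ⊆ L²`. -/
def toL2 {d : ℕ} {q : ℝ} : Sobolev d q →ₗ[ℂ] L2Field d := (sobolevSubmodule d q).subtype

theorem toL2_injective {d : ℕ} {q : ℝ} :
    Function.Injective (toL2 : Sobolev d q →ₗ[ℂ] L2Field d) :=
  Subtype.val_injective

theorem memLp_weighted {d : ℕ} {q : ℝ} (f : Sobolev d q) :
    MemLp (fun ξ => lam q ξ • (𝓕 (toL2 f) : L2Field d) ξ) 2 volume :=
  f.2

/-- The linear map `f ↦ λ_q · 𝓕 f` from `H^q` to `L²`. -/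
def weighted (d : ℕ) (q : ℝ) : Sobolev d q →ₗ[ℂ] L2Field d where
  toFun f := (memLp_weighted f).toLp _
  map_add' f g := by
    have h : (𝓕 (toL2 (f + g)) : L2Field d) = 𝓕 (toL2 f) + 𝓕 (toL2 g) := by
      rw [map_add]; exact (Lp.fourierTransformₗᵢ (Space d) (CVec d)).map_add _ _
    rw [← MemLp.toLp_add]
    refine (MemLp.toLp_eq_toLp_iff _ _).2 ?_
    rw [h]
    filter_upwards [Lp.coeFn_add (𝓕 (toL2 f) : L2Field d) (𝓕 (toL2 g))] with ξ hξ
    rw [hξ, Pi.add_apply, smul_add]; rfl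
  map_smul' c f := by
    have h : (𝓕 (toL2 (c • f)) : L2Field d) = c • 𝓕 (toL2 f) := by
      rw [map_smul]; exact (Lp.fourierTransformₗᵢ (Space d) (CVec d)).map_smul _ _
    rw [RingHom.id_apply, ← MemLp.toLp_const_smul]
    refine (MemLp.toLp_eq_toLp_iff _ _).2 ?_
    rw [h]
    filter_upwards [Lp.coeFn_smul c (𝓕 (toL2 f) : L2Field d)] with ξ hξ
    rw [hξ]
    exact smul_comm (lam q ξ) c ((𝓕 (toL2 f) : L2Field d) ξ)

theorem weighted_injective (d : ℕ) (q : ℝ) : Function.Injective (weighted d q) := by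
  rw [← LinearMap.ker_eq_bot, LinearMap.ker_eq_bot']
  intro f hf
  have h0 : (𝓕 (toL2 f) : L2Field d) = 0 := by
    refine Lp.ext ?_
    have h1 := (memLp_weighted f).coeFn_toLp
    have h2 : (memLp_weighted f).toLp _ = 0 := hf
    rw [h2] at h1
    filter_upwards [h1, Lp.coeFn_zero (CVec d) 2 (volume : Measure (Space d))] with ξ h1 h3
    have hpos : lam q ξ ≠ 0 := by
      have : (0 : ℝ) < 1 + ‖ξ‖ ^ 2 := by positivity
      exact (Real.rpow_pos_of_pos this _).ne'
    rw [h3] at h1 ⊢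
    simpa [hpos] using h1.symm
  have h4 : toL2 f = 0 :=
    (Lp.fourierTransformₗᵢ (Space d) (CVec d)).map_eq_zero_iff.1 h0
  exact toL2_injective (h4.trans (map_zero _).symm)

/-- The norm of `H^q` is `‖f‖_{H^q} = ‖λ_q · 𝓕 f‖_{L²}`. -/
instance instNormedAddCommGroup (d : ℕ) (q : ℝ) : NormedAddCommGroup (Sobolev d q) :=
  NormedAddCommGroup.induced (Sobolev d q) (L2Field d) (weighted d q) (weighted_injective d q)

instance instNormedSpace (d : ℕ) (q : ℝ) : NormedSpace ℂ (Sobolev d q) :=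
  NormedSpace.induced ℂ (Sobolev d q) (L2Field d) (weighted d q)

end Sobolev

/-- `u ∈ H^∞(ℝ^d; ℂ^d) = ⋂_{q ≥ 0} H^q`. By the Sobolev embedding every class in this intersection
has a unique smooth representative; elements of `H^∞` are taken to be these smooth functions. -/
def IsHInfty {d : ℕ} (u : Space d → CVec d) : Prop :=
  ContDiff ℝ ∞ u ∧
    ∃ h : MemLp u 2 (volume : Measure (Space d)), ∀ q : ℝ, 0 ≤ q → h.toLp u ∈ sobolevSubmodule d q

/-! ### Fourier multipliers -/

/-- The partial derivative `∂_{i₁} ⋯ ∂_{i_k} a (ξ)` of a smooth operator-valued function. -/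
def partialDeriv {d : ℕ} (a : Space d → (CVec d →L[ℂ] CVec d)) {k : ℕ} (i : Fin k → Fin d)
    (ξ : Space d) : CVec d →L[ℂ] CVec d :=
  iteratedFDeriv ℝ k a ξ (fun j => EuclideanSpace.single (i j) (1 : ℝ))

/-- The symbol class `S^r`: `a` is smooth, and `‖∂^α a(ξ)‖ ≲ (1 + |ξ|²)^{(r - |α|)/2}` for all
multi-indices `α`, each of them written as a tuple of `k = |α|` indices. -/
def SymbolClass {d : ℕ} (r : ℝ) (a : Space d → (CVec d →L[ℂ] CVec d)) : Prop :=
  ContDiff ℝ ∞ a ∧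
    ∀ (k : ℕ) (i : Fin k → Fin d), ∃ C : ℝ, ∀ ξ : Space d, ‖partialDeriv a i ξ‖ ≤ C * lam (r - k) ξ

open Classical in
/-- The Fourier transform `û` of a square-integrable function `u`. -/
def hat {d : ℕ} (u : Space d → CVec d) : Space d → CVec d :=
  if h : MemLp u 2 (volume : Measure (Space d)) then (𝓕 (h.toLp u) : L2Field d) else 0

/-- The Fourier multiplier `a(D) u = 𝓕⁻¹ (a û)` on `H^∞`, that is
`(a(D) u)(x) = ∫ e^{2πi⟨x,ξ⟩} a(ξ) û(ξ) dξ`. -/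
def fourierMult {d : ℕ} (a : Space d → (CVec d →L[ℂ] CVec d)) (u : Space d → CVec d) :
    Space d → CVec d :=
  𝓕⁻ (fun ξ => a ξ (hat u ξ))

/-! ### The operators `A_n` -/

/-- The canonical derivative `∇_u w = ∑_j u_j ∂_j w`. -/
def nabla {d : ℕ} (u w : Space d → CVec d) : Space d → CVec d :=
  fun x => ∑ j : Fin d, u x j • fderiv ℝ w x (EuclideanSpace.single j (1 : ℝ))

/-- `A_0 = a(D)` and
`A_{n+1}(u_0, …, u_{n+1}) = ∇_{u_{n+1}} (A_n(u_0, …, u_n))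
  - ∑_{k=0}^{n} A_n(u_0, …, ∇_{u_{n+1}} u_k, …, u_n)`. -/
def iterA {d : ℕ} (a : Space d → (CVec d →L[ℂ] CVec d)) :
    (n : ℕ) → (Fin (n + 1) → Space d → CVec d) → Space d → CVec d
  | 0, u => fourierMult a (u 0)
  | n + 1, u =>
      nabla (u (Fin.last (n + 1))) (iterA a n (fun k => u k.castSucc)) -
        ∑ k : Fin (n + 1), iterA a n
          (Function.update (fun l : Fin (n + 1) => u l.castSucc) k
            (nabla (u (Fin.last (n + 1))) (u k.castSucc)))

/-- `u` is `ℝ^d`-valued (almost everywhere). -/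
def IsRealField {d : ℕ} (u : Space d → CVec d) : Prop :=
  ∀ᵐ x ∂(volume : Measure (Space d)), ∀ j : Fin d, (u x j).im = 0

end

/-! ### The weight -/

section Weight

variable {d : ℕ}

/-! In Fourier variables `A_n` is a multilinear multiplier: the transform of `A_n(u_0, …, u_n)` at η
is the integral of `sym a n`, evaluated at the frequencies ξ_j and the amplitudes c_j = û_j(ξ_j),
over ξ_0 + ⋯ + ξ_n = η. The outer derivative along u_{n+1} produces the factor 2πi⟨ξ_0 + ⋯ + ξ_n,
c_{n+1}⟩. A derivative inside slot k produces 2πi⟨ξ_k, c_{n+1}⟩ and moves ξ_k to ξ_k + ξ_{n+1}. The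
next symbol is therefore a sum of differences of the previous one, and `weak_formula` makes this
representation precise.

Everything rests on `sym_bound`: with M = ∑ λ_1(ξ_j), the symbol is at most a constant times M^{r-1}
∏ λ_1(ξ_j)‖c_j‖. So each argument loses one derivative, and the remaining r - 1 orders fall on the
total frequency, whatever n is. The proof is an induction on n with two regimes. If some ξ_m with m
≥ 1 is comparable to M, the symmetry of the symbol in its arguments of index ≥ 1 (`sym_swap`) makes
it the last one, and the recursion can be estimated term by term without using cancellation. If ξ_0
dominates, the symbol is expanded (`sym_mem_termSpan`) into monomials in the pairings ⟨ξ_i, c_j⟩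
times multiple differences of `a`. A difference in the directions ξ_i, i ∈ I, gains ∏_I ‖ξ_i‖ and
lowers the order of `a` by |I|; a count of the factors (`Admissible.prod_le`) shows that this
compensates exactly for the surplus frequencies in the monomial.

Since q ≥ r, the weight λ_{q-r} of the output and M^{r-1} are together at most M^{q-1}, which is
bounded by a sum over k of λ_{q-1}(ξ_k). One factor is then in L² with weight λ_q and all others
have weight λ_1; these are in L¹ by Cauchy–Schwarz because q - 1 > d/2. Young's inequality in dual
form and the Riesz theorem give the bounded extension, and testing against smooth functions
identifies it with `iterA` on H^∞.

For reality, the recursion preserves real smooth fields, sharp Fourier cutoffs to balls approximate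
a real element of H^q by real elements of H^∞, and real fields form a closed subset of L². -/

theorem lam_base_pos (ξ : Space d) : (0 : ℝ) < 1 + ‖ξ‖ ^ 2 := by positivity

theorem lam_pos (s : ℝ) (ξ : Space d) : 0 < lam s ξ := Real.rpow_pos_of_pos (lam_base_pos ξ) _

theorem lam_nonneg (s : ℝ) (ξ : Space d) : 0 ≤ lam s ξ := (lam_pos s ξ).le

theorem lam_zero (ξ : Space d) : lam 0 ξ = 1 := by simp [lam]

theorem lam_add (s t : ℝ) (ξ : Space d) : lam (s + t) ξ = lam s ξ * lam t ξ := by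
  rw [lam, lam, lam, ← Real.rpow_add (lam_base_pos ξ), add_div]

theorem lam_neg (s : ℝ) (ξ : Space d) : lam (-s) ξ = (lam s ξ)⁻¹ := by
  rw [lam, lam, neg_div, Real.rpow_neg (lam_base_pos ξ).le]

theorem lam_eq_rpow (s : ℝ) (ξ : Space d) : lam s ξ = lam 1 ξ ^ s := by
  rw [lam, lam, ← Real.rpow_mul (lam_base_pos ξ).le]; ring_nf

theorem lam_mono {s t : ℝ} (h : s ≤ t) (ξ : Space d) : lam s ξ ≤ lam t ξ := by
  refine Real.rpow_le_rpow_of_exponent_le ?_ (by linarith)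
  nlinarith [sq_nonneg ‖ξ‖]

theorem one_le_lam {s : ℝ} (h : 0 ≤ s) (ξ : Space d) : 1 ≤ lam s ξ :=
  lam_zero ξ ▸ lam_mono h ξ

theorem lam_one_sq (ξ : Space d) : lam 1 ξ ^ 2 = 1 + ‖ξ‖ ^ 2 := by
  rw [← Real.rpow_natCast, lam, ← Real.rpow_mul (lam_base_pos ξ).le]; norm_num

theorem norm_le_lam_one (ξ : Space d) : ‖ξ‖ ≤ lam 1 ξ :=
  le_of_sq_le_sq (by rw [lam_one_sq]; linarith) (lam_nonneg 1 ξ)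

/-- After squaring, the cross term 2‖ξ‖‖η‖ is at most 2 λ_1(ξ)‖η‖. Having ‖η‖ here instead of λ_1(η)
allows perturbations of size λ_1(ξ)/2 to be absorbed in `lam_le_of_near`. -/
theorem lam_one_add_le (ξ η : Space d) : lam 1 (ξ + η) ≤ lam 1 ξ + ‖η‖ := by
  have h0 := lam_nonneg 1 ξ
  refine le_of_sq_le_sq ?_ (by positivity)
  have h1 : ‖ξ + η‖ ^ 2 ≤ (‖ξ‖ + ‖η‖) ^ 2 := by gcongr; exact norm_add_le _ _
  have h2 := mul_le_mul_of_nonneg_right (norm_le_lam_one ξ) (norm_nonneg η)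
  nlinarith [lam_one_sq ξ, lam_one_sq (ξ + η)]

theorem lam_one_add_le' (ξ η : Space d) : lam 1 (ξ + η) ≤ lam 1 ξ + lam 1 η :=
  (lam_one_add_le ξ η).trans (by gcongr; exact norm_le_lam_one η)

theorem lam_one_sum_le {ι : Type*} (s : Finset ι) (ξ : ι → Space d) (hs : s.Nonempty) :
    lam 1 (∑ i ∈ s, ξ i) ≤ ∑ i ∈ s, lam 1 (ξ i) := by
  classical
  induction hs using Finset.Nonempty.cons_induction with
  | singleton i => simp
  | cons i s hi _ ih =>
    rw [Finset.sum_cons, Finset.sum_cons]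
    exact (lam_one_add_le' _ _).trans (by gcongr)

theorem continuous_lam (s : ℝ) : Continuous (lam s : Space d → ℝ) := by
  unfold lam
  exact (by fun_prop : Continuous fun ξ : Space d => 1 + ‖ξ‖ ^ 2).rpow_const
    fun ξ => Or.inl (lam_base_pos ξ).ne'

end Weight

/-! ### The multilinear symbols -/

section Symbol

variable {d : ℕ}

/-- The bilinear pairing `∑_j c_j ξ_j`. -/
noncomputable def dot (ξ : Space d) (c : CVec d) : ℂ := ∑ j, c j * (ξ j : ℂ)

theorem dot_add_left (ξ η : Space d) (c : CVec d) : dot (ξ + η) c = dot ξ c + dot η c := by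
  simp [dot, mul_add, Finset.sum_add_distrib]

theorem dot_sum_left {ι : Type*} (s : Finset ι) (ξ : ι → Space d) (c : CVec d) :
    dot (∑ i ∈ s, ξ i) c = ∑ i ∈ s, dot (ξ i) c := by
  classical
  induction s using Finset.induction_on with
  | empty => simp [dot]
  | insert i s hi ih => rw [Finset.sum_insert hi, Finset.sum_insert hi, dot_add_left, ih]

theorem dot_add_right (ξ : Space d) (c e : CVec d) : dot ξ (c + e) = dot ξ c + dot ξ e := by
  simp [dot, add_mul, Finset.sum_add_distrib]

theorem dot_smul_right (ξ : Space d) (z : ℂ) (c : CVec d) : dot ξ (z • c) = z * dot ξ c := by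
  simp [dot, Finset.mul_sum, mul_assoc]

theorem norm_dot_le (ξ : Space d) (c : CVec d) : ‖dot ξ c‖ ≤ ‖ξ‖ * ‖c‖ := by
  have h1 : ‖dot ξ c‖ ≤ ∑ j, ‖ξ j‖ * ‖c j‖ := by
    refine (norm_sum_le _ _).trans (Finset.sum_le_sum fun j _ => ?_)
    rw [norm_mul, mul_comm, Complex.norm_real]
  refine h1.trans ?_
  rw [EuclideanSpace.norm_eq, EuclideanSpace.norm_eq]
  exact Real.sum_mul_le_sqrt_mul_sqrt _ _ _

theorem norm_dot_le_lam (ξ : Space d) (c : CVec d) : ‖dot ξ c‖ ≤ lam 1 ξ * ‖c‖ :=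
  (norm_dot_le ξ c).trans (by gcongr; exact norm_le_lam_one ξ)

/-- Adding the `n`-th frequency to the `k`-th one. -/
noncomputable def shift (n k : ℕ) (ξ : ℕ → Space d) : ℕ → Space d := ξ + Pi.single k (ξ n)

theorem shift_self (n k : ℕ) (ξ : ℕ → Space d) : shift n k ξ k = ξ k + ξ n := by simp [shift]

theorem shift_of_ne {n k i : ℕ} (h : i ≠ k) (ξ : ℕ → Space d) : shift n k ξ i = ξ i := by
  simp [shift, h]

/-- The symbol of the multilinear operator `A_n`. -/
noncomputable def sym (a : Space d → (CVec d →L[ℂ] CVec d)) : ℕ → (ℕ → Space d) → (ℕ → CVec d) → CVec d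
  | 0, ξ, c => a (ξ 0) (c 0)
  | n + 1, ξ, c => (2 * Real.pi * Complex.I : ℂ) • ∑ k ∈ Finset.range (n + 1),
      dot (ξ k) (c (n + 1)) • (sym a n ξ c - sym a n (shift (n + 1) k ξ) c)

variable (a : Space d → (CVec d →L[ℂ] CVec d))

/-- Frequencies and amplitudes are sequences over ℕ so that the recursion never reindexes; only the
entries 0, …, n matter. -/
theorem sym_congr (n : ℕ) {ξ η : ℕ → Space d} {c e : ℕ → CVec d} (h : ∀ i ≤ n, ξ i = η i)
    (h' : ∀ i ≤ n, c i = e i) : sym a n ξ c = sym a n η e := by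
  induction n generalizing ξ η with
  | zero => simp only [sym]; rw [h 0 le_rfl, h' 0 le_rfl]
  | succ n ih =>
    simp only [sym]
    congr 1
    refine Finset.sum_congr rfl fun k hk => ?_
    have hk' : k ≤ n := Nat.lt_succ_iff.1 (Finset.mem_range.1 hk)
    rw [h k (by omega), h' _ le_rfl, ih (fun i hi => h i (by omega)) (fun i hi => h' i (by omega)),
      ih (ξ := shift (n + 1) k ξ) (η := shift (n + 1) k η) ?_ (fun i hi => h' i (by omega))]
    intro i hi
    simp only [shift, Pi.add_apply]
    rw [h i (by omega), h _ le_rfl]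

/-- Two steps of the recursion for an arbitrary function f in place of a symbol, with (x, c) and (y,
e) the last two frequency–amplitude pairs. The right-hand side is visibly invariant under exchanging
these pairs: the double sum is symmetric after relabelling, and the two parts of the single sum are
interchanged. -/
theorem sum_swap_last (m : ℕ) (f : (ℕ → Space d) → CVec d) (ξ : ℕ → Space d) (x y : Space d)
    (c e : CVec d) :
    (∑ k ∈ Finset.range m, dot (ξ k) e •
        ((∑ l ∈ Finset.range m, dot (ξ l) c • (f ξ - f (ξ + Pi.single l x)))
        - ∑ l ∈ Finset.range m, dot ((ξ + Pi.single k y : ℕ → Space d) l) c •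
          (f (ξ + Pi.single k y) - f (ξ + Pi.single k y + Pi.single l x)))
      + dot x e • ((∑ l ∈ Finset.range m, dot (ξ l) c • (f ξ - f (ξ + Pi.single l x)))
        - ∑ l ∈ Finset.range m, dot (ξ l) c • (f ξ - f (ξ + Pi.single l (x + y))))) =
    (∑ k ∈ Finset.range m, ∑ l ∈ Finset.range m, (dot (ξ k) e * dot (ξ l) c) •
        (f ξ - f (ξ + Pi.single l x) - f (ξ + Pi.single k y)
          + f (ξ + Pi.single k y + Pi.single l x)))
      + ∑ k ∈ Finset.range m, ((dot (ξ k) e * dot y c) • (f (ξ + Pi.single k (x + y))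
          - f (ξ + Pi.single k y))
        + (dot (ξ k) c * dot x e) • (f (ξ + Pi.single k (x + y)) - f (ξ + Pi.single k x))) := by
  -- Translating the k-th frequency by y affects the pairing with c only for l = k; this diagonal
  -- correction supplies the `dot y c` terms.
  have h1 : ∀ k ∈ Finset.range m,
      ∑ l ∈ Finset.range m, dot ((ξ + Pi.single k y : ℕ → Space d) l) c •
          (f (ξ + Pi.single k y) - f (ξ + Pi.single k y + Pi.single l x)) =
      (∑ l ∈ Finset.range m, dot (ξ l) c •
          (f (ξ + Pi.single k y) - f (ξ + Pi.single k y + Pi.single l x)))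
        + dot y c • (f (ξ + Pi.single k y) - f (ξ + Pi.single k (x + y))) := by
    intro k hk
    have h2 : ∀ l, dot ((ξ + Pi.single k y : ℕ → Space d) l) c •
          (f (ξ + Pi.single k y) - f (ξ + Pi.single k y + Pi.single l x)) =
        dot (ξ l) c • (f (ξ + Pi.single k y) - f (ξ + Pi.single k y + Pi.single l x))
        + if l = k then dot y c • (f (ξ + Pi.single k y) - f (ξ + Pi.single k (x + y))) else 0 := by
      intro l
      split_ifs with h
      · subst h
        rw [Pi.add_apply, Pi.single_eq_same, dot_add_left, add_smul, add_assoc ξ, ← Pi.single_add,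
          add_comm y x]
      · rw [Pi.add_apply, Pi.single_eq_of_ne h, add_zero, add_zero]
    simp_rw [h2]
    rw [Finset.sum_add_distrib, Finset.sum_ite_eq' , if_pos hk]
  rw [Finset.sum_congr rfl fun k hk => by rw [h1 k hk], ← Finset.sum_sub_distrib, Finset.smul_sum,
    add_comm, ← Finset.sum_add_distrib, add_comm (∑ k ∈ Finset.range m, ∑ l ∈ Finset.range m, _),
    ← Finset.sum_add_distrib]
  refine Finset.sum_congr rfl fun k _ => ?_
  have h3 : ∑ l ∈ Finset.range m, (dot (ξ k) e * dot (ξ l) c) •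
        (f ξ - f (ξ + Pi.single l x) - f (ξ + Pi.single k y)
          + f (ξ + Pi.single k y + Pi.single l x)) =
      dot (ξ k) e • ((∑ l ∈ Finset.range m, dot (ξ l) c • (f ξ - f (ξ + Pi.single l x)))
       - ∑ l ∈ Finset.range m, dot (ξ l) c •
          (f (ξ + Pi.single k y) - f (ξ + Pi.single k y + Pi.single l x))) := by
    rw [← Finset.sum_sub_distrib, Finset.smul_sum]
    refine Finset.sum_congr rfl fun l _ => ?_
    module
  rw [h3]
  module

/-- This is the symmetry of a second covariant derivative: the canonical connection is flat and
torsion free, so the commutator of ∇_u and ∇_v is the derivative along ∇_u v - ∇_v u, which the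
correction terms of the recursion cancel. -/
theorem sym_swap_last (m : ℕ) (ξ : ℕ → Space d) (c : ℕ → CVec d) :
    sym a (m + 2) (ξ ∘ Equiv.swap (m + 1) (m + 2)) (c ∘ Equiv.swap (m + 1) (m + 2)) =
      sym a (m + 2) ξ c := by
  have key : ∀ (ξ : ℕ → Space d) (c : ℕ → CVec d), sym a (m + 2) ξ c =
      (2 * Real.pi * Complex.I : ℂ) • (2 * Real.pi * Complex.I : ℂ) •
      ((∑ k ∈ Finset.range (m + 1), ∑ l ∈ Finset.range (m + 1),
        (dot (ξ k) (c (m + 2)) * dot (ξ l) (c (m + 1))) •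
        (sym a m ξ c - sym a m (ξ + Pi.single l (ξ (m + 1))) c
          - sym a m (ξ + Pi.single k (ξ (m + 2))) c
          + sym a m (ξ + Pi.single k (ξ (m + 2)) + Pi.single l (ξ (m + 1))) c))
      + ∑ k ∈ Finset.range (m + 1), ((dot (ξ k) (c (m + 2)) * dot (ξ (m + 2)) (c (m + 1))) •
          (sym a m (ξ + Pi.single k (ξ (m + 1) + ξ (m + 2))) c
          - sym a m (ξ + Pi.single k (ξ (m + 2))) c)
        + (dot (ξ k) (c (m + 1)) * dot (ξ (m + 1)) (c (m + 2))) •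
          (sym a m (ξ + Pi.single k (ξ (m + 1) + ξ (m + 2))) c
            - sym a m (ξ + Pi.single k (ξ (m + 1))) c))) := by
    intro ξ c
    rw [← sum_swap_last (m + 1) (fun η => sym a m η c), sym, Finset.sum_range_succ]
    simp only [sym, ← smul_sub]
    rw [smul_comm (dot (ξ (m + 1)) (c (m + 1 + 1))), Finset.sum_congr rfl
      (fun k _ => smul_comm (dot (ξ k) (c (m + 1 + 1))) _ _), ← Finset.smul_sum, ← smul_add]
    congr 3
    · refine Finset.sum_congr rfl fun k hk => ?_
      have hk := Finset.mem_range.1 hk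
      congr 2
      refine Finset.sum_congr rfl fun l _ => ?_
      rw [shift, shift, Pi.add_apply _ _ (m + 1), Pi.single_eq_of_ne (by omega : m + 1 ≠ k),
        add_zero]
    · congr 2
      refine Finset.sum_congr rfl fun l hl => ?_
      have hl := Finset.mem_range.1 hl
      rw [shift_of_ne (by omega)]
      congr 2
      · refine sym_congr a m (fun i hi => shift_of_ne (by omega) ξ) fun _ _ => rfl
      · refine sym_congr a m (fun i hi => ?_) fun _ _ => rfl
        rw [shift, shift_self, Pi.add_apply, shift_of_ne (by omega), Pi.add_apply]
  rw [key, key ξ c]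
  have e1 : Equiv.swap (m + 1) (m + 2) (m + 1) = m + 2 := Equiv.swap_apply_left _ _
  have e2 : Equiv.swap (m + 1) (m + 2) (m + 2) = m + 1 := Equiv.swap_apply_right _ _
  have e3 : ∀ i ≤ m, Equiv.swap (m + 1) (m + 2) i = i := fun i hi =>
    Equiv.swap_apply_of_ne_of_ne (by omega) (by omega)
  have e4 : ∀ η : ℕ → Space d, sym a m (ξ ∘ Equiv.swap (m + 1) (m + 2) + η)
      (c ∘ Equiv.swap (m + 1) (m + 2)) = sym a m (ξ + η) c := fun η =>
    sym_congr a m (fun i hi => by simp [e3 i hi]) (fun i hi => by simp [e3 i hi])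
  have e5 : sym a m (ξ ∘ Equiv.swap (m + 1) (m + 2)) (c ∘ Equiv.swap (m + 1) (m + 2)) =
      sym a m ξ c := by simpa using e4 0
  simp only [add_assoc, e4, e5, Function.comp_apply, e1, e2]
  congr 3
  · rw [Finset.sum_comm]
    refine Finset.sum_congr rfl fun k hk => Finset.sum_congr rfl fun l hl => ?_
    rw [e3 k (Nat.lt_succ_iff.1 (Finset.mem_range.1 hk)),
      e3 l (Nat.lt_succ_iff.1 (Finset.mem_range.1 hl)), mul_comm, sub_right_comm,
      add_comm (Pi.single k _ : ℕ → Space d)]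
  · refine Finset.sum_congr rfl fun k hk => ?_
    rw [e3 k (Nat.lt_succ_iff.1 (Finset.mem_range.1 hk)), add_comm, add_comm (ξ (m + 2))]

/-- A transposition not involving the last index merely permutes the summands of the recursion, so
induction reduces to the last two indices. Index 0 is excluded because its slot is the one on which
`a` acts. -/
theorem sym_swap (n i : ℕ) (hi : 1 ≤ i) (hin : i + 1 ≤ n) (ξ : ℕ → Space d) (c : ℕ → CVec d) :
    sym a n (ξ ∘ Equiv.swap i (i + 1)) (c ∘ Equiv.swap i (i + 1)) = sym a n ξ c := by
  induction n generalizing ξ with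
  | zero => omega
  | succ n ih =>
    rcases Nat.lt_or_ge (i + 1) (n + 1) with h | h
    · have hN : Equiv.swap i (i + 1) (n + 1) = n + 1 :=
        Equiv.swap_apply_of_ne_of_ne (by omega) (by omega)
      simp only [sym]
      congr 1
      refine Finset.sum_equiv (Equiv.swap i (i + 1)) (fun k => ?_) fun k _ => ?_
      · simp only [Finset.mem_range, Equiv.swap_apply_def]
        split_ifs <;> omega
      · rw [Function.comp_apply, Function.comp_apply, hN, ih (by omega) ξ,
          ← ih (by omega) (shift _ _ ξ)]
        congr 4
        funext j
        simp only [shift, Pi.add_apply, Function.comp_apply, hN, Pi.single_apply,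
          EmbeddingLike.apply_eq_iff_eq]
    · obtain ⟨m, rfl⟩ : ∃ m, n = m + 1 := ⟨n - 1, by omega⟩
      obtain rfl : i = m + 1 := by omega
      exact sym_swap_last a m ξ c

end Symbol

/-! ### Multiple differences -/

section Differences

variable {d : ℕ} {E : Type*} [NormedAddCommGroup E] [NormedSpace ℝ E]

/-- The multiple difference of `f` at `x` in the directions `ξ i`, `i ∈ I`. -/
def mdiff (f : Space d → E) (ξ : ℕ → Space d) (I : Finset ℕ) (x : Space d) : E :=
  ∑ J ∈ I.powerset, (-1 : ℝ) ^ J.card • f (x + ∑ i ∈ J, ξ i)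

theorem mdiff_empty (f : Space d → E) (ξ : ℕ → Space d) (x : Space d) : mdiff f ξ ∅ x = f x := by
  simp [mdiff]

/-- Subsets are sorted by whether they contain i. The sign convention is f(x) - f(x + ξ_i), matching
the differences in the recursion of `sym`. -/
theorem mdiff_insert (f : Space d → E) (ξ : ℕ → Space d) {i : ℕ} {I : Finset ℕ} (hi : i ∉ I)
    (x : Space d) : mdiff f ξ (insert i I) x = mdiff f ξ I x - mdiff f ξ I (x + ξ i) := by
  rw [mdiff, Finset.sum_powerset_insert hi, mdiff, mdiff, sub_eq_add_neg,
    ← Finset.sum_neg_distrib]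
  congr 1
  refine Finset.sum_congr rfl fun J hJ => ?_
  have hiJ : i ∉ J := fun h => hi (Finset.mem_powerset.1 hJ h)
  rw [Finset.card_insert_of_notMem hiJ, Finset.sum_insert hiJ, pow_succ, mul_neg_one, neg_smul,
    add_assoc]

theorem mdiff_sub (f : Space d → E) (ξ : ℕ → Space d) (I : Finset ℕ) (v x : Space d) :
    mdiff (fun y => f y - f (y + v)) ξ I x = mdiff f ξ I x - mdiff f ξ I (x + v) := by
  rw [mdiff, mdiff, mdiff, ← Finset.sum_sub_distrib]
  refine Finset.sum_congr rfl fun J _ => ?_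
  rw [smul_sub, add_right_comm x v]

theorem mdiff_congr (f : Space d → E) {ξ η : ℕ → Space d} {I : Finset ℕ}
    (h : ∀ i ∈ I, ξ i = η i) (x : Space d) : mdiff f ξ I x = mdiff f η I x := by
  refine Finset.sum_congr rfl fun J hJ => ?_
  rw [Finset.sum_congr rfl fun i hi => h i (Finset.mem_powerset.1 hJ hi)]

/-- Each direction costs one mean value inequality, which trades a derivative for a factor ‖ξ_i‖.
The derivative is controlled only within distance ∑ ‖ξ_i‖ of x, so that the local decay of the
derivatives of a symbol can be used. -/
theorem norm_mdiff_le {f : Space d → E} (hf : ContDiff ℝ ∞ f) (ξ : ℕ → Space d) (I : Finset ℕ)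
    (x : Space d) {C : ℝ}
    (hC : ∀ v : Space d, ‖v‖ ≤ ∑ i ∈ I, ‖ξ i‖ → ‖iteratedFDeriv ℝ I.card f (x + v)‖ ≤ C) :
    ‖mdiff f ξ I x‖ ≤ C * ∏ i ∈ I, ‖ξ i‖ := by
  induction I using Finset.induction_on generalizing f C with
  | empty =>
    have h := hC 0 (by simp)
    rw [Finset.card_empty, norm_iteratedFDeriv_zero, add_zero] at h
    simpa [mdiff_empty] using h
  | insert i I hi ih =>
    rw [mdiff_insert f ξ hi, ← mdiff_sub, Finset.prod_insert hi, ← mul_assoc]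
    have hg : ContDiff ℝ ∞ fun y => f (y + ξ i) := hf.comp (contDiff_id.add contDiff_const)
    -- The induction hypothesis is applied to y ↦ f(y) - f(y + ξ_i) with the constant C‖ξ_i‖.
    refine ih (hf.sub hg) fun v hv => ?_
    have h1 : iteratedFDeriv ℝ I.card (fun y => f y - f (y + ξ i)) (x + v) =
        iteratedFDeriv ℝ I.card f (x + v) - iteratedFDeriv ℝ I.card f (x + v + ξ i) := by
      have h := iteratedFDeriv_sub_apply (i := I.card) (x := x + v)
        ((hf.of_le (by exact_mod_cast le_top)).contDiffAt)
        ((hg.of_le (by exact_mod_cast le_top)).contDiffAt)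
      rwa [iteratedFDeriv_comp_add_right] at h
    rw [h1, norm_sub_rev]
    have hd : Differentiable ℝ (iteratedFDeriv ℝ I.card f) :=
      hf.differentiable_iteratedFDeriv (by exact_mod_cast WithTop.coe_lt_top _)
    have h2 := Convex.norm_image_sub_le_of_norm_fderiv_le (𝕜 := ℝ)
      (f := iteratedFDeriv ℝ I.card f) (s := segment ℝ (x + v) (x + v + ξ i)) (C := C)
      (fun y _ => hd y) (fun y hy => ?_) (convex_segment _ _)
      (left_mem_segment ℝ _ _) (right_mem_segment ℝ _ _)
    · simpa using h2
    · rw [norm_fderiv_iteratedFDeriv]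
      rw [segment_eq_image'] at hy
      obtain ⟨t, ht, rfl⟩ := hy
      have h3 := hC (v + t • ξ i) (by
        rw [Finset.sum_insert hi]
        refine (norm_add_le _ _).trans ?_
        rw [norm_smul, Real.norm_of_nonneg ht.1]
        have := mul_le_of_le_one_left (norm_nonneg (ξ i)) ht.2
        linarith)
      rw [Finset.card_insert_of_notMem hi] at h3
      simpa [add_assoc] using h3

end Differences

/-! ### Expansion of the symbols -/

section Expansion

variable {d : ℕ}

/-- The monomial `∏_j ⟨ξ_{p j}, c_j⟩`. -/
noncomputable def mono (p : ℕ → ℕ) (n : ℕ) (ξ : ℕ → Space d) (c : ℕ → CVec d) : ℂ :=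
  ∏ j ∈ Finset.Icc 1 n, dot (ξ (p j)) (c j)

theorem mono_congr {p p' : ℕ → ℕ} {n : ℕ} (h : ∀ j ∈ Finset.Icc 1 n, p j = p' j)
    (ξ : ℕ → Space d) (c : ℕ → CVec d) : mono p n ξ c = mono p' n ξ c :=
  Finset.prod_congr rfl fun j hj => by rw [h j hj]

theorem mono_succ (p : ℕ → ℕ) (n : ℕ) (ξ : ℕ → Space d) (c : ℕ → CVec d) :
    mono p (n + 1) ξ c = mono p n ξ c * dot (ξ (p (n + 1))) (c (n + 1)) :=
  Finset.prod_Icc_succ_top (by omega) _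

/-- Every factor with p j = k splits into two summands; expanding the product amounts to choosing
the set R of those j whose parent changes from k to N. -/
theorem mono_shift (p : ℕ → ℕ) (n N k : ℕ) (ξ : ℕ → Space d) (c : ℕ → CVec d) :
    mono p n (shift N k ξ) c =
      ∑ R ∈ ((Finset.Icc 1 n).filter fun j => p j = k).powerset,
        mono (fun j => if j ∈ R then N else p j) n ξ c := by
  have h1 : ∀ j, dot (shift N k ξ (p j)) (c j) =
      (if p j = k then dot (ξ N) (c j) else 0) + dot (ξ (p j)) (c j) := by
    intro j
    split_ifs with h
    · rw [h, shift_self, dot_add_left, add_comm]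
    · rw [shift_of_ne h, zero_add]
  rw [mono, Finset.prod_congr rfl fun j _ => h1 j, Finset.prod_add]
  symm
  have hsub : ((Finset.Icc 1 n).filter fun j => p j = k).powerset ⊆ (Finset.Icc 1 n).powerset :=
    Finset.powerset_mono.2 (Finset.filter_subset _ _)
  -- The expansion runs over all subsets of the index interval; a subset containing some j with p j
  -- ≠ k has a vanishing factor.
  rw [← Finset.sum_subset hsub]
  · refine Finset.sum_congr rfl fun R hR => ?_
    have hR' := Finset.mem_powerset.1 hR
    rw [mono, ← Finset.prod_sdiff (hR'.trans (Finset.filter_subset _ _)), mul_comm]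
    congr 1
    · refine Finset.prod_congr rfl fun j hj => ?_
      rw [if_pos hj, if_pos (Finset.mem_filter.1 (hR' hj)).2]
    · refine Finset.prod_congr rfl fun j hj => ?_
      rw [if_neg (Finset.mem_sdiff.1 hj).2]
  · intro R hR hR'
    rw [Finset.mem_powerset] at hR hR'
    obtain ⟨j, hj, hjk⟩ : ∃ j ∈ R, p j ≠ k := by
      by_contra! h
      exact hR' fun j hj => Finset.mem_filter.2 ⟨hR hj, h j hj⟩
    rw [Finset.prod_eq_zero hj (if_neg hjk), zero_mul]

/-- The combinatorial condition on the terms of the symbol of `A_n`: `p` is the parent map of a tree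
with root `0` and set of leaves `I`. -/
structure Admissible (n : ℕ) (p : ℕ → ℕ) (S I : Finset ℕ) : Prop where
  zero_mem : 0 ∈ S
  disj : Disjoint S I
  union : S ∪ I = Finset.range (n + 1)
  maps : ∀ j ∈ Finset.Icc 1 n, p j ∈ S
  surj : ∀ i ∈ S, i ≠ 0 → ∃ j ∈ Finset.Icc 1 n, p j = i

variable (a : Space d → (CVec d →L[ℂ] CVec d))

/-- A term of the symbol of `A_n`. -/
noncomputable def term (n : ℕ) (p : ℕ → ℕ) (S I : Finset ℕ)
    (x : (ℕ → Space d) × (ℕ → CVec d)) : CVec d :=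
  mono p n x.1 x.2 • mdiff a x.1 I (∑ i ∈ S, x.1 i) (x.2 0)

/-- The span of the admissible terms. -/
noncomputable def termSpan (n : ℕ) : Submodule ℂ ((ℕ → Space d) × (ℕ → CVec d) → CVec d) :=
  Submodule.span ℂ {F | ∃ p S I, Admissible n p S I ∧ F = term a n p S I}

/-- One summand of the recursion for the symbols. -/
noncomputable def symStep (n k : ℕ) : ((ℕ → Space d) × (ℕ → CVec d) → CVec d) →ₗ[ℂ]
    ((ℕ → Space d) × (ℕ → CVec d) → CVec d) where
  toFun F x := dot (x.1 k) (x.2 (n + 1)) • (F x - F (shift (n + 1) k x.1, x.2))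
  map_add' F G := by funext x; simp only [Pi.add_apply]; module
  map_smul' z F := by funext x; simp only [Pi.smul_apply, RingHom.id_apply]; module

variable {a}

theorem sum_shift_of_mem {S : Finset ℕ} {N k : ℕ} (hk : k ∈ S) (hN : N ∉ S) (ξ : ℕ → Space d) :
    ∑ i ∈ S, shift N k ξ i = ∑ i ∈ insert N S, ξ i := by
  simp only [shift, Pi.add_apply]
  rw [Finset.sum_add_distrib, Finset.sum_pi_single', if_pos hk, Finset.sum_insert hN, add_comm]

/-- The shift moves the base point by ξ_{n+1} and expands the monomial over sets R of children of k.
The part R = ∅ combines with the unshifted term to a further difference, making n + 1 a leaf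
attached to k. For R ≠ ∅, the vertex n + 1 becomes an inner vertex below k which takes over the
children in R. -/
theorem symStep_term_mem_of_mem {n k : ℕ} {p : ℕ → ℕ} {S I : Finset ℕ} (h : Admissible n p S I)
    (hk : k ∈ S) : symStep n k (term a n p S I) ∈ termSpan a (n + 1) := by
  have hlt : ∀ i ∈ S ∪ I, i < n + 1 := fun i hi => by
    rw [h.union] at hi; exact Finset.mem_range.1 hi
  have hNS : n + 1 ∉ S := fun hN => absurd (hlt _ (Finset.mem_union_left _ hN)) (by omega)
  have hNI : n + 1 ∉ I := fun hN => absurd (hlt _ (Finset.mem_union_right _ hN)) (by omega)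
  have hkI : k ∉ I := Finset.disjoint_left.1 h.disj hk
  set Q : Finset (Finset ℕ) := ((Finset.Icc 1 n).filter fun j => p j = k).powerset with hQ
  -- The new parent map: n + 1 hangs from k, and the children in R hang from n + 1.
  let pR : Finset ℕ → ℕ → ℕ := fun R j => if j ∈ R then n + 1 else Function.update p (n + 1) k j
  have hRsub : ∀ R ∈ Q, ∀ j ∈ R, j ∈ Finset.Icc 1 n ∧ p j = k := fun R hR j hj =>
    Finset.mem_filter.1 (Finset.mem_powerset.1 hR hj)
  have hmono : ∀ R ∈ Q, ∀ x : (ℕ → Space d) × (ℕ → CVec d),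
      dot (x.1 k) (x.2 (n + 1)) * mono (fun j => if j ∈ R then n + 1 else p j) n x.1 x.2 =
        mono (pR R) (n + 1) x.1 x.2 := by
    intro R hR x
    have hN : n + 1 ∉ R := fun hN => by have := Finset.mem_Icc.1 (hRsub R hR _ hN).1; omega
    have e : pR R (n + 1) = k := by simp [pR, hN]
    rw [mono_succ, e, mul_comm]
    congr 1
    refine mono_congr (fun j hj => ?_) _ _
    have : j ≠ n + 1 := by have := Finset.mem_Icc.1 hj; omega
    simp [pR, this]
  have hQ0 : ∅ ∈ Q := Finset.empty_mem_powerset _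
  have main : symStep n k (term a n p S I) = term a (n + 1) (pR ∅) S (insert (n + 1) I) -
      ∑ R ∈ Q.erase ∅, term a (n + 1) (pR R) (insert (n + 1) S) I := by
    funext x
    have e1 : mdiff a (shift (n + 1) k x.1) I (∑ i ∈ S, shift (n + 1) k x.1 i) =
        mdiff a x.1 I (∑ i ∈ insert (n + 1) S, x.1 i) := by
      rw [sum_shift_of_mem hk hNS]
      exact mdiff_congr a (fun i hi => shift_of_ne (ne_of_mem_of_not_mem hi hkI) _) _
    have e2 : mdiff a x.1 (insert (n + 1) I) (∑ i ∈ S, x.1 i) =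
        mdiff a x.1 I (∑ i ∈ S, x.1 i) - mdiff a x.1 I (∑ i ∈ insert (n + 1) S, x.1 i) := by
      rw [mdiff_insert a x.1 hNI, Finset.sum_insert hNS, add_comm (x.1 (n + 1))]
    have e3 : mono p n x.1 x.2 = mono (fun j => if j ∈ (∅ : Finset ℕ) then n + 1 else p j) n x.1 x.2 :=
      mono_congr (fun j _ => by simp) _ _
    change dot (x.1 k) (x.2 (n + 1)) • (term a n p S I x - term a n p S I (shift (n + 1) k x.1, x.2))
      = _
    simp only [Pi.sub_apply, Finset.sum_apply, term]
    have e4 : dot (x.1 k) (x.2 (n + 1)) * mono p n (shift (n + 1) k x.1) x.2 =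
        mono (pR ∅) (n + 1) x.1 x.2 + ∑ R ∈ Q.erase ∅, mono (pR R) (n + 1) x.1 x.2 := by
      rw [mono_shift, ← hQ, Finset.mul_sum, ← Finset.add_sum_erase Q _ hQ0, hmono ∅ hQ0]
      congr 1
      exact Finset.sum_congr rfl fun R hR => hmono R (Finset.mem_of_mem_erase hR) x
    rw [e1, e2, ← Finset.sum_smul, smul_sub, smul_smul, smul_smul, e4, e3, hmono ∅ hQ0]
    generalize mdiff a x.1 I (∑ i ∈ S, x.1 i) = U
    generalize mdiff a x.1 I (∑ i ∈ insert (n + 1) S, x.1 i) = V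
    rw [_root_.sub_apply]
    module
  rw [main]
  have hN : ∀ R ∈ Q, pR R (n + 1) = k := fun R hR => by
    have hN : n + 1 ∉ R := fun hN => by have := Finset.mem_Icc.1 (hRsub R hR _ hN).1; omega
    simp [pR, hN]
  have hp : ∀ R, ∀ j ∈ Finset.Icc 1 n, j ∉ R → pR R j = p j := fun R j hj hjR => by
    have : j ≠ n + 1 := by have := Finset.mem_Icc.1 hj; omega
    simp [pR, this, hjR]
  have hIcc : ∀ j ∈ Finset.Icc 1 (n + 1), j ∈ Finset.Icc 1 n ∨ j = n + 1 := fun j hj => by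
    simp only [Finset.mem_Icc] at hj ⊢; omega
  have hIcc' : ∀ j ∈ Finset.Icc 1 n, j ∈ Finset.Icc 1 (n + 1) := fun j hj => by
    simp only [Finset.mem_Icc] at hj ⊢; omega
  refine Submodule.sub_mem _ (Submodule.subset_span ⟨_, _, _, ⟨h.zero_mem, ?_, ?_, ?_, ?_⟩, rfl⟩)
    (Submodule.sum_mem _ fun R hR =>
      Submodule.subset_span ⟨_, _, _, ⟨Finset.mem_insert_of_mem h.zero_mem, ?_, ?_, ?_, ?_⟩, rfl⟩)
  · exact Finset.disjoint_insert_right.2 ⟨hNS, h.disj⟩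
  · rw [Finset.union_insert, h.union, ← Finset.range_add_one]
  · intro j hj
    rcases hIcc j hj with hj' | rfl
    · rw [hp ∅ j hj' (by simp)]; exact h.maps j hj'
    · rw [hN ∅ hQ0]; exact hk
  · intro i hi hi0
    obtain ⟨j, hj, rfl⟩ := h.surj i hi hi0
    exact ⟨j, hIcc' j hj, hp ∅ j hj (by simp)⟩
  · exact Finset.disjoint_insert_left.2 ⟨hNI, h.disj⟩
  · rw [Finset.insert_union, h.union, ← Finset.range_add_one]
  · intro j hj
    by_cases hjR : j ∈ R
    · simp [pR, hjR]
    rcases hIcc j hj with hj' | rfl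
    · rw [hp R j hj' hjR]; exact Finset.mem_insert_of_mem (h.maps j hj')
    · rw [hN R (Finset.mem_of_mem_erase hR)]; exact Finset.mem_insert_of_mem hk
  · intro i hi hi0
    have hRQ := Finset.mem_of_mem_erase hR
    rcases Finset.mem_insert.1 hi with rfl | hiS
    · obtain ⟨j, hj⟩ := Finset.nonempty_iff_ne_empty.2 (Finset.ne_of_mem_erase hR)
      exact ⟨j, hIcc' j (hRsub R hRQ j hj).1, by simp [pR, hj]⟩
    -- The vertex k may lose all its old children to n + 1, but then n + 1 itself is a child of k.
    · by_cases hik : i = k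
      · exact ⟨n + 1, by simp, by rw [hN R hRQ, hik]⟩
      · obtain ⟨j, hj, rfl⟩ := h.surj i hiS hi0
        exact ⟨j, hIcc' j hj, hp R j hj fun hjR => hik (hRsub R hRQ j hjR).2⟩

/-- No factor of the monomial involves the leaf k, so only the difference in direction ξ_k changes:
with g the difference in the other directions, (g(y) - g(y + ξ_k)) - (g(y) - g(y + ξ_k + ξ_{n+1}))
is minus the difference of g in direction ξ_{n+1} at y + ξ_k. Thus k becomes an inner vertex and n +
1 a leaf attached to it. -/
theorem symStep_term_mem_of_mem_leaves {n k : ℕ} {p : ℕ → ℕ} {S I : Finset ℕ}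
    (h : Admissible n p S I) (hk : k ∈ I) :
    symStep n k (term a n p S I) ∈ termSpan a (n + 1) := by
  have hlt : ∀ i ∈ S ∪ I, i < n + 1 := fun i hi => by
    rw [h.union] at hi; exact Finset.mem_range.1 hi
  have hNS : n + 1 ∉ S := fun hN => absurd (hlt _ (Finset.mem_union_left _ hN)) (by omega)
  have hNI : n + 1 ∉ I := fun hN => absurd (hlt _ (Finset.mem_union_right _ hN)) (by omega)
  have hkS : k ∉ S := Finset.disjoint_right.1 h.disj hk
  have hkN : n + 1 ≠ k := fun e => hNI (e ▸ hk)
  set I0 := I.erase k with hI0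
  have hkI0 : k ∉ I0 := Finset.notMem_erase k I
  have hNI0 : n + 1 ∉ I0 := fun hN => hNI (Finset.mem_of_mem_erase hN)
  have hI : I = insert k I0 := (Finset.insert_erase hk).symm
  have hNkS : n + 1 ∉ insert k S := by simp [hNS, hkN]
  have main : symStep n k (term a n p S I) =
      -term a (n + 1) (Function.update p (n + 1) k) (insert k S) (insert (n + 1) I0) := by
    funext x
    have e0 : ∀ y, mdiff a (shift (n + 1) k x.1) I0 y = mdiff a x.1 I0 y := fun y =>
      mdiff_congr a (fun i hi => shift_of_ne (ne_of_mem_of_not_mem hi hkI0) _) _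
    have e1 : mdiff a (shift (n + 1) k x.1) I (∑ i ∈ S, shift (n + 1) k x.1 i) =
        mdiff a x.1 I0 (∑ i ∈ S, x.1 i) - mdiff a x.1 I0 (∑ i ∈ insert (n + 1) (insert k S), x.1 i) := by
      rw [hI, mdiff_insert _ _ hkI0, e0, e0, ← sum_shift_of_mem (Finset.mem_insert_self k S) hNkS,
        Finset.sum_insert hkS, add_comm (shift (n + 1) k x.1 k),
        Finset.sum_congr rfl fun i hi => shift_of_ne (ne_of_mem_of_not_mem hi hkS) x.1]
    have e2 : mdiff a x.1 I (∑ i ∈ S, x.1 i) =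
        mdiff a x.1 I0 (∑ i ∈ S, x.1 i) - mdiff a x.1 I0 (∑ i ∈ insert k S, x.1 i) := by
      rw [hI, mdiff_insert a x.1 hkI0, Finset.sum_insert hkS, add_comm (x.1 k)]
    have e3 : mdiff a x.1 (insert (n + 1) I0) (∑ i ∈ insert k S, x.1 i) =
        mdiff a x.1 I0 (∑ i ∈ insert k S, x.1 i)
          - mdiff a x.1 I0 (∑ i ∈ insert (n + 1) (insert k S), x.1 i) := by
      rw [mdiff_insert a x.1 hNI0, Finset.sum_insert hNkS, add_comm (x.1 (n + 1))]
    have e4 : mono p n (shift (n + 1) k x.1) x.2 = mono p n x.1 x.2 :=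
      Finset.prod_congr rfl fun j hj => by
        rw [shift_of_ne (ne_of_mem_of_not_mem (h.maps j hj) hkS)]
    have e5 : mono (Function.update p (n + 1) k) (n + 1) x.1 x.2 =
        dot (x.1 k) (x.2 (n + 1)) * mono p n x.1 x.2 := by
      rw [mono_succ, Function.update_self, mul_comm]
      congr 1
      refine mono_congr (fun j hj => Function.update_of_ne ?_ _ _) _ _
      have := Finset.mem_Icc.1 hj; omega
    change dot (x.1 k) (x.2 (n + 1)) • (term a n p S I x - term a n p S I (shift (n + 1) k x.1, x.2))
      = _
    simp only [Pi.neg_apply, term]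
    rw [e1, e2, e3, e4, e5]
    rw [_root_.sub_apply, _root_.sub_apply, _root_.sub_apply]
    module
  rw [main]
  refine Submodule.neg_mem _ (Submodule.subset_span ⟨_, _, _,
    ⟨Finset.mem_insert_of_mem h.zero_mem, ?_, ?_, ?_, ?_⟩, rfl⟩)
  · refine Finset.disjoint_insert_left.2 ⟨by simp [hkN.symm, hkI0], ?_⟩
    exact Finset.disjoint_insert_right.2 ⟨hNS, h.disj.mono_right (Finset.erase_subset _ _)⟩
  · rw [Finset.union_insert, Finset.insert_union, ← Finset.union_insert, ← hI, h.union,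
      ← Finset.range_add_one]
  · intro j hj
    by_cases hj' : j = n + 1
    · subst hj'; rw [Function.update_self]; exact Finset.mem_insert_self _ _
    · rw [Function.update_of_ne hj']
      refine Finset.mem_insert_of_mem (h.maps j ?_)
      simp only [Finset.mem_Icc] at hj ⊢; omega
  · intro i hi hi0
    rcases Finset.mem_insert.1 hi with rfl | hiS
    · exact ⟨n + 1, by simp, Function.update_self _ _ _⟩
    · obtain ⟨j, hj, rfl⟩ := h.surj i hiS hi0
      have := Finset.mem_Icc.1 hj
      exact ⟨j, by simp only [Finset.mem_Icc]; omega, Function.update_of_ne (by omega) _ _⟩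

theorem sym_mem_termSpan (n : ℕ) :
    (fun x : (ℕ → Space d) × (ℕ → CVec d) => sym a n x.1 x.2) ∈ termSpan a n := by
  induction n with
  | zero =>
    -- For n = 0 there are no edges, so the choice of the parent map is immaterial.
    refine Submodule.subset_span ⟨id, {0}, ∅, ⟨by simp, by simp, by simp, by simp, by simp⟩, ?_⟩
    funext x
    simp [term, mono, mdiff_empty, sym]
  | succ n ih =>
    have h : (fun x : (ℕ → Space d) × (ℕ → CVec d) => sym a (n + 1) x.1 x.2) =
        (2 * Real.pi * Complex.I : ℂ) • ∑ k ∈ Finset.range (n + 1),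
          symStep n k (fun x : (ℕ → Space d) × (ℕ → CVec d) => sym a n x.1 x.2) := by
      funext x
      simp only [Pi.smul_apply, Finset.sum_apply]
      rfl
    rw [h]
    refine Submodule.smul_mem _ _ (Submodule.sum_mem _ fun k hk => ?_)
    have hle : termSpan a n ≤ (termSpan a (n + 1)).comap (symStep n k) := by
      refine Submodule.span_le.2 ?_
      rintro _ ⟨p, S, I, hA, rfl⟩
      rw [← hA.union] at hk
      rcases Finset.mem_union.1 hk with hk | hk
      · exact symStep_term_mem_of_mem hA hk
      · exact symStep_term_mem_of_mem_leaves hA hk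
    exact hle ih

end Expansion

/-! ### Bounds for the symbols -/

section Bounds

variable {d : ℕ} {r : ℝ} {a : Space d → (CVec d →L[ℂ] CVec d)}

theorem SymbolClass.exists_bound (ha : SymbolClass r a) (k : ℕ) :
    ∃ C : ℝ, 0 ≤ C ∧ ∀ ξ : Space d, ‖iteratedFDeriv ℝ k a ξ‖ ≤ C * lam (r - k) ξ := by
  choose C hC using ha.2 k
  refine ⟨∑ i, |C i|, by positivity, fun ξ => ?_⟩
  have hnn : 0 ≤ (∑ i, |C i|) * lam (r - k) ξ := mul_nonneg (by positivity) (lam_nonneg _ _)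
  refine ContinuousMultilinearMap.opNorm_le_bound hnn fun m => ?_
  have hm : m = fun j => ∑ l : Fin d, (m j l) • EuclideanSpace.single l (1 : ℝ) := by
    funext j
    ext l
    simp [Finset.sum_apply, Pi.single_apply]
  have h1 : iteratedFDeriv ℝ k a ξ m =
      ∑ i : Fin k → Fin d, (∏ j, m j (i j)) • partialDeriv a i ξ := by
    conv_lhs => rw [hm]
    rw [ContinuousMultilinearMap.map_sum]
    refine Finset.sum_congr rfl fun i _ => ?_
    rw [ContinuousMultilinearMap.map_smul_univ]; rfl
  rw [h1, Finset.sum_mul, Finset.sum_mul]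
  refine (norm_sum_le _ _).trans (Finset.sum_le_sum fun i _ => ?_)
  rw [norm_smul, norm_prod, mul_comm]
  refine mul_le_mul ((hC i ξ).trans ?_) ?_ (by positivity) (mul_nonneg (abs_nonneg _)
    (lam_nonneg _ _))
  · exact mul_le_mul_of_nonneg_right (le_abs_self _) (lam_nonneg _ _)
  · exact Finset.prod_le_prod (fun _ _ => norm_nonneg _) fun j _ => PiLp.norm_apply_le (m j) (i j)

/-- λ_1(ξ) and λ_1(ξ + v) differ by at most a factor 2 in either direction. Both are needed, since
the exponent r - |I| may be negative. -/
theorem lam_le_of_near (s : ℝ) {ξ v : Space d} (hv : ‖v‖ ≤ lam 1 ξ / 2) :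
    lam s (ξ + v) ≤ 2 ^ |s| * lam s ξ := by
  have h1 : lam 1 (ξ + v) ≤ 2 * lam 1 ξ := by
    have := lam_one_add_le ξ v
    have := lam_nonneg 1 ξ
    linarith
  have h2 : lam 1 ξ ≤ 2 * lam 1 (ξ + v) := by
    have := lam_one_add_le (ξ + v) (-v)
    rw [add_neg_cancel_right, norm_neg] at this
    linarith
  have p1 := lam_pos 1 ξ
  have p2 := lam_pos 1 (ξ + v)
  rw [lam_eq_rpow s ξ, lam_eq_rpow s (ξ + v)]
  rcases le_or_gt 0 s with hs | hs
  · rw [abs_of_nonneg hs, ← Real.mul_rpow (by norm_num) p1.le]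
    exact Real.rpow_le_rpow p2.le h1 hs
  · rw [abs_of_neg hs, Real.rpow_neg (by norm_num), inv_mul_eq_div, le_div_iff₀ (by positivity),
      mul_comm, ← Real.mul_rpow (by norm_num) p2.le]
    exact Real.rpow_le_rpow_of_nonpos p1 h2 hs.le

/-- Each i ∈ S other than 0 has a child, and choosing one child for each is injective. These
children account for the factors w i with i ∈ S \ {0}. The number of remaining edges is n - |S \
{0}| = |I|, and each of them contributes at most B. -/
theorem Admissible.prod_le {n : ℕ} {p : ℕ → ℕ} {S I : Finset ℕ} (h : Admissible n p S I)
    {w : ℕ → ℝ} {B : ℝ} (h0 : ∀ i, 0 ≤ w i) (hB : ∀ i ∈ Finset.range (n + 1), w i ≤ B) :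
    (∏ j ∈ Finset.Icc 1 n, w (p j)) * ∏ i ∈ I, w i ≤ B ^ I.card * ∏ j ∈ Finset.Icc 1 n, w j := by
  have h0I : 0 ∉ I := Finset.disjoint_left.1 h.disj h.zero_mem
  have hU : Finset.Icc 1 n = S.erase 0 ∪ I := by
    ext i
    have := congrArg (i ∈ ·) h.union
    simp only [Finset.mem_union, Finset.mem_range, eq_iff_iff] at this
    simp only [Finset.mem_Icc, Finset.mem_union, Finset.mem_erase]
    constructor
    · rintro ⟨h1, h2⟩
      rcases this.2 (by omega) with h3 | h3
      · exact Or.inl ⟨by omega, h3⟩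
      · exact Or.inr h3
    · rintro (⟨h1, h2⟩ | h2)
      · have := this.1 (Or.inl h2); omega
      · have := this.1 (Or.inr h2)
        have : i ≠ 0 := fun e => h0I (e ▸ h2)
        omega
  have hD : Disjoint (S.erase 0) I := h.disj.mono_left (Finset.erase_subset _ _)
  choose! g hg hpg using fun i (hi : i ∈ S.erase 0) =>
    h.surj i (Finset.mem_of_mem_erase hi) (Finset.ne_of_mem_erase hi)
  have hinj : Set.InjOn g (S.erase 0 : Finset ℕ) := fun i hi j hj e => by
    rw [← hpg i hi, ← hpg j hj, e]
  have hT : (S.erase 0).image g ⊆ Finset.Icc 1 n := Finset.image_subset_iff.2 hg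
  have hcard : (Finset.Icc 1 n \ (S.erase 0).image g).card = I.card := by
    rw [Finset.card_sdiff_of_subset hT, Finset.card_image_of_injOn hinj, hU,
      Finset.card_union_of_disjoint hD]
    omega
  have h1 : ∏ j ∈ (S.erase 0).image g, w (p j) = ∏ i ∈ S.erase 0, w i := by
    rw [Finset.prod_image hinj]
    exact Finset.prod_congr rfl fun i hi => by rw [hpg i hi]
  have h2 : ∏ j ∈ Finset.Icc 1 n \ (S.erase 0).image g, w (p j) ≤ B ^ I.card := by
    rw [← hcard]
    rw [← Finset.prod_const]
    refine Finset.prod_le_prod (fun j _ => h0 _) fun j hj => hB _ ?_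
    rw [← h.union]
    exact Finset.mem_union_left _ (h.maps j (Finset.mem_sdiff.1 hj).1)
  rw [← Finset.prod_sdiff hT, h1]
  conv_rhs => rw [hU, Finset.prod_union hD]
  rw [mul_assoc]
  exact mul_le_mul_of_nonneg_right h2 (mul_nonneg (Finset.prod_nonneg fun _ _ => h0 _)
    (Finset.prod_nonneg fun _ _ => h0 _))

/-- The multiple difference gives λ_{r-|I|}(ξ_0) ∏_I λ_1(ξ_i), and by `Admissible.prod_le` the
monomial has at most |I| surplus factors, each at most λ_1(ξ_0). The total order in ξ_0 is again r.
-/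
theorem Admissible.norm_term_le (ha : SymbolClass r a) {n : ℕ} {p : ℕ → ℕ} {S I : Finset ℕ}
    (h : Admissible n p S I) : ∃ C : ℝ, 0 ≤ C ∧ ∀ (ξ : ℕ → Space d) (c : ℕ → CVec d),
      ∑ j ∈ Finset.Icc 1 n, lam 1 (ξ j) ≤ lam 1 (ξ 0) / 2 →
      ‖term a n p S I (ξ, c)‖ ≤ C * (lam r (ξ 0) * (∏ j ∈ Finset.Icc 1 n, lam 1 (ξ j)) *
        ((∏ j ∈ Finset.Icc 1 n, ‖c j‖) * ‖c 0‖)) := by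
  obtain ⟨C, hC0, hC⟩ := ha.exists_bound I.card
  refine ⟨C * 2 ^ |r - I.card|, by positivity, fun ξ c hξ => ?_⟩
  have h0I : 0 ∉ I := Finset.disjoint_left.1 h.disj h.zero_mem
  have hsub : S.erase 0 ∪ I ⊆ Finset.Icc 1 n := fun i hi => by
    have hi' : i ∈ S ∪ I ∧ i ≠ 0 := by
      rcases Finset.mem_union.1 hi with hi | hi
      · exact ⟨Finset.mem_union_left _ (Finset.mem_of_mem_erase hi), Finset.ne_of_mem_erase hi⟩
      · exact ⟨Finset.mem_union_right _ hi, fun e => h0I (e ▸ hi)⟩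
    rw [h.union, Finset.mem_range] at hi'
    rw [Finset.mem_Icc]; omega
  have hD : Disjoint (S.erase 0) I := h.disj.mono_left (Finset.erase_subset _ _)
  -- S \ {0} and I are disjoint subsets of {1, …, n}, so every point at which `a` is differentiated
  -- lies within λ_1(ξ_0)/2 of ξ_0.
  have hsum : ∑ i ∈ S.erase 0, ‖ξ i‖ + ∑ i ∈ I, ‖ξ i‖ ≤ lam 1 (ξ 0) / 2 := by
    rw [← Finset.sum_union hD]
    exact ((Finset.sum_le_sum_of_subset_of_nonneg hsub fun _ _ _ => norm_nonneg _).trans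
      (Finset.sum_le_sum fun i _ => norm_le_lam_one (ξ i))).trans hξ
  have hm : ‖mdiff a ξ I (∑ i ∈ S, ξ i)‖ ≤
      C * (2 ^ |r - I.card| * lam (r - I.card) (ξ 0)) * ∏ i ∈ I, lam 1 (ξ i) := by
    refine (norm_mdiff_le ha.1 ξ I _ (C := C * (2 ^ |r - I.card| * lam (r - I.card) (ξ 0)))
      fun v hv => ?_).trans ?_
    · rw [← Finset.add_sum_erase S ξ h.zero_mem, add_assoc]
      refine (hC _).trans (mul_le_mul_of_nonneg_left (lam_le_of_near _ ?_) hC0)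
      refine (norm_add_le _ _).trans (le_trans ?_ hsum)
      exact add_le_add (norm_sum_le _ _) hv
    · refine mul_le_mul_of_nonneg_left (Finset.prod_le_prod (fun _ _ => norm_nonneg _)
        fun i _ => norm_le_lam_one _) ?_
      have := lam_nonneg (r - I.card) (ξ 0)
      positivity
  have hmono : ‖mono p n ξ c‖ ≤ (∏ j ∈ Finset.Icc 1 n, lam 1 (ξ (p j))) *
      ∏ j ∈ Finset.Icc 1 n, ‖c j‖ := by
    rw [mono, norm_prod, ← Finset.prod_mul_distrib]
    exact Finset.prod_le_prod (fun _ _ => norm_nonneg _) fun j _ => norm_dot_le_lam _ _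
  have hw := h.prod_le (w := fun i => lam 1 (ξ i)) (B := lam 1 (ξ 0)) (fun i => lam_nonneg _ _)
    (fun i hi => by
      rcases Nat.eq_zero_or_pos i with rfl | hi0
      · exact le_rfl
      · have h1 : lam 1 (ξ i) ≤ ∑ j ∈ Finset.Icc 1 n, lam 1 (ξ j) :=
          Finset.single_le_sum (f := fun j => lam 1 (ξ j)) (fun _ _ => lam_nonneg _ _)
            (Finset.mem_Icc.2 ⟨hi0, Nat.lt_succ_iff.1 (Finset.mem_range.1 hi)⟩)
        have := lam_nonneg 1 (ξ 0)
        linarith)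
  have hlam : lam (r - I.card) (ξ 0) * lam 1 (ξ 0) ^ I.card = lam r (ξ 0) := by
    rw [← Real.rpow_natCast, ← lam_eq_rpow, ← lam_add, sub_add_cancel]
  have hterm : ‖term a n p S I (ξ, c)‖ ≤ ((∏ j ∈ Finset.Icc 1 n, lam 1 (ξ (p j))) *
      ∏ j ∈ Finset.Icc 1 n, ‖c j‖) * ((C * (2 ^ |r - I.card| * lam (r - I.card) (ξ 0)) *
        ∏ i ∈ I, lam 1 (ξ i)) * ‖c 0‖) := by
    rw [term, norm_smul]
    refine mul_le_mul hmono ((ContinuousLinearMap.le_opNorm _ _).trans ?_) (norm_nonneg _) ?_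
    · exact mul_le_mul_of_nonneg_right hm (norm_nonneg _)
    · exact mul_nonneg (Finset.prod_nonneg fun _ _ => lam_nonneg _ _)
        (Finset.prod_nonneg fun _ _ => norm_nonneg _)
  have hK : 0 ≤ C * 2 ^ |r - I.card| * lam (r - I.card) (ξ 0) *
      ((∏ j ∈ Finset.Icc 1 n, ‖c j‖) * ‖c 0‖) :=
    mul_nonneg (mul_nonneg (by positivity) (lam_nonneg _ _))
      (mul_nonneg (Finset.prod_nonneg fun _ _ => norm_nonneg _) (norm_nonneg _))
  calc ‖term a n p S I (ξ, c)‖ ≤ _ := hterm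
    _ = C * 2 ^ |r - I.card| * lam (r - I.card) (ξ 0) *
      ((∏ j ∈ Finset.Icc 1 n, ‖c j‖) * ‖c 0‖) * ((∏ j ∈ Finset.Icc 1 n, lam 1 (ξ (p j))) *
        ∏ i ∈ I, lam 1 (ξ i)) := by ring
    _ ≤ C * 2 ^ |r - I.card| * lam (r - I.card) (ξ 0) *
      ((∏ j ∈ Finset.Icc 1 n, ‖c j‖) * ‖c 0‖) * (lam 1 (ξ 0) ^ I.card *
        ∏ j ∈ Finset.Icc 1 n, lam 1 (ξ j)) := mul_le_mul_of_nonneg_left hw hK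
    _ = _ := by rw [← hlam]; ring

theorem sym_bound_near (ha : SymbolClass r a) (n : ℕ) :
    ∃ C : ℝ, 0 ≤ C ∧ ∀ (ξ : ℕ → Space d) (c : ℕ → CVec d),
      ∑ j ∈ Finset.Icc 1 n, lam 1 (ξ j) ≤ lam 1 (ξ 0) / 2 →
      ‖sym a n ξ c‖ ≤ C * (lam r (ξ 0) * (∏ j ∈ Finset.Icc 1 n, lam 1 (ξ j)) *
        ((∏ j ∈ Finset.Icc 1 n, ‖c j‖) * ‖c 0‖)) := by
  suffices h : ∀ F ∈ termSpan a n, ∃ C : ℝ, 0 ≤ C ∧ ∀ (ξ : ℕ → Space d) (c : ℕ → CVec d),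
      ∑ j ∈ Finset.Icc 1 n, lam 1 (ξ j) ≤ lam 1 (ξ 0) / 2 →
      ‖F (ξ, c)‖ ≤ C * (lam r (ξ 0) * (∏ j ∈ Finset.Icc 1 n, lam 1 (ξ j)) *
        ((∏ j ∈ Finset.Icc 1 n, ‖c j‖) * ‖c 0‖)) from
    h (fun x => sym a n x.1 x.2) (sym_mem_termSpan n)
  intro F hF
  induction hF using Submodule.span_induction with
  | mem F hF =>
    obtain ⟨p, S, I, hA, rfl⟩ := hF
    exact hA.norm_term_le ha
  | zero => exact ⟨0, le_rfl, fun ξ c _ => by simp⟩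
  | add F G _ _ hF hG =>
    obtain ⟨C, hC0, hC⟩ := hF
    obtain ⟨D, hD0, hD⟩ := hG
    refine ⟨C + D, by positivity, fun ξ c hξ => ?_⟩
    rw [add_mul]
    exact (norm_add_le _ _).trans (add_le_add (hC ξ c hξ) (hD ξ c hξ))
  | smul z F _ hF =>
    obtain ⟨C, hC0, hC⟩ := hF
    refine ⟨‖z‖ * C, by positivity, fun ξ c hξ => ?_⟩
    rw [Pi.smul_apply, norm_smul, mul_assoc]
    exact mul_le_mul_of_nonneg_left (hC ξ c hξ) (norm_nonneg _)

/-- The sum of the weights. -/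
noncomputable def wsum (n : ℕ) (ξ : ℕ → Space d) : ℝ := ∑ j ∈ Finset.range (n + 1), lam 1 (ξ j)

/-- The bound for the symbol of `A_n`. -/
noncomputable def symBound (r : ℝ) (n : ℕ) (ξ : ℕ → Space d) (c : ℕ → CVec d) : ℝ :=
  wsum n ξ ^ (r - 1) * ∏ j ∈ Finset.range (n + 1), (lam 1 (ξ j) * ‖c j‖)

theorem wsum_nonneg (n : ℕ) (ξ : ℕ → Space d) : 0 ≤ wsum n ξ :=
  Finset.sum_nonneg fun _ _ => lam_nonneg _ _

theorem lam_le_wsum {n k : ℕ} (hk : k ≤ n) (ξ : ℕ → Space d) : lam 1 (ξ k) ≤ wsum n ξ :=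
  Finset.single_le_sum (f := fun j => lam 1 (ξ j)) (fun _ _ => lam_nonneg _ _)
    (Finset.mem_range.2 (by omega))

theorem symBound_nonneg (r : ℝ) (n : ℕ) (ξ : ℕ → Space d) (c : ℕ → CVec d) :
    0 ≤ symBound r n ξ c :=
  mul_nonneg (Real.rpow_nonneg (wsum_nonneg n ξ) _)
    (Finset.prod_nonneg fun _ _ => mul_nonneg (lam_nonneg _ _) (norm_nonneg _))

theorem range_succ_eq_insert (n : ℕ) : Finset.range (n + 1) = insert 0 (Finset.Icc 1 n) := by
  ext i
  simp only [Finset.mem_range, Finset.mem_insert, Finset.mem_Icc]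
  omega

theorem mem_range_swap {n i : ℕ} (hin : i + 1 ≤ n) (k : ℕ) :
    k ∈ Finset.range (n + 1) ↔ Equiv.swap i (i + 1) k ∈ Finset.range (n + 1) := by
  simp only [Finset.mem_range, Equiv.swap_apply_def]
  split_ifs <;> omega

theorem wsum_swap {n i : ℕ} (hin : i + 1 ≤ n) (ξ : ℕ → Space d) :
    wsum n (ξ ∘ Equiv.swap i (i + 1)) = wsum n ξ :=
  Finset.sum_equiv (Equiv.swap i (i + 1)) (mem_range_swap hin) fun _ _ => rfl

theorem symBound_swap {n i : ℕ} (hin : i + 1 ≤ n) (ξ : ℕ → Space d) (c : ℕ → CVec d) :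
    symBound r n (ξ ∘ Equiv.swap i (i + 1)) (c ∘ Equiv.swap i (i + 1)) = symBound r n ξ c := by
  rw [symBound, symBound, wsum_swap hin]
  congr 1
  exact Finset.prod_equiv (Equiv.swap i (i + 1)) (mem_range_swap hin) fun _ _ => rfl

/-- Subadditivity of λ_1: merging ξ_{n+1} into slot k does not increase the total weight. -/
theorem sum_range_le_of_shift {n k : ℕ} (hk : k ≤ n) (ξ : ℕ → Space d) :
    wsum n (shift (n + 1) k ξ) ≤ wsum (n + 1) ξ := by
  have hk' : k ∈ Finset.range (n + 1) := Finset.mem_range.2 (by omega)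
  rw [wsum, wsum, Finset.sum_range_succ _ (n + 1), ← Finset.add_sum_erase _ _ hk',
    ← Finset.add_sum_erase _ (fun j => lam 1 (ξ j)) hk', shift_self,
    Finset.sum_congr rfl fun j hj => by rw [shift_of_ne (Finset.ne_of_mem_erase hj)]]
  have := lam_one_add_le' (ξ k) (ξ (n + 1))
  linarith

/-- Arithmetic for `sym_bound_last`: x is the pairing, s the difference of symbols, l and l' the
weights of ξ_k before and after the shift, L the weight of ξ_{n+1}. The pairing keeps one l for slot
k, while the l or l' inside s is exchanged for K L. -/
theorem mul_le_of_weights {x s l l' N C R e V K L : ℝ} (hx : x ≤ l * N)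
    (hs : s ≤ C * (R * (l * e * V)) + C * (R * (l' * e * V))) (hl : l ≤ K * L) (hl' : l' ≤ K * L)
    (s0 : 0 ≤ s) (l0 : 0 ≤ l) (N0 : 0 ≤ N) (C0 : 0 ≤ C) (R0 : 0 ≤ R) (e0 : 0 ≤ e) (V0 : 0 ≤ V) :
    x * s ≤ 2 * (C * K) * (R * (l * e * V * (L * N))) := by
  have h1 : s ≤ C * (R * (K * L * e * V)) + C * (R * (K * L * e * V)) :=
    hs.trans (by gcongr)
  calc x * s ≤ l * N * (C * (R * (K * L * e * V)) + C * (R * (K * L * e * V))) :=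
        mul_le_mul hx h1 s0 (mul_nonneg l0 N0)
    _ = _ := by ring

/-- No cancellation is needed here. The pairing contributes λ_1(ξ_k), and the lower symbol
contributes λ_1(ξ_k) or λ_1(ξ_k + ξ_{n+1}); both are at most the total weight, hence at most K
λ_1(ξ_{n+1}), which is the weight required for the new slot. The assumption 1 ≤ r makes the power r
- 1 monotone. -/
theorem sym_bound_last (hr : 1 ≤ r) {n : ℕ} {C : ℝ} (hC0 : 0 ≤ C)
    (hC : ∀ (ξ : ℕ → Space d) (c : ℕ → CVec d), ‖sym a n ξ c‖ ≤ C * symBound r n ξ c) {K : ℝ}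
    (ξ : ℕ → Space d) (c : ℕ → CVec d) (hK : wsum (n + 1) ξ ≤ K * lam 1 (ξ (n + 1))) :
    ‖sym a (n + 1) ξ c‖ ≤ 2 * Real.pi * ((n + 1) * (2 * (C * K))) * symBound r (n + 1) ξ c := by
  set M := wsum (n + 1) ξ with hM
  set V := ∏ j ∈ Finset.range (n + 1), (lam 1 (ξ j) * ‖c j‖) with hV
  have hV0 : 0 ≤ V := Finset.prod_nonneg fun _ _ => mul_nonneg (lam_nonneg _ _) (norm_nonneg _)
  have hM0 : 0 ≤ M := wsum_nonneg _ _
  have hMr : 0 ≤ M ^ (r - 1) := Real.rpow_nonneg hM0 _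
  have hB : symBound r (n + 1) ξ c = M ^ (r - 1) * (V * (lam 1 (ξ (n + 1)) * ‖c (n + 1)‖)) := by
    rw [symBound, Finset.prod_range_succ]
  have hsym : ∀ η : ℕ → Space d, wsum n η ≤ M → ∀ W,
      ∏ j ∈ Finset.range (n + 1), (lam 1 (η j) * ‖c j‖) = W →
      ‖sym a n η c‖ ≤ C * (M ^ (r - 1) * W) := by
    rintro η hη W rfl
    refine (hC η c).trans (mul_le_mul_of_nonneg_left ?_ hC0)
    refine mul_le_mul_of_nonneg_right (Real.rpow_le_rpow (wsum_nonneg _ _) hη (by linarith)) ?_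
    exact Finset.prod_nonneg fun _ _ => mul_nonneg (lam_nonneg _ _) (norm_nonneg _)
  have hterm : ∀ k ∈ Finset.range (n + 1),
      ‖dot (ξ k) (c (n + 1)) • (sym a n ξ c - sym a n (shift (n + 1) k ξ) c)‖ ≤
        2 * (C * K) * symBound r (n + 1) ξ c := by
    intro k hk
    have hk' : k ≤ n := Nat.lt_succ_iff.1 (Finset.mem_range.1 hk)
    have hlk : lam 1 (ξ k) ≤ M := lam_le_wsum (by omega) ξ
    have hle : lam 1 (ξ k + ξ (n + 1)) ≤ M := by
      have := lam_le_wsum hk' (shift (n + 1) k ξ)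
      rw [shift_self] at this
      exact this.trans (sum_range_le_of_shift hk' ξ)
    set V' := ∏ j ∈ (Finset.range (n + 1)).erase k, (lam 1 (ξ j) * ‖c j‖) with hV'
    have hV'0 : 0 ≤ V' := Finset.prod_nonneg fun _ _ => mul_nonneg (lam_nonneg _ _) (norm_nonneg _)
    have hVV : V = lam 1 (ξ k) * ‖c k‖ * V' := (Finset.mul_prod_erase _ _ hk).symm
    have h1 := hsym ξ ((Finset.sum_le_sum_of_subset_of_nonneg (Finset.range_mono (by omega))
      fun _ _ _ => lam_nonneg _ _)) _ hVV
    have h2 := hsym (shift (n + 1) k ξ) (sum_range_le_of_shift hk' ξ)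
      (lam 1 (ξ k + ξ (n + 1)) * ‖c k‖ * V') (by
        rw [← Finset.mul_prod_erase _ _ hk, shift_self]
        congr 1
        exact Finset.prod_congr rfl fun j hj => by rw [shift_of_ne (Finset.ne_of_mem_erase hj)])
    have h3 : ‖dot (ξ k) (c (n + 1))‖ ≤ lam 1 (ξ k) * ‖c (n + 1)‖ := norm_dot_le_lam _ _
    have h4 : lam 1 (ξ k) ≤ K * lam 1 (ξ (n + 1)) := hlk.trans hK
    have h5 : lam 1 (ξ k + ξ (n + 1)) ≤ K * lam 1 (ξ (n + 1)) := hle.trans hK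
    have hc := norm_nonneg (c (n + 1))
    have hck := norm_nonneg (c k)
    have hl := lam_nonneg 1 (ξ k)
    rw [norm_smul, hB, hVV]
    exact mul_le_of_weights h3 ((norm_sub_le _ _).trans (add_le_add h1 h2)) h4 h5 (norm_nonneg _)
      hl hc hC0 hMr hck hV'0
  rw [sym, norm_smul]
  have hpi : ‖(2 * Real.pi * Complex.I : ℂ)‖ = 2 * Real.pi := by
    simp [abs_of_pos Real.pi_pos]
  rw [hpi]
  have hsum := (norm_sum_le _ _).trans (Finset.sum_le_sum hterm)
  rw [Finset.sum_const, Finset.card_range, nsmul_eq_mul] at hsum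
  refine (mul_le_mul_of_nonneg_left hsum (by positivity)).trans_eq ?_
  push_cast
  ring

/-- Adjacent transpositions carry the large frequency from position m to the last position; t counts
those still to be made. -/
theorem sym_bound_of_large (hr : 1 ≤ r) {n : ℕ} {C : ℝ} (hC0 : 0 ≤ C)
    (hC : ∀ (ξ : ℕ → Space d) (c : ℕ → CVec d), ‖sym a n ξ c‖ ≤ C * symBound r n ξ c) {K : ℝ}
    (t m : ℕ) (hm : 1 ≤ m) (hmt : m + t = n + 1) (ξ : ℕ → Space d) (c : ℕ → CVec d)
    (hK : wsum (n + 1) ξ ≤ K * lam 1 (ξ m)) :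
    ‖sym a (n + 1) ξ c‖ ≤ 2 * Real.pi * ((n + 1) * (2 * (C * K))) * symBound r (n + 1) ξ c := by
  induction t generalizing m ξ c with
  | zero =>
    obtain rfl : m = n + 1 := by omega
    exact sym_bound_last hr hC0 hC ξ c hK
  | succ t ih =>
    rw [← sym_swap a (n + 1) m hm (by omega) ξ c, ← symBound_swap (by omega : m + 1 ≤ n + 1) ξ c]
    refine ih (m + 1) (by omega) (by omega) _ _ ?_
    rw [wsum_swap (by omega), Function.comp_apply, Equiv.swap_apply_right]
    exact hK

theorem sym_bound (hr : 1 ≤ r) (ha : SymbolClass r a) (n : ℕ) :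
    ∃ C : ℝ, 0 ≤ C ∧ ∀ (ξ : ℕ → Space d) (c : ℕ → CVec d),
      ‖sym a n ξ c‖ ≤ C * symBound r n ξ c := by
  have near : ∀ n : ℕ, ∃ C : ℝ, 0 ≤ C ∧ ∀ (ξ : ℕ → Space d) (c : ℕ → CVec d),
      ∑ j ∈ Finset.Icc 1 n, lam 1 (ξ j) ≤ lam 1 (ξ 0) / 2 →
      ‖sym a n ξ c‖ ≤ C * symBound r n ξ c := by
    intro n
    obtain ⟨C, hC0, hC⟩ := sym_bound_near ha n
    refine ⟨C, hC0, fun ξ c h => (hC ξ c h).trans (mul_le_mul_of_nonneg_left ?_ hC0)⟩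
    have h1 : lam r (ξ 0) ≤ wsum n ξ ^ (r - 1) * lam 1 (ξ 0) := by
      rw [← sub_add_cancel r 1, lam_add, lam_eq_rpow (r - 1), add_sub_cancel_right]
      exact mul_le_mul_of_nonneg_right (Real.rpow_le_rpow (lam_nonneg _ _)
        (lam_le_wsum (by omega) ξ) (by linarith)) (lam_nonneg _ _)
    have h2 : ∀ f : ℕ → ℝ, ∏ j ∈ Finset.range (n + 1), f j = f 0 * ∏ j ∈ Finset.Icc 1 n, f j := by
      intro f
      rw [range_succ_eq_insert, Finset.prod_insert (by simp)]
    rw [symBound, h2, Finset.prod_mul_distrib]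
    have h3 : 0 ≤ (∏ j ∈ Finset.Icc 1 n, lam 1 (ξ j)) * ((∏ j ∈ Finset.Icc 1 n, ‖c j‖) * ‖c 0‖) :=
      mul_nonneg (Finset.prod_nonneg fun _ _ => lam_nonneg _ _)
        (mul_nonneg (Finset.prod_nonneg fun _ _ => norm_nonneg _) (norm_nonneg _))
    calc _ = lam r (ξ 0) * ((∏ j ∈ Finset.Icc 1 n, lam 1 (ξ j)) *
          ((∏ j ∈ Finset.Icc 1 n, ‖c j‖) * ‖c 0‖)) := by ring
      _ ≤ wsum n ξ ^ (r - 1) * lam 1 (ξ 0) * _ := mul_le_mul_of_nonneg_right h1 h3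
      _ = _ := by ring
  induction n with
  | zero =>
    obtain ⟨C, hC0, hC⟩ := near 0
    -- For n = 0 the sum over the other frequencies is empty, so the near region is everything.
    exact ⟨C, hC0, fun ξ c => hC ξ c (by simpa using div_nonneg (lam_nonneg 1 (ξ 0)) zero_le_two)⟩
  | succ n ih =>
    obtain ⟨C, hC0, hC⟩ := ih
    obtain ⟨D, hD0, hD⟩ := near (n + 1)
    -- If each of the n + 1 weights with index ≥ 1 is below a fraction 1/K of the total, their sum
    -- is at most a third of the total, hence at most λ_1(ξ_0)/2, as the near estimate requires.
    set K : ℝ := 3 * (n + 1) with hKdef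
    have hK0 : 0 < K := by positivity
    set C' := 2 * Real.pi * ((n + 1) * (2 * (C * K)))
    have hC'0 : 0 ≤ C' := by positivity
    refine ⟨C' + D, by positivity, fun ξ c => ?_⟩
    have hB := symBound_nonneg r (n + 1) ξ c
    rw [add_mul]
    by_cases h : ∃ m ∈ Finset.Icc 1 (n + 1), wsum (n + 1) ξ ≤ K * lam 1 (ξ m)
    · obtain ⟨m, hm, h⟩ := h
      obtain ⟨hm1, hm2⟩ := Finset.mem_Icc.1 hm
      have := sym_bound_of_large hr hC0 hC (n + 1 - m) m hm1 (by omega) ξ c h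
      exact this.trans (le_add_of_nonneg_right (mul_nonneg hD0 hB))
    · push Not at h
      refine (hD ξ c ?_).trans (le_add_of_nonneg_left (mul_nonneg hC'0 hB))
      have h1 : K * ∑ j ∈ Finset.Icc 1 (n + 1), lam 1 (ξ j) ≤ (n + 1) * wsum (n + 1) ξ := by
        rw [Finset.mul_sum]
        refine (Finset.sum_le_sum fun m hm => (h m hm).le).trans_eq ?_
        simp
      have h2 : wsum (n + 1) ξ = lam 1 (ξ 0) + ∑ j ∈ Finset.Icc 1 (n + 1), lam 1 (ξ j) := by
        rw [wsum, range_succ_eq_insert, Finset.sum_insert (by simp)]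
      rw [h2, hKdef] at h1
      have hn : (0 : ℝ) < n + 1 := by positivity
      have h3 : 3 * ∑ j ∈ Finset.Icc 1 (n + 1), lam 1 (ξ j) ≤
          lam 1 (ξ 0) + ∑ j ∈ Finset.Icc 1 (n + 1), lam 1 (ξ j) := by
        refine le_of_mul_le_mul_left ?_ hn
        linarith
      linarith

end Bounds

/-! ### Rapidly decaying fields and their Fourier transforms -/

section Rapid

variable {d : ℕ}

theorem finrank_space (d : ℕ) : Module.finrank ℝ (Space d) = d := finrank_euclideanSpace_fin

theorem measurable_lam (s : ℝ) : Measurable (lam s : Space d → ℝ) := (continuous_lam s).measurable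

theorem memLp_lam_neg {t : ℝ} (ht : (d : ℝ) / 2 < t) :
    MemLp (lam (-t) : Space d → ℝ) 2 volume := by
  rw [memLp_two_iff_integrable_sq (continuous_lam _).aestronglyMeasurable]
  have h := integrable_rpow_neg_one_add_norm_sq (E := Space d) (μ := volume) (r := 2 * t)
    (by rw [finrank_space]; linarith)
  refine h.congr (Filter.Eventually.of_forall fun ξ => ?_)
  dsimp only
  rw [sq (lam (-t) ξ), ← lam_add, lam]
  congr 1
  ring

/-- Cauchy–Schwarz: λ_{s-q} is in L² as q - s > d/2, and λ_q V is in L² by assumption. -/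
theorem integrable_lam_smul {s q : ℝ} (h : s + (d : ℝ) / 2 < q) {V : Space d → CVec d}
    (hV : MemLp (fun ξ => lam q ξ • V ξ) 2 volume) : Integrable (fun ξ => lam s ξ • V ξ) := by
  have h1 : MemLp (lam (-(q - s)) : Space d → ℝ) 2 volume := memLp_lam_neg (by linarith)
  have h2 := hV.smul h1 (r := 1)
  rw [memLp_one_iff_integrable] at h2
  refine h2.congr (Filter.Eventually.of_forall fun ξ => ?_)
  simp only [Pi.smul_apply', smul_smul, ← lam_add]
  congr 2
  ring

/-- Measurable fields all of whose weighted `L²` norms are finite. -/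
def Rapid (U : Space d → CVec d) : Prop :=
  Measurable U ∧ ∀ s : ℝ, MemLp (fun ξ => lam s ξ • U ξ) 2 volume

theorem Rapid.integrable_lam {U : Space d → CVec d} (hU : Rapid U) (s : ℝ) :
    Integrable (fun ξ => lam s ξ • U ξ) :=
  integrable_lam_smul (q := s + d / 2 + 1) (by linarith) (hU.2 _)

theorem Rapid.integrable {U : Space d → CVec d} (hU : Rapid U) : Integrable U := by
  simpa [lam_zero] using hU.integrable_lam 0

theorem Rapid.memLp {U : Space d → CVec d} (hU : Rapid U) : MemLp U 2 volume := by
  simpa [lam_zero] using hU.2 0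

theorem Rapid.integrable_norm {U : Space d → CVec d} (hU : Rapid U) (s : ℝ) :
    Integrable (fun ξ => lam s ξ * ‖U ξ‖) := by
  refine (hU.integrable_lam s).norm.congr (Filter.Eventually.of_forall fun ξ => ?_)
  simp only [norm_smul, Real.norm_of_nonneg (lam_nonneg s ξ)]

theorem Rapid.of_le {U W : Space d → CVec d} (hU : Rapid U) (hW : Measurable W) {C t : ℝ}
    (h : ∀ ξ, ‖W ξ‖ ≤ C * (lam t ξ * ‖U ξ‖)) : Rapid W := by
  refine ⟨hW, fun s => (hU.2 (s + t)).of_le_mul (c := C)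
    ((measurable_lam s).smul hW).aestronglyMeasurable (Filter.Eventually.of_forall fun ξ => ?_)⟩
  rw [norm_smul, norm_smul, Real.norm_of_nonneg (lam_nonneg _ _),
    Real.norm_of_nonneg (lam_nonneg _ _), lam_add]
  calc _ ≤ lam s ξ * (C * (lam t ξ * ‖U ξ‖)) := mul_le_mul_of_nonneg_left (h ξ) (lam_nonneg _ _)
    _ = _ := by ring

/-- A pointwise bound with d/2 + 1 more orders of decay leaves a square-integrable weight. -/
theorem Rapid.of_forall_le {W : Space d → CVec d} (hW : Measurable W)
    (h : ∀ s : ℝ, 0 ≤ s → ∃ C, ∀ ξ, lam s ξ * ‖W ξ‖ ≤ C) : Rapid W := by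
  refine ⟨hW, fun s => ?_⟩
  obtain ⟨C, hC⟩ := h (|s| + d / 2 + 1) (by positivity)
  refine (memLp_lam_neg (t := (d : ℝ) / 2 + 1) (by linarith)).of_le_mul (c := C)
    ((measurable_lam s).smul hW).aestronglyMeasurable (Filter.Eventually.of_forall fun ξ => ?_)
  rw [norm_smul, Real.norm_of_nonneg (lam_nonneg _ _), Real.norm_of_nonneg (lam_nonneg _ _),
    lam_neg, ← div_eq_mul_inv, le_div_iff₀ (lam_pos _ _)]
  refine le_trans ?_ (hC ξ)
  rw [mul_right_comm, ← lam_add]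
  refine mul_le_mul_of_nonneg_right (lam_mono ?_ ξ) (norm_nonneg _)
  have := le_abs_self s
  linarith

theorem Rapid.add {U W : Space d → CVec d} (hU : Rapid U) (hW : Rapid W) :
    Rapid (fun ξ => U ξ + W ξ) :=
  ⟨hU.1.add hW.1, fun s => by
    simp only [smul_add]
    exact (hU.2 s).add (hW.2 s)⟩

theorem Rapid.sub {U W : Space d → CVec d} (hU : Rapid U) (hW : Rapid W) : Rapid (U - W) :=
  ⟨hU.1.sub hW.1, fun s => by
    simp only [smul_sub, Pi.sub_apply]
    exact (hU.2 s).sub (hW.2 s)⟩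

theorem Rapid.zero : Rapid (0 : Space d → CVec d) := ⟨measurable_const, fun s => by simp⟩

theorem Rapid.sum {ι : Type*} (T : Finset ι) {U : ι → Space d → CVec d}
    (h : ∀ i ∈ T, Rapid (U i)) : Rapid (∑ i ∈ T, U i) := by
  classical
  induction T using Finset.induction_on with
  | empty => simpa using Rapid.zero
  | insert i T hi ih =>
    rw [Finset.sum_insert hi]
    exact (h i (Finset.mem_insert_self _ _)).add
      (ih fun j hj => h j (Finset.mem_insert_of_mem hj))

theorem Rapid.comp_neg {U : Space d → CVec d} (hU : Rapid U) : Rapid fun ξ => U (-ξ) := by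
  refine ⟨hU.1.comp measurable_neg, fun s => ?_⟩
  have h := (hU.2 s).comp_measurePreserving (Measure.measurePreserving_neg volume)
  refine h.ae_eq (Filter.Eventually.of_forall fun ξ => ?_)
  simp [lam]

theorem fourierInv_continuous {U : Space d → CVec d} (hU : Integrable U) :
    Continuous (𝓕⁻ U : Space d → CVec d) := by
  refine VectorFourier.fourierIntegral_continuous Real.continuous_fourierChar ?_ hU
  exact (by fun_prop : Continuous fun p : Space d × Space d => -inner ℝ p.1 p.2)

theorem Rapid.contDiff_fourierInv {U : Space d → CVec d} (hU : Rapid U) :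
    ContDiff ℝ ∞ (𝓕⁻ U : Space d → CVec d) := by
  rw [Real.fourierInv_eq_fourier_comp_neg]
  refine Real.contDiff_fourier (N := ⊤) fun n _ => ?_
  refine (hU.comp_neg.integrable_norm n).mono'
    ((measurable_norm.pow_const n).mul hU.comp_neg.1.norm).aestronglyMeasurable
    (Filter.Eventually.of_forall fun ξ => ?_)
  rw [norm_mul, norm_norm, norm_pow, norm_norm]
  refine mul_le_mul_of_nonneg_right ?_ (norm_nonneg _)
  rw [lam_eq_rpow, Real.rpow_natCast]
  exact pow_le_pow_left₀ (norm_nonneg _) (norm_le_lam_one ξ) n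

/-- The multiplication formula: the inverse Fourier kernel is symmetric in its two variables, so
Fubini applies. -/
theorem integral_fourierInv_smul {g : Space d → ℂ} {f : Space d → CVec d} (hg : Integrable g)
    (hf : Integrable f) : ∫ x, (𝓕⁻ g : Space d → ℂ) x • f x = ∫ x, g x • (𝓕⁻ f : Space d → CVec d) x := by
  have h := VectorFourier.integral_fourierIntegral_smul_eq_flip (μ := volume) (ν := volume)
    (L := -innerₗ (Space d)) (f := g) (g := f) Real.continuous_fourierChar
    (by exact (by fun_prop : Continuous fun p : Space d × Space d => -inner ℝ p.1 p.2)) hg hf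
  have e : (-innerₗ (Space d)).flip = -innerₗ (Space d) := by
    ext x y; simp [real_inner_comm]
  rw [e] at h
  exact h

theorem integral_smul_fourierInv_Lp (f : L2Field d) (G : SchwartzMap (Space d) ℂ) :
    ∫ x, G x • (𝓕⁻ f : L2Field d) x = ∫ x, (𝓕⁻ G : SchwartzMap (Space d) ℂ) x • f x := by
  have h := DFunLike.congr_fun (Lp.fourierInv_toTemperedDistribution_eq f) G
  rw [TemperedDistribution.fourierInv_apply, Lp.toTemperedDistribution_apply,
    Lp.toTemperedDistribution_apply] at h
  exact h.symm

theorem integral_smul_fourier_Lp (f : L2Field d) (G : SchwartzMap (Space d) ℂ) :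
    ∫ x, G x • (𝓕 f : L2Field d) x = ∫ x, (𝓕 G : SchwartzMap (Space d) ℂ) x • f x := by
  have h := DFunLike.congr_fun (Lp.fourier_toTemperedDistribution_eq f) G
  rw [TemperedDistribution.fourier_apply, Lp.toTemperedDistribution_apply,
    Lp.toTemperedDistribution_apply] at h
  exact h.symm

/-- A compactly supported smooth real function, as a complex-valued Schwartz function. -/
noncomputable def toSchwartz (g : Space d → ℝ) (hg : ContDiff ℝ ∞ g) (hc : HasCompactSupport g) :
    SchwartzMap (Space d) ℂ :=
  HasCompactSupport.toSchwartzMap (f := fun x => (g x : ℂ)) (hc.comp_left Complex.ofReal_zero)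
    (Complex.ofRealCLM.contDiff.comp hg)

theorem toSchwartz_apply (g : Space d → ℝ) (hg : ContDiff ℝ ∞ g) (hc : HasCompactSupport g)
    (x : Space d) : toSchwartz g hg hc x = g x := rfl

/-- On `L¹ ∩ L²` the inverse Fourier transform of `L²` is given by the integral. -/
theorem fourierInv_toLp_ae_eq {U : Space d → CVec d} (h1 : Integrable U)
    (h2 : MemLp U 2 volume) : (𝓕⁻ (h2.toLp U) : L2Field d) =ᵐ[volume] (𝓕⁻ U : Space d → CVec d) := by
  -- Both sides are tested against smooth g with compact support: the L² side transfers 𝓕⁻ to g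
  -- through tempered distributions, the L¹ side through Fubini.
  refine ae_eq_of_integral_contDiff_smul_eq ((Lp.memLp _).locallyIntegrable (by norm_num))
    (fourierInv_continuous h1).locallyIntegrable fun g hg hc => ?_
  have e1 := integral_smul_fourierInv_Lp (h2.toLp U) (toSchwartz g hg hc)
  have e2 : ∫ x, (𝓕⁻ (toSchwartz g hg hc) : SchwartzMap (Space d) ℂ) x • (h2.toLp U) x =
      ∫ x, (𝓕⁻ (toSchwartz g hg hc : Space d → ℂ) : Space d → ℂ) x • U x := by
    rw [← SchwartzMap.fourierInv_coe]
    refine integral_congr_ae ?_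
    filter_upwards [h2.coeFn_toLp] with x hx
    rw [hx]
  rw [e2, integral_fourierInv_smul (toSchwartz g hg hc).integrable h1] at e1
  simpa only [toSchwartz_apply, Complex.coe_smul] using e1

theorem Rapid.memLp_fourierInv {U : Space d → CVec d} (hU : Rapid U) :
    MemLp (𝓕⁻ U : Space d → CVec d) 2 volume :=
  (memLp_congr_ae (fourierInv_toLp_ae_eq hU.integrable hU.memLp)).1 (Lp.memLp _)

theorem Rapid.toLp_fourierInv {U : Space d → CVec d} (hU : Rapid U)
    (h : MemLp (𝓕⁻ U : Space d → CVec d) 2 volume) :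
    h.toLp _ = (𝓕⁻ (hU.memLp.toLp U) : L2Field d) :=
  Lp.ext (h.coeFn_toLp.trans (fourierInv_toLp_ae_eq hU.integrable hU.memLp).symm)

theorem Rapid.fourier_toLp_fourierInv {U : Space d → CVec d} (hU : Rapid U)
    (h : MemLp (𝓕⁻ U : Space d → CVec d) 2 volume) :
    (𝓕 (h.toLp _) : L2Field d) = hU.memLp.toLp U := by
  rw [hU.toLp_fourierInv h, FourierTransform.fourier_fourierInv_eq]

theorem Rapid.hat_fourierInv {U : Space d → CVec d} (hU : Rapid U) :
    hat (𝓕⁻ U : Space d → CVec d) =ᵐ[volume] U := by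
  rw [hat, dif_pos hU.memLp_fourierInv, hU.fourier_toLp_fourierInv]
  exact hU.memLp.coeFn_toLp

theorem Rapid.isHInfty_fourierInv {U : Space d → CVec d} (hU : Rapid U) :
    IsHInfty (𝓕⁻ U : Space d → CVec d) := by
  refine ⟨hU.contDiff_fourierInv, hU.memLp_fourierInv, fun q _ => ?_⟩
  change MemLp (fun ξ => lam q ξ • (𝓕 (hU.memLp_fourierInv.toLp _) : L2Field d) ξ) 2 volume
  rw [hU.fourier_toLp_fourierInv]
  refine (hU.2 q).ae_eq ?_
  filter_upwards [hU.memLp.coeFn_toLp] with ξ hξ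
  rw [hξ]

theorem IsHInfty.rapid_hat {u : Space d → CVec d} (hu : IsHInfty u) : Rapid (hat u) := by
  obtain ⟨_, h, hq⟩ := hu
  rw [hat, dif_pos h]
  have hm := (Lp.stronglyMeasurable (𝓕 (h.toLp u) : L2Field d)).measurable
  refine ⟨hm, fun s => ?_⟩
  have h1 : MemLp (fun ξ => lam |s| ξ • (𝓕 (h.toLp u) : L2Field d) ξ) 2 volume :=
    hq |s| (abs_nonneg s)
  refine h1.of_le ((measurable_lam s).smul hm).aestronglyMeasurable
    (Filter.Eventually.of_forall fun ξ => ?_)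
  rw [norm_smul, norm_smul, Real.norm_of_nonneg (lam_nonneg _ _),
    Real.norm_of_nonneg (lam_nonneg _ _)]
  exact mul_le_mul_of_nonneg_right (lam_mono (le_abs_self s) ξ) (norm_nonneg _)

/-- With `IsHInfty.rapid_hat` this makes every element of H^∞ the integral inverse transform of a
rapid field. Equality holds everywhere, because both sides are continuous and agree almost
everywhere. -/
theorem IsHInfty.fourierInv_hat {u : Space d → CVec d} (hu : IsHInfty u) :
    (𝓕⁻ (hat u) : Space d → CVec d) = u := by
  have hR := hu.rapid_hat
  obtain ⟨hc, h, _⟩ := hu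
  have h1 : (𝓕⁻ (hat u) : Space d → CVec d) =ᵐ[volume] u := by
    refine (fourierInv_toLp_ae_eq hR.integrable hR.memLp).symm.trans ?_
    have h2 : hR.memLp.toLp (hat u) = (𝓕 (h.toLp u) : L2Field d) := by
      refine Lp.ext (hR.memLp.coeFn_toLp.trans ?_)
      rw [hat, dif_pos h]
    rw [h2, FourierTransform.fourierInv_fourier_eq]
    exact h.coeFn_toLp
  exact (Continuous.ae_eq_iff_eq volume (fourierInv_continuous hR.integrable)
    hc.continuous).1 h1

end Rapid

/-! ### Submultiplicativity of the weights -/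

section LamProducts

variable {d : ℕ}

theorem lam_add_arg_le {s : ℝ} (hs : 0 ≤ s) (ξ η : Space d) :
    lam s (ξ + η) ≤ 2 ^ s * (lam s ξ * lam s η) := by
  have h1 := one_le_lam zero_le_one ξ
  have h2 := one_le_lam zero_le_one η
  have h : lam 1 (ξ + η) ≤ 2 * (lam 1 ξ * lam 1 η) :=
    (lam_one_add_le' ξ η).trans (by nlinarith)
  rw [lam_eq_rpow s ξ, lam_eq_rpow s η, lam_eq_rpow s (ξ + η),
    ← Real.mul_rpow (lam_nonneg _ _) (lam_nonneg _ _),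
    ← Real.mul_rpow zero_le_two (mul_nonneg (lam_nonneg _ _) (lam_nonneg _ _))]
  exact Real.rpow_le_rpow (lam_nonneg _ _) h hs

theorem lam_le_prod {ι : Type*} (T : Finset ι) {s : ℝ} (hs : 0 ≤ s) (ξ : ι → Space d) {k : ι}
    (hk : k ∈ T) : lam s (ξ k) ≤ ∏ i ∈ T, lam s (ξ i) := by
  classical
  rw [← Finset.mul_prod_erase T _ hk]
  refine le_mul_of_one_le_right (lam_nonneg _ _) ?_
  have := Finset.prod_le_prod (s := T.erase k) (f := fun _ => (1 : ℝ)) (g := fun i => lam s (ξ i))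
    (fun _ _ => zero_le_one) fun i _ => one_le_lam hs (ξ i)
  simpa using this

theorem rpow_sum_lam_le {ι : Type*} (T : Finset ι) {s : ℝ} (hs : 0 ≤ s) (ξ : ι → Space d) :
    (∑ i ∈ T, lam 1 (ξ i)) ^ s ≤ (T.card : ℝ) ^ s * ∏ i ∈ T, lam s (ξ i) := by
  have h : ∑ i ∈ T, lam 1 (ξ i) ≤ T.card * ∏ i ∈ T, lam 1 (ξ i) := by
    refine (Finset.sum_le_sum fun i hi => lam_le_prod T zero_le_one ξ hi).trans_eq ?_
    rw [Finset.sum_const, nsmul_eq_mul]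
  have hp : 0 ≤ ∏ i ∈ T, lam 1 (ξ i) := Finset.prod_nonneg fun _ _ => lam_nonneg _ _
  refine (Real.rpow_le_rpow (Finset.sum_nonneg fun _ _ => lam_nonneg _ _) h hs).trans_eq ?_
  rw [Real.mul_rpow (Nat.cast_nonneg _) hp, ← Real.finsetProd_rpow _ _ fun _ _ => lam_nonneg _ _]
  congr 1
  exact Finset.prod_congr rfl fun i _ => (lam_eq_rpow s _).symm

theorem lam_sum_le {n : ℕ} {s : ℝ} (hs : 0 ≤ s) (ξ : Fin (n + 1) → Space d) :
    lam s (∑ i, ξ i) ≤ (n + 1 : ℝ) ^ s * ∏ i, lam s (ξ i) := by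
  rw [lam_eq_rpow]
  refine (Real.rpow_le_rpow (lam_nonneg _ _)
    (lam_one_sum_le Finset.univ ξ Finset.univ_nonempty) hs).trans ?_
  simpa using rpow_sum_lam_le Finset.univ hs ξ

/-- The alternative for w treats the unshifted and the shifted symbol of the recursion at once. -/
theorem prod_lam_add_single_le {n : ℕ} {s : ℝ} (hs : 0 ≤ s) (ξ : Fin n → Space d) (k : Fin n)
    {w η : Space d} (hw : w = 0 ∨ w = η) :
    ∏ i, lam s ((ξ + Pi.single k w : Fin n → Space d) i) ≤
      2 ^ s * lam s η * ∏ i, lam s (ξ i) := by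
  have h1 : lam s (ξ k + w) ≤ 2 ^ s * lam s η * lam s (ξ k) := by
    rcases hw with rfl | rfl
    · rw [add_zero]
      refine le_mul_of_one_le_left (lam_nonneg _ _) ?_
      have := Real.one_le_rpow (one_le_two : (1 : ℝ) ≤ 2) hs
      have := one_le_lam hs η
      nlinarith
    · exact (lam_add_arg_le hs _ _).trans_eq (by ring)
  rw [← Finset.mul_prod_erase _ _ (Finset.mem_univ k),
    ← Finset.mul_prod_erase _ (fun i => lam s (ξ i)) (Finset.mem_univ k), ← mul_assoc,
    Finset.prod_congr rfl fun i hi => by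
      rw [Pi.add_apply, Pi.single_eq_of_ne (Finset.ne_of_mem_erase hi), add_zero]]
  refine mul_le_mul_of_nonneg_right ?_ (Finset.prod_nonneg fun _ _ => lam_nonneg _ _)
  rw [Pi.add_apply, Pi.single_eq_same]
  exact h1

end LamProducts

/-! ### Shears -/

section Shear

variable {X Y E : Type*} [MeasurableSpace X] [MeasurableSpace Y] [AddCommGroup Y]
  [MeasurableAdd₂ Y] [MeasurableNeg Y] [NormedAddCommGroup E] [NormedSpace ℝ E]
  {μ : Measure X} {ν : Measure Y} [SFinite μ] [SFinite ν] [ν.IsAddRightInvariant]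

theorem measurePreserving_shear {g : X → Y} (hg : Measurable g) :
    MeasurePreserving (fun p : X × Y => (p.1, p.2 - g p.1)) (μ.prod ν) (μ.prod ν) := by
  refine (MeasurePreserving.id μ).skew_product (g := fun x y => y - g x) ?_ ?_
  · exact measurable_snd.sub (hg.comp measurable_fst)
  · exact Filter.Eventually.of_forall fun x => map_sub_right_eq_self ν (g x)

/-- Fubini and translation invariance. This substitution turns an integral over (ξ, η) with a
convolution argument ξ - η into an integral over independent variables. -/
theorem integral_shear {g : X → Y} (hg : Measurable g) {H : X × Y → E}
    (hH : Integrable H (μ.prod ν)) :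
    ∫ y, ∫ x, H (x, y - g x) ∂μ ∂ν = ∫ p, H p ∂(μ.prod ν) := by
  have h1 : Integrable (fun p : X × Y => H (p.1, p.2 - g p.1)) (μ.prod ν) :=
    (measurePreserving_shear hg).integrable_comp_of_integrable hH
  rw [← integral_integral_swap (f := fun x y => H (x, y - g x)) h1, integral_prod _ hH]
  congr 1
  funext x
  exact integral_sub_right_eq_self (fun y => H (x, y)) (g x)

end Shear

/-! ### The convolution product -/

section Convolution

variable {d : ℕ}

theorem continuous_dot : Continuous fun p : Space d × CVec d => dot p.1 p.2 := by
  unfold dot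
  fun_prop

theorem Measurable.dot {α : Type*} [MeasurableSpace α] {f : α → Space d} {g : α → CVec d}
    (hf : Measurable f) (hg : Measurable g) : Measurable fun x => dot (f x) (g x) :=
  continuous_dot.measurable.comp (hf.prodMk hg)

/-- The Fourier transform of `∇_u w`, in terms of those of `u` and `w`. -/
noncomputable def convN (U W : Space d → CVec d) (ξ : Space d) : CVec d :=
  ∫ η, (2 * Real.pi * Complex.I * dot (ξ - η) (U η)) • W (ξ - η)

theorem norm_two_pi_I : ‖(2 * Real.pi * Complex.I : ℂ)‖ = 2 * Real.pi := by
  simp [abs_of_pos Real.pi_pos]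

theorem norm_convN_integrand_le (U W : Space d → CVec d) (ξ η : Space d) :
    ‖(2 * Real.pi * Complex.I * dot ξ (U η)) • W ξ‖ ≤
      2 * Real.pi * (‖U η‖ * (lam 1 ξ * ‖W ξ‖)) := by
  rw [norm_smul, norm_mul, norm_two_pi_I]
  have := mul_le_mul_of_nonneg_right (norm_dot_le_lam ξ (U η)) (norm_nonneg (W ξ))
  have hpi := Real.pi_pos
  calc _ = 2 * Real.pi * (‖dot ξ (U η)‖ * ‖W ξ‖) := by ring
    _ ≤ 2 * Real.pi * (lam 1 ξ * ‖U η‖ * ‖W ξ‖) := by gcongr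
    _ = _ := by ring

variable {U W : Space d → CVec d}

theorem measurable_convN_integrand (hU : Measurable U) (hW : Measurable W) :
    Measurable fun p : Space d × Space d =>
      (2 * Real.pi * Complex.I * dot (p.1 - p.2) (U p.2)) • W (p.1 - p.2) :=
  (((measurable_fst.sub measurable_snd).dot (hU.comp measurable_snd)).const_mul _).smul
    (hW.comp (measurable_fst.sub measurable_snd))

theorem measurable_convN (hU : Measurable U) (hW : Measurable W) : Measurable (convN U W) :=
  (measurable_convN_integrand hU hW).stronglyMeasurable.integral_prod_right'.measurable

/-- The weight is split by λ_s(ξ) ≤ 2^s λ_s(ξ - η) λ_s(η), and a product xy is bounded by x² + y².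
The integral over η of the result does not depend on ξ, which gives decay of every order. -/
theorem Rapid.convN_integrand_bound (hU : Rapid U) (hW : Rapid W) {s : ℝ} (hs : 0 ≤ s) :
    ∃ f g : Space d → ℝ, Integrable f ∧ Integrable g ∧ ∀ ξ η : Space d,
      lam s ξ * ‖(2 * Real.pi * Complex.I * dot (ξ - η) (U η)) • W (ξ - η)‖ ≤
        f η + g (ξ - η) := by
  have hpi := Real.pi_pos
  refine ⟨fun η => 2 ^ s * (2 * Real.pi) * ‖lam s η • U η‖ ^ 2,
    fun ζ => 2 ^ s * (2 * Real.pi) * ‖lam (s + 1) ζ • W ζ‖ ^ 2,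
    (hU.2 s).norm.integrable_sq.const_mul _, (hW.2 (s + 1)).norm.integrable_sq.const_mul _,
    fun ξ η => ?_⟩
  have h1 : lam s ξ ≤ 2 ^ s * (lam s (ξ - η) * lam s η) := by
    simpa using lam_add_arg_le hs (ξ - η) η
  have h2 := norm_convN_integrand_le U W (ξ - η) η
  have l1 := lam_nonneg s η
  have l2 := lam_nonneg s (ξ - η)
  have l3 := lam_nonneg 1 (ξ - η)
  have e1 : ‖lam s η • U η‖ = lam s η * ‖U η‖ := by rw [norm_smul, Real.norm_of_nonneg l1]
  have e2 : ‖lam (s + 1) (ξ - η) • W (ξ - η)‖ = lam s (ξ - η) * lam 1 (ξ - η) * ‖W (ξ - η)‖ := by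
    rw [norm_smul, Real.norm_of_nonneg (lam_nonneg _ _), lam_add]
  dsimp only
  rw [e1, e2, ← mul_add]
  calc _ ≤ 2 ^ s * (lam s (ξ - η) * lam s η) *
        (2 * Real.pi * (‖U η‖ * (lam 1 (ξ - η) * ‖W (ξ - η)‖))) :=
        mul_le_mul h1 h2 (norm_nonneg _) (by positivity)
    _ = 2 ^ s * (2 * Real.pi) * ((lam s η * ‖U η‖) *
        (lam s (ξ - η) * lam 1 (ξ - η) * ‖W (ξ - η)‖)) := by ring
    _ ≤ _ := by
      refine mul_le_mul_of_nonneg_left ?_ (by positivity)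
      generalize lam s η * ‖U η‖ = x
      generalize lam s (ξ - η) * lam 1 (ξ - η) * ‖W (ξ - η)‖ = y
      nlinarith [sq_nonneg (x - y), sq_nonneg x, sq_nonneg y]

theorem Rapid.integrable_convN_integrand (hU : Rapid U) (hW : Rapid W) (ξ : Space d) :
    Integrable fun η => (2 * Real.pi * Complex.I * dot (ξ - η) (U η)) • W (ξ - η) := by
  obtain ⟨f, g, hf, hg, h⟩ := hU.convN_integrand_bound hW le_rfl
  refine (hf.add (hg.comp_sub_left ξ)).mono'
    ((measurable_convN_integrand hU.1 hW.1).comp measurable_prodMk_left).aestronglyMeasurable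
    (Filter.Eventually.of_forall fun η => ?_)
  simpa [lam_zero] using h ξ η

theorem Rapid.convN (hU : Rapid U) (hW : Rapid W) : Rapid (convN U W) := by
  refine Rapid.of_forall_le (measurable_convN hU.1 hW.1) fun s hs => ?_
  obtain ⟨f, g, hf, hg, h⟩ := hU.convN_integrand_bound hW hs
  refine ⟨(∫ η, f η) + ∫ η, g η, fun ξ => ?_⟩
  rw [← Real.norm_of_nonneg (lam_nonneg s ξ), ← norm_smul, _root_.convN, ← integral_smul,
    ← integral_sub_left_eq_self g volume ξ, ← integral_add hf (hg.comp_sub_left ξ)]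
  refine norm_integral_le_of_norm_le (hf.add (hg.comp_sub_left ξ))
    (Filter.Eventually.of_forall fun η => ?_)
  rw [norm_smul, Real.norm_of_nonneg (lam_nonneg s ξ)]
  exact h ξ η

/-- The integrand of the weak form of the convolution product. -/
noncomputable def convKernel (φ : Space d → ℂ) (U W : Space d → CVec d) (p : Space d × Space d) :
    CVec d :=
  (φ (p.2 + p.1) * (2 * Real.pi * Complex.I * dot p.2 (U p.1))) • W p.2

theorem Rapid.integrable_convKernel (hU : Rapid U) (hW : Rapid W) {φ : Space d → ℂ}
    (hφ : Measurable φ) {C s : ℝ} (hC : 0 ≤ C) (hs : 0 ≤ s) (hφb : ∀ ξ, ‖φ ξ‖ ≤ C * lam s ξ) :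
    Integrable (convKernel φ U W) (volume.prod volume) := by
  have hpi := Real.pi_pos
  have h1 := ((hU.integrable_norm s).mul_prod (hW.integrable_norm (s + 1))).const_mul
    (C * 2 ^ s * (2 * Real.pi))
  refine h1.mono' (Measurable.aestronglyMeasurable ?_) (Filter.Eventually.of_forall fun p => ?_)
  · exact ((hφ.comp (measurable_snd.add measurable_fst)).mul
      ((measurable_snd.dot (hU.1.comp measurable_fst)).const_mul _)).smul (hW.1.comp measurable_snd)
  · rw [convKernel, mul_smul, norm_smul]
    have h2 := norm_convN_integrand_le U W p.2 p.1
    have h3 := (hφb (p.2 + p.1)).trans (mul_le_mul_of_nonneg_left (lam_add_arg_le hs _ _) hC)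
    have l1 := lam_nonneg s p.1
    have l2 := lam_nonneg s p.2
    refine (mul_le_mul h3 h2 (norm_nonneg _) (by positivity)).trans_eq ?_
    rw [lam_add]
    ring

/-- The substitution ξ ↦ ξ + η. Polynomial growth of φ is allowed because it is applied to
characters in `nabla_fourierInv` and to growing factors in `weak_formula`. -/
theorem Rapid.integral_smul_convN (hU : Rapid U) (hW : Rapid W) {φ : Space d → ℂ}
    (hφ : Measurable φ) {C s : ℝ} (hC : 0 ≤ C) (hs : 0 ≤ s) (hφb : ∀ ξ, ‖φ ξ‖ ≤ C * lam s ξ) :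
    ∫ ξ, φ ξ • _root_.convN U W ξ = ∫ η, ∫ ξ, convKernel φ U W (η, ξ) := by
  have hH := hU.integrable_convKernel hW hφ hC hs hφb
  rw [← integral_prod _ hH, ← integral_shear measurable_id hH]
  congr 1
  funext ξ
  rw [_root_.convN, ← integral_smul]
  congr 1
  funext η
  simp only [convKernel, id, sub_add_cancel, mul_smul]

end Convolution

/-! ### The derivative in Fourier variables -/

section Nabla

variable {d : ℕ} {U W : Space d → CVec d}

/-- The character `ξ ↦ e^{2πi⟨ξ,x⟩}`. -/
noncomputable def chr (x ξ : Space d) : ℂ := Complex.exp (↑(2 * Real.pi * inner ℝ ξ x) * Complex.I)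

theorem continuous_chr (x : Space d) : Continuous (chr x) := by
  unfold chr
  fun_prop

theorem measurable_chr (x : Space d) : Measurable (chr x) := (continuous_chr x).measurable

theorem norm_chr (x ξ : Space d) : ‖chr x ξ‖ = 1 := Complex.norm_exp_ofReal_mul_I _

theorem chr_add (x ξ η : Space d) : chr x (ξ + η) = chr x ξ * chr x η := by
  rw [chr, inner_add_left, mul_add, Complex.ofReal_add, add_mul, Complex.exp_add]; rfl

theorem fourierInv_eq_chr (f : Space d → CVec d) (x : Space d) :
    (𝓕⁻ f : Space d → CVec d) x = ∫ ξ, chr x ξ • f ξ := Real.fourierInv_eq' f x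

theorem inner_single_eq (ξ : Space d) (j : Fin d) :
    (inner ℝ ξ (EuclideanSpace.single j (1 : ℝ)) : ℝ) = ξ j := by
  rw [EuclideanSpace.inner_single_right]; simp

/-- Differentiation under the integral, taken over from the forward transform of the reflected
field; the two sign changes cancel. -/
theorem fderiv_fourierInv_apply (hW : Rapid W) (x v : Space d) :
    fderiv ℝ (𝓕⁻ W : Space d → CVec d) x v =
      ∫ ξ, chr x ξ • ((2 * Real.pi * Complex.I * (inner ℝ ξ v : ℝ) : ℂ) • W ξ) := by
  have hW' := hW.comp_neg
  have h1 : Integrable fun ξ : Space d => ‖ξ‖ * ‖W (-ξ)‖ := by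
    refine (hW'.integrable_norm 1).mono'
      (measurable_norm.mul hW'.1.norm).aestronglyMeasurable (Filter.Eventually.of_forall fun ξ => ?_)
    rw [norm_mul, norm_norm, norm_norm]
    exact mul_le_mul_of_nonneg_right (norm_le_lam_one ξ) (norm_nonneg _)
  have h2 := Real.hasFDerivAt_fourier hW'.integrable h1 x
  rw [Real.fourierInv_eq_fourier_comp_neg, h2.fderiv, Real.fourier_eq']
  have h3 : Integrable fun ξ : Space d => Complex.exp (↑(-2 * Real.pi * inner ℝ ξ x) * Complex.I) •
      VectorFourier.fourierSMulRight (innerSL ℝ) (fun ξ => W (-ξ)) ξ := by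
    refine (h1.const_mul (2 * Real.pi * ‖innerSL ℝ (E := Space d)‖)).mono' ?_
      (Filter.Eventually.of_forall fun ξ => ?_)
    · have hc : Continuous fun ξ : Space d =>
          Complex.exp (↑(-2 * Real.pi * inner ℝ ξ x) * Complex.I) := by fun_prop
      exact hc.aestronglyMeasurable.smul hW'.1.aestronglyMeasurable.fourierSMulRight
    · rw [norm_smul, Complex.norm_exp_ofReal_mul_I, one_mul]
      exact (VectorFourier.norm_fourierSMulRight_le _ _ _).trans_eq (by ring)
  rw [ContinuousLinearMap.integral_apply h3, ← integral_neg_eq_self]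
  congr 1
  funext ξ
  have e : VectorFourier.fourierSMulRight (innerSL ℝ) (fun ξ => W (-ξ)) (-ξ) v =
      (2 * Real.pi * Complex.I * (inner ℝ ξ v : ℝ) : ℂ) • W ξ := by
    rw [VectorFourier.fourierSMulRight_apply, innerSL_apply_apply, inner_neg_left, neg_neg,
      neg_smul, neg_smul, smul_neg, neg_neg, ← Complex.coe_smul, smul_smul]
  rw [_root_.smul_apply, e, chr, inner_neg_left]
  congr 4
  ring

theorem integrable_chr_smul {V : Space d → CVec d} (hV : Integrable V) (x : Space d) :
    Integrable fun ξ => chr x ξ • V ξ := by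
  refine hV.norm.mono' ((measurable_chr x).aestronglyMeasurable.smul hV.aestronglyMeasurable)
    (Filter.Eventually.of_forall fun ξ => ?_)
  rw [norm_smul, norm_chr, one_mul]

theorem Rapid.integrable_derivative (hW : Rapid W) (j : Fin d) :
    Integrable fun ξ : Space d => ((2 * Real.pi * Complex.I *
        (inner ℝ ξ (EuclideanSpace.single j (1 : ℝ)) : ℝ) : ℂ) • W ξ) := by
  refine ((hW.integrable_norm 1).const_mul (2 * Real.pi)).mono' ?_
    (Filter.Eventually.of_forall fun ξ => ?_)
  · have hc : Continuous fun ξ : Space d => (2 * Real.pi * Complex.I *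
        (inner ℝ ξ (EuclideanSpace.single j (1 : ℝ)) : ℝ) : ℂ) := by fun_prop
    exact (hc.measurable.smul hW.1).aestronglyMeasurable
  · rw [norm_smul, norm_mul, norm_two_pi_I, mul_assoc, Complex.norm_real, inner_single_eq]
    have hpi := Real.pi_pos
    have : ‖ξ j‖ ≤ lam 1 ξ := (PiLp.norm_apply_le ξ j).trans (norm_le_lam_one ξ)
    gcongr

theorem Rapid.integral_convKernel_chr (hW : Rapid W) (U : Space d → CVec d) (x η : Space d) :
    ∫ ξ, convKernel (chr x) U W (η, ξ) = ∑ j : Fin d, (chr x η • U η j) •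
      fderiv ℝ (𝓕⁻ W : Space d → CVec d) x (EuclideanSpace.single j 1) := by
  simp_rw [fderiv_fourierInv_apply hW, ← integral_smul]
  rw [← integral_finsetSum]
  · congr 1
    funext ξ
    rw [convKernel, dot, Finset.mul_sum, Finset.mul_sum, Finset.sum_smul]
    refine Finset.sum_congr rfl fun j _ => ?_
    simp only [smul_smul, chr_add, inner_single_eq, smul_eq_mul]
    congr 1
    ring
  · exact fun j _ => (integrable_chr_smul (hW.integrable_derivative j) x).smul (chr x η • U η j)

/-- Testing the convolution with the character at x, its multiplicativity splits the double integral
into the product of the inverse transform of U_j and the j-th derivative of the inverse transform of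
W. -/
theorem nabla_fourierInv (hU : Rapid U) (hW : Rapid W) :
    nabla (𝓕⁻ U : Space d → CVec d) (𝓕⁻ W : Space d → CVec d) = 𝓕⁻ (convN U W) := by
  funext x
  rw [fourierInv_eq_chr, hU.integral_smul_convN hW (measurable_chr x) (C := 1) (s := 0) zero_le_one
    le_rfl fun ξ => by rw [norm_chr, lam_zero, one_mul]]
  simp_rw [hW.integral_convKernel_chr]
  have hU' := integrable_chr_smul hU.integrable x
  have hUj : ∀ j : Fin d, Integrable fun η : Space d => chr x η • U η j := fun j =>
    (EuclideanSpace.proj (𝕜 := ℂ) j : CVec d →L[ℂ] ℂ).integrable_comp hU'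
  rw [integral_finsetSum _ fun j _ => (hUj j).smul_const _, nabla]
  refine Finset.sum_congr rfl fun j _ => ?_
  rw [integral_smul_const, fourierInv_eq_chr]
  congr 1
  exact ((EuclideanSpace.proj (𝕜 := ℂ) j : CVec d →L[ℂ] ℂ).integral_comp_comm hU').symm

end Nabla

/-! ### The operators in Fourier variables -/

section FourierSide

variable {d : ℕ}

/-- The operators `A_n` in Fourier variables. -/
noncomputable def ftA (a : Space d → (CVec d →L[ℂ] CVec d)) :
    (n : ℕ) → (Fin (n + 1) → Space d → CVec d) → Space d → CVec d
  | 0, U => fun ξ => a ξ (U 0 ξ)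
  | n + 1, U =>
      convN (U (Fin.last (n + 1))) (ftA a n (fun k => U k.castSucc)) -
        ∑ k : Fin (n + 1), ftA a n
          (Function.update (fun l : Fin (n + 1) => U l.castSucc) k
            (convN (U (Fin.last (n + 1))) (U k.castSucc)))

variable {r : ℝ} {a : Space d → (CVec d →L[ℂ] CVec d)}

theorem SymbolClass.norm_le (ha : SymbolClass r a) :
    ∃ C : ℝ, 0 ≤ C ∧ ∀ ξ : Space d, ‖a ξ‖ ≤ C * lam r ξ := by
  obtain ⟨C, hC0, hC⟩ := ha.exists_bound 0
  exact ⟨C, hC0, fun ξ => by simpa using hC ξ⟩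

theorem SymbolClass.measurable_apply (ha : SymbolClass r a) {U : Space d → CVec d}
    (hU : Measurable U) : Measurable fun ξ => a ξ (U ξ) := by
  have hc : Continuous fun p : Space d × CVec d => a p.1 p.2 :=
    (ha.1.continuous.comp continuous_fst).clm_apply continuous_snd
  exact hc.measurable.comp (measurable_id.prodMk hU)

theorem SymbolClass.rapid_apply (ha : SymbolClass r a) {U : Space d → CVec d} (hU : Rapid U) :
    Rapid fun ξ => a ξ (U ξ) := by
  obtain ⟨C, hC0, hC⟩ := ha.norm_le
  refine hU.of_le (ha.measurable_apply hU.1) (C := C) (t := r) fun ξ => ?_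
  refine ((a ξ).le_opNorm _).trans ?_
  rw [← mul_assoc]
  exact mul_le_mul_of_nonneg_right (hC ξ) (norm_nonneg _)

theorem rapid_update {n : ℕ} {U : Fin n → Space d → CVec d} (hU : ∀ i, Rapid (U i)) (k : Fin n)
    {V : Space d → CVec d} (hV : Rapid V) (i : Fin n) : Rapid (Function.update U k V i) := by
  rcases eq_or_ne i k with rfl | h
  · rwa [Function.update_self]
  · rw [Function.update_of_ne h]; exact hU i

theorem rapid_ftA (ha : SymbolClass r a) (n : ℕ) (U : Fin (n + 1) → Space d → CVec d)
    (hU : ∀ i, Rapid (U i)) : Rapid (ftA a n U) := by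
  induction n with
  | zero => exact ha.rapid_apply (hU 0)
  | succ n ih =>
    exact ((hU _).convN (ih _ fun i => hU _)).sub (Rapid.sum _ fun k _ =>
      ih _ (rapid_update (fun i => hU _) k ((hU _).convN (hU _))))

theorem fourierMult_fourierInv {U : Space d → CVec d} (hU : Rapid U) :
    fourierMult a (𝓕⁻ U) = 𝓕⁻ fun ξ => a ξ (U ξ) := by
  funext x
  refine Real.fourierInv_congr_ae ?_ x
  filter_upwards [hU.hat_fourierInv] with ξ hξ
  rw [hξ]

theorem fourierInv_sub {U W : Space d → CVec d} (hU : Integrable U) (hW : Integrable W) :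
    (𝓕⁻ (U - W) : Space d → CVec d) = 𝓕⁻ U - 𝓕⁻ W := by
  funext x
  rw [Pi.sub_apply, fourierInv_eq_chr, fourierInv_eq_chr, fourierInv_eq_chr,
    ← integral_sub (integrable_chr_smul hU x) (integrable_chr_smul hW x)]
  simp [smul_sub]

theorem fourierInv_sum {ι : Type*} (T : Finset ι) {U : ι → Space d → CVec d}
    (hU : ∀ i ∈ T, Integrable (U i)) :
    (𝓕⁻ (∑ i ∈ T, U i) : Space d → CVec d) = ∑ i ∈ T, 𝓕⁻ (U i) := by
  funext x
  simp only [Finset.sum_apply, fourierInv_eq_chr]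
  rw [← integral_finsetSum _ fun i hi => integrable_chr_smul (hU i hi) x]
  simp [Finset.smul_sum]

/-- Rapid fields are stable under every operation of the recursion, so all integrals converge and 𝓕⁻
may be applied termwise, with `nabla_fourierInv` for the derivatives. -/
theorem iterA_fourierInv (ha : SymbolClass r a) (n : ℕ) (U : Fin (n + 1) → Space d → CVec d)
    (hU : ∀ i, Rapid (U i)) : iterA a n (fun i => 𝓕⁻ (U i)) = 𝓕⁻ (ftA a n U) := by
  induction n with
  | zero => exact fourierMult_fourierInv (hU 0)
  | succ n ih =>
    have hk : ∀ k : Fin (n + 1), ∀ i, Rapid (Function.update (fun l : Fin (n + 1) => U l.castSucc) k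
        (convN (U (Fin.last (n + 1))) (U k.castSucc)) i) := fun k =>
      rapid_update (fun i => hU _) k ((hU _).convN (hU _))
    rw [iterA, ftA, ih _ fun i => hU _, nabla_fourierInv (hU _) (rapid_ftA ha n _ fun i => hU _),
      fourierInv_sub ((hU _).convN (rapid_ftA ha n _ fun i => hU _)).integrable
        (Rapid.sum _ fun k _ => rapid_ftA ha n _ (hk k)).integrable,
      fourierInv_sum _ fun k _ => (rapid_ftA ha n _ (hk k)).integrable]
    congr 1
    refine Finset.sum_congr rfl fun k _ => ?_
    rw [nabla_fourierInv (hU _) (hU _), ← ih _ (hk k)]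
    congr 1
    funext l
    rcases eq_or_ne l k with rfl | h
    · rw [Function.update_self, Function.update_self]
    · rw [Function.update_of_ne h, Function.update_of_ne h]

end FourierSide

/-! ### The symbols on finite tuples -/

section FiniteTuples

variable {d : ℕ} {E : Type*} [Zero E]

/-- Extension of a finite tuple by zero. -/
def extendZero {n : ℕ} (f : Fin (n + 1) → E) (i : ℕ) : E := if h : i < n + 1 then f ⟨i, h⟩ else 0

theorem extendZero_val {n : ℕ} (f : Fin (n + 1) → E) (i : Fin (n + 1)) :
    extendZero f i = f i := dif_pos i.2

theorem extendZero_of_lt {n : ℕ} (f : Fin (n + 1) → E) {i : ℕ} (h : i < n + 1) :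
    extendZero f i = f ⟨i, h⟩ := dif_pos h

theorem extendZero_castSucc {n : ℕ} (f : Fin (n + 2) → E) {i : ℕ} (h : i < n + 1) :
    extendZero f i = extendZero (fun k : Fin (n + 1) => f k.castSucc) i := by
  rw [extendZero_of_lt _ h, extendZero_of_lt _ (by omega)]; rfl

theorem extendZero_update {n : ℕ} (f : Fin (n + 1) → E) (k : Fin (n + 1)) (x : E) :
    extendZero (Function.update f k x) = Function.update (extendZero f) k x := by
  funext i
  by_cases h : i < n + 1
  · rw [extendZero_of_lt _ h]
    rcases eq_or_ne i k with rfl | hk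
    · simp
    · rw [Function.update_of_ne hk, extendZero_of_lt _ h, Function.update_of_ne]
      exact fun e => hk (congrArg Fin.val e)
  · have hk : i ≠ k := fun e => h (e ▸ k.2)
    rw [Function.update_of_ne hk, extendZero, extendZero, dif_neg h, dif_neg h]

theorem measurable_extendZero [MeasurableSpace E] {n : ℕ} {α : Type*} [MeasurableSpace α]
    {f : α → Fin (n + 1) → E} (hf : Measurable f) : Measurable fun x => extendZero (f x) := by
  refine measurable_pi_iff.2 fun i => ?_
  by_cases h : i < n + 1
  · simp only [extendZero_of_lt _ h]
    exact (measurable_pi_apply _).comp hf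
  · simp only [extendZero, dif_neg h]
    exact measurable_const

variable (a : Space d → (CVec d →L[ℂ] CVec d))

/-- The symbol of `A_n` on finite tuples. -/
noncomputable def symF (n : ℕ) (ξ : Fin (n + 1) → Space d) (c : Fin (n + 1) → CVec d) : CVec d :=
  sym a n (extendZero ξ) (extendZero c)

theorem symF_zero (ξ : Fin 1 → Space d) (c : Fin 1 → CVec d) : symF a 0 ξ c = a (ξ 0) (c 0) := rfl

theorem symF_succ (n : ℕ) (ξ : Fin (n + 2) → Space d) (c : Fin (n + 2) → CVec d) :
    symF a (n + 1) ξ c = ∑ k : Fin (n + 1),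
      (2 * Real.pi * Complex.I * dot (ξ k.castSucc) (c (Fin.last (n + 1)))) •
      (symF a n (fun i => ξ i.castSucc) (fun i => c i.castSucc) -
        symF a n ((fun i => ξ i.castSucc) + Pi.single k (ξ (Fin.last (n + 1))))
          (fun i => c i.castSucc)) := by
  rw [symF, sym, Finset.sum_range, Finset.smul_sum]
  refine Finset.sum_congr rfl fun k _ => ?_
  have hk := k.2
  have e1 : extendZero ξ k = ξ k.castSucc := extendZero_of_lt ξ (by omega)
  have e2 : extendZero c (n + 1) = c (Fin.last (n + 1)) := extendZero_of_lt c (by omega)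
  have e3 : extendZero ξ (n + 1) = ξ (Fin.last (n + 1)) := extendZero_of_lt ξ (by omega)
  have e4 : ∀ i ≤ n, extendZero c i = extendZero (fun i : Fin (n + 1) => c i.castSucc) i :=
    fun i hi => extendZero_castSucc c (by omega)
  have e5 : ∀ i ≤ n, extendZero ξ i = extendZero (fun i : Fin (n + 1) => ξ i.castSucc) i :=
    fun i hi => extendZero_castSucc ξ (by omega)
  rw [e1, e2, smul_smul, symF, symF, sym_congr a n e5 e4]
  congr 2
  refine sym_congr a n (fun i hi => ?_) e4
  rw [shift, Pi.add_apply, e5 i hi, e3, extendZero_of_lt _ (by omega : i < n + 1),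
    extendZero_of_lt _ (by omega : i < n + 1), Pi.add_apply]
  congr 1
  simp only [Pi.single_apply, Fin.ext_iff]

theorem sym_update_add (n : ℕ) (ξ : ℕ → Space d) (c : ℕ → CVec d) {k : ℕ} (hk : k ≤ n)
    (x y : CVec d) : sym a n ξ (Function.update c k (x + y)) =
      sym a n ξ (Function.update c k x) + sym a n ξ (Function.update c k y) := by
  induction n generalizing ξ with
  | zero =>
    obtain rfl : k = 0 := by omega
    simp [sym]
  | succ n ih =>
    simp only [sym, ← smul_add, ← Finset.sum_add_distrib]
    congr 1
    refine Finset.sum_congr rfl fun j _ => ?_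
    -- The last amplitude enters only through the pairing, the earlier ones only through the lower
    -- symbol.
    rcases Nat.lt_or_ge n k with h | h
    · obtain rfl : k = n + 1 := by omega
      have e : ∀ η z, sym a n η (Function.update c (n + 1) z) = sym a n η c := fun η z =>
        sym_congr a n (fun _ _ => rfl) fun i hi => Function.update_of_ne (by omega) _ _
      simp only [e, Function.update_self, dot_add_right, add_smul]
    · rw [ih _ h, ih _ h, Function.update_of_ne (by omega), Function.update_of_ne (by omega),
        Function.update_of_ne (by omega)]
      module

theorem sym_update_smul (n : ℕ) (ξ : ℕ → Space d) (c : ℕ → CVec d) {k : ℕ} (hk : k ≤ n) (z : ℂ)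
    (x : CVec d) : sym a n ξ (Function.update c k (z • x)) =
      z • sym a n ξ (Function.update c k x) := by
  induction n generalizing ξ with
  | zero =>
    obtain rfl : k = 0 := by omega
    simp [sym]
  | succ n ih =>
    simp only [sym]
    rw [smul_comm z, Finset.smul_sum (r := z)]
    congr 1
    refine Finset.sum_congr rfl fun j _ => ?_
    rcases Nat.lt_or_ge n k with h | h
    · obtain rfl : k = n + 1 := by omega
      have e : ∀ η z, sym a n η (Function.update c (n + 1) z) = sym a n η c := fun η z =>
        sym_congr a n (fun _ _ => rfl) fun i hi => Function.update_of_ne (by omega) _ _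
      simp only [e, Function.update_self, dot_smul_right, mul_smul]
    · rw [ih _ h, ih _ h, Function.update_of_ne (by omega), Function.update_of_ne (by omega)]
      module

theorem symF_update_add (n : ℕ) (ξ : Fin (n + 1) → Space d) (c : Fin (n + 1) → CVec d)
    (k : Fin (n + 1)) (x y : CVec d) : symF a n ξ (Function.update c k (x + y)) =
      symF a n ξ (Function.update c k x) + symF a n ξ (Function.update c k y) := by
  simp only [symF, extendZero_update]
  exact sym_update_add a n _ _ (Nat.lt_succ_iff.1 k.2) x y

theorem symF_update_smul (n : ℕ) (ξ : Fin (n + 1) → Space d) (c : Fin (n + 1) → CVec d)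
    (k : Fin (n + 1)) (z : ℂ) (x : CVec d) : symF a n ξ (Function.update c k (z • x)) =
      z • symF a n ξ (Function.update c k x) := by
  simp only [symF, extendZero_update]
  exact sym_update_smul a n _ _ (Nat.lt_succ_iff.1 k.2) z x

/-- The symbol as a linear function of one of the amplitudes. -/
noncomputable def symSlot (n : ℕ) (ξ : Fin (n + 1) → Space d) (c : Fin (n + 1) → CVec d)
    (k : Fin (n + 1)) : CVec d →L[ℂ] CVec d :=
  LinearMap.toContinuousLinearMap
    { toFun := fun x => symF a n ξ (Function.update c k x)
      map_add' := symF_update_add a n ξ c k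
      map_smul' := symF_update_smul a n ξ c k }

theorem symSlot_apply (n : ℕ) (ξ : Fin (n + 1) → Space d) (c : Fin (n + 1) → CVec d)
    (k : Fin (n + 1)) (x : CVec d) : symSlot a n ξ c k x = symF a n ξ (Function.update c k x) := rfl

variable {a} {r : ℝ}

theorem SymbolClass.continuous_sym (ha : SymbolClass r a) (n : ℕ) :
    Continuous fun p : (ℕ → Space d) × (ℕ → CVec d) => sym a n p.1 p.2 := by
  induction n with
  | zero =>
    exact (ha.1.continuous.comp ((continuous_apply 0).comp continuous_fst)).clm_apply
      ((continuous_apply 0).comp continuous_snd)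
  | succ n ih =>
    simp only [sym]
    refine Continuous.const_smul (continuous_finsetSum (Finset.range (n + 1)) fun k _ => ?_)
      (2 * Real.pi * Complex.I : ℂ)
    have h0 : Continuous fun p : (ℕ → Space d) × (ℕ → CVec d) => (p.1 k, p.2 (n + 1)) := by
      fun_prop
    have h1 : Continuous fun p : (ℕ → Space d) × (ℕ → CVec d) => dot (p.1 k) (p.2 (n + 1)) :=
      continuous_dot.comp h0
    have h2 : Continuous fun p : (ℕ → Space d) × (ℕ → CVec d) => shift (n + 1) k p.1 := by
      refine continuous_pi fun i => ?_
      simp only [shift, Pi.add_apply, Pi.single_apply]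
      split_ifs <;> fun_prop
    exact h1.smul (ih.sub (ih.comp (h2.prodMk continuous_snd)))

theorem SymbolClass.measurable_symF (ha : SymbolClass r a) {n : ℕ} {α : Type*} [MeasurableSpace α]
    {f : α → Fin (n + 1) → Space d} {g : α → Fin (n + 1) → CVec d} (hf : Measurable f)
    (hg : Measurable g) : Measurable fun x => symF a n (f x) (g x) := by
  exact (ha.continuous_sym n).measurable.comp
    ((measurable_extendZero hf).prodMk (measurable_extendZero hg))

theorem symF_bound (hr : 1 ≤ r) (ha : SymbolClass r a) (n : ℕ) : ∃ C : ℝ, 0 ≤ C ∧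
    ∀ (ξ : Fin (n + 1) → Space d) (c : Fin (n + 1) → CVec d),
      ‖symF a n ξ c‖ ≤ C * ((∑ i, lam 1 (ξ i)) ^ (r - 1) * ∏ i, (lam 1 (ξ i) * ‖c i‖)) := by
  obtain ⟨C, hC0, hC⟩ := sym_bound hr ha n
  refine ⟨C, hC0, fun ξ c => (hC _ _).trans_eq ?_⟩
  rw [symBound, wsum, Finset.sum_range, Finset.prod_range]
  simp only [extendZero_val]

/-- A crude version of `symF_bound` with separated variables; it serves only to justify Fubini for
rapid fields. -/
theorem symF_poly_bound (hr : 1 ≤ r) (ha : SymbolClass r a) (n : ℕ) : ∃ C : ℝ, 0 ≤ C ∧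
    ∀ (ξ : Fin (n + 1) → Space d) (c : Fin (n + 1) → CVec d),
      ‖symF a n ξ c‖ ≤ C * ((∏ i, lam r (ξ i)) * ∏ i, ‖c i‖) := by
  obtain ⟨C, hC0, hC⟩ := symF_bound hr ha n
  refine ⟨C * (n + 1 : ℝ) ^ (r - 1), by positivity, fun ξ c => (hC ξ c).trans ?_⟩
  rw [mul_assoc, Finset.prod_mul_distrib]
  refine mul_le_mul_of_nonneg_left ?_ hC0
  have h1 := rpow_sum_lam_le Finset.univ (by linarith : 0 ≤ r - 1) ξ
  have h2 : 0 ≤ (∏ i, lam 1 (ξ i)) * ∏ i, ‖c i‖ :=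
    mul_nonneg (Finset.prod_nonneg fun _ _ => lam_nonneg _ _)
      (Finset.prod_nonneg fun _ _ => norm_nonneg _)
  refine (mul_le_mul_of_nonneg_right h1 h2).trans_eq ?_
  have h3 : (∏ i, lam r (ξ i)) = (∏ i, lam (r - 1) (ξ i)) * ∏ i, lam 1 (ξ i) := by
    rw [← Finset.prod_mul_distrib]
    exact Finset.prod_congr rfl fun i _ => by rw [← lam_add, sub_add_cancel]
  rw [h3, Finset.card_univ, Fintype.card_fin]
  push_cast
  ring

end FiniteTuples

/-! ### The weak form of the operators -/

section WeakForm

variable {d : ℕ} {r : ℝ} {a : Space d → (CVec d →L[ℂ] CVec d)}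

theorem mul_mul_mul_le_of_le {x y z x' y' z' κ : ℝ} (hx : x ≤ x') (hy : y ≤ y') (hz : z ≤ z')
    (hκ : 0 ≤ κ) (x0 : 0 ≤ x) (y0 : 0 ≤ y) (z0 : 0 ≤ z) :
    x * (κ * y) * z ≤ x' * (κ * y') * z' := by
  have hx' := x0.trans hx
  have hy' := y0.trans hy
  gcongr

/-- The integrand of the summands in the recursion for the weak form of `A_n`; the frequency `ξ_k`
is translated by `w`. -/
noncomputable def weakKernel (a : Space d → (CVec d →L[ℂ] CVec d)) (n : ℕ) (φ : Space d → ℂ)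
    (V : Space d → CVec d) (U : Fin (n + 1) → Space d → CVec d) (k : Fin (n + 1))
    (w : Space d → Space d) (p : Space d × (Fin (n + 1) → Space d)) : CVec d :=
  (φ ((∑ i, p.2 i) + p.1) * (2 * Real.pi * Complex.I * dot (p.2 k) (V p.1))) •
    symF a n (p.2 + Pi.single k (w p.1)) (fun i => U i (p.2 i))

/-- Domination by a product of one-variable functions: φ costs s orders in every frequency, the
pairing one, the symbol r. Translating ξ_k by η moves at most r further orders to η. -/
theorem integrable_weakKernel (hr : 1 ≤ r) (ha : SymbolClass r a) {n : ℕ} {φ : Space d → ℂ}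
    (hφ : Measurable φ) {C s : ℝ} (hC : 0 ≤ C) (hs : 0 ≤ s) (hφb : ∀ ξ, ‖φ ξ‖ ≤ C * lam s ξ)
    {V : Space d → CVec d} (hV : Rapid V) {U : Fin (n + 1) → Space d → CVec d}
    (hU : ∀ i, Rapid (U i)) (k : Fin (n + 1)) {w : Space d → Space d} (hwm : Measurable w)
    (hw : ∀ η, w η = 0 ∨ w η = η) :
    Integrable (weakKernel a n φ V U k w) (volume.prod volume) := by
  obtain ⟨B, hB0, hB⟩ := symF_poly_bound hr ha n
  have hpi := Real.pi_pos
  have hint : Integrable (fun ξ : Fin (n + 1) → Space d =>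
      ∏ i, (lam (s + 1 + r) (ξ i) * ‖U i (ξ i)‖)) :=
    Integrable.fintype_prod fun i => (hU i).integrable_norm (s + 1 + r)
  have h1 := ((hV.integrable_norm (s + r)).mul_prod hint).const_mul
    (C * (2 ^ s * (n + 1 : ℝ) ^ s) * (2 * Real.pi) * (B * 2 ^ r))
  have hsnd : ∀ i, Measurable fun p : Space d × (Fin (n + 1) → Space d) => p.2 i := fun i =>
    (measurable_pi_apply i).comp measurable_snd
  have hsum : Measurable fun p : Space d × (Fin (n + 1) → Space d) => (∑ i, p.2 i) + p.1 :=
    (Finset.measurable_sum _ fun i _ => hsnd i).add measurable_fst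
  have hsingle : Measurable fun p : Space d × (Fin (n + 1) → Space d) =>
      p.2 + Pi.single k (w p.1) := by
    refine measurable_snd.add (measurable_pi_iff.2 fun i => ?_)
    by_cases h : i = k
    · subst h
      simp only [Pi.single_eq_same]
      exact hwm.comp measurable_fst
    · simp only [Pi.single_eq_of_ne h]
      exact measurable_const
  refine h1.mono' (Measurable.aestronglyMeasurable ?_) (Filter.Eventually.of_forall fun p => ?_)
  · exact ((hφ.comp hsum).mul (((hsnd k).dot (hV.1.comp measurable_fst)).const_mul _)).smul
      (ha.measurable_symF hsingle (measurable_pi_iff.2 fun i => (hU i).1.comp (hsnd i)))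
  · obtain ⟨η, ξ⟩ := p
    rw [weakKernel, norm_smul, norm_mul, norm_mul, norm_two_pi_I]
    dsimp only
    have l1 := lam_nonneg s η
    have l2 := lam_nonneg r η
    have hP : ∀ t, 0 ≤ ∏ i, lam t (ξ i) := fun t => Finset.prod_nonneg fun _ _ => lam_nonneg _ _
    have hN : 0 ≤ ∏ i, ‖U i (ξ i)‖ := Finset.prod_nonneg fun _ _ => norm_nonneg _
    have e1 : ‖φ ((∑ i, ξ i) + η)‖ ≤
        C * (2 ^ s * (((n + 1 : ℝ) ^ s * ∏ i, lam s (ξ i)) * lam s η)) := by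
      refine (hφb _).trans (mul_le_mul_of_nonneg_left ((lam_add_arg_le hs _ _).trans ?_) hC)
      gcongr
      exact lam_sum_le hs ξ
    have e2 : ‖dot (ξ k) (V η)‖ ≤ (∏ i, lam 1 (ξ i)) * ‖V η‖ :=
      (norm_dot_le_lam _ _).trans (mul_le_mul_of_nonneg_right
        (lam_le_prod Finset.univ zero_le_one ξ (Finset.mem_univ k)) (norm_nonneg _))
    have e3 : ‖symF a n (ξ + Pi.single k (w η)) (fun i => U i (ξ i))‖ ≤
        B * ((2 ^ r * lam r η * ∏ i, lam r (ξ i)) * ∏ i, ‖U i (ξ i)‖) := by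
      refine (hB _ _).trans (mul_le_mul_of_nonneg_left ?_ hB0)
      exact mul_le_mul_of_nonneg_right (prod_lam_add_single_le (by linarith) ξ k (hw η)) hN
    have e4 : ∏ i, (lam (s + 1 + r) (ξ i) * ‖U i (ξ i)‖) = (∏ i, lam s (ξ i)) *
        (∏ i, lam 1 (ξ i)) * (∏ i, lam r (ξ i)) * ∏ i, ‖U i (ξ i)‖ := by
      simp only [← Finset.prod_mul_distrib, lam_add]
    have p1 := hP s
    have p2 := hP 1
    have p3 := hP r
    rw [e4, lam_add]
    refine (mul_mul_mul_le_of_le e1 e2 e3 (by positivity) (norm_nonneg _) (norm_nonneg _)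
      (norm_nonneg _)).trans_eq ?_
    ring

/-- The symbol is linear in its k-th amplitude, so the convolution integral in that slot comes
outside; the shear ξ_k ↦ ξ_k + η then separates the variables and leaves the shifted symbol. -/
theorem integral_smul_ftA_update (hr : 1 ≤ r) (ha : SymbolClass r a) {n : ℕ} {φ : Space d → ℂ}
    (hφ : Measurable φ) {C s : ℝ} (hC : 0 ≤ C) (hs : 0 ≤ s) (hφb : ∀ ξ, ‖φ ξ‖ ≤ C * lam s ξ)
    {V : Space d → CVec d} (hV : Rapid V) {U : Fin (n + 1) → Space d → CVec d}
    (hU : ∀ i, Rapid (U i)) (k : Fin (n + 1)) :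
    ∫ ξ : Fin (n + 1) → Space d, φ (∑ i, ξ i) •
        symF a n ξ (fun i => Function.update U k (convN V (U k)) i (ξ i)) =
      ∫ p, weakKernel a n φ V U k id p ∂(volume.prod volume) := by
  have hH := integrable_weakKernel hr ha hφ hC hs hφb hV hU k measurable_id fun η => Or.inr rfl
  have hg : Measurable fun η : Space d => (Pi.single k η : Fin (n + 1) → Space d) := by
    refine measurable_pi_iff.2 fun i => ?_
    by_cases h : i = k
    · subst h
      simp only [Pi.single_eq_same]
      exact measurable_id
    · simp only [Pi.single_eq_of_ne h]
      exact measurable_const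
  rw [← integral_shear hg hH]
  congr 1
  funext ξ
  have e1 : (fun i => Function.update U k (convN V (U k)) i (ξ i)) =
      Function.update (fun i => U i (ξ i)) k (convN V (U k) (ξ k)) := by
    funext i
    rcases eq_or_ne i k with rfl | h
    · simp
    · simp [h]
  rw [e1, ← symSlot_apply, convN,
    ← (symSlot a n ξ (fun i => U i (ξ i)) k).integral_comp_comm
      (hV.integrable_convN_integrand (hU k) (ξ k)), ← integral_smul]
  congr 1
  funext η
  have e2 : (∑ i, (ξ - Pi.single k η : Fin (n + 1) → Space d) i) + η = ∑ i, ξ i := by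
    simp only [Pi.sub_apply, Finset.sum_sub_distrib]
    rw [Finset.sum_pi_single', if_pos (Finset.mem_univ k), sub_add_cancel]
  have e3 : (fun i => U i ((ξ - Pi.single k η : Fin (n + 1) → Space d) i)) =
      Function.update (fun i => U i (ξ i)) k (U k (ξ k - η)) := by
    funext i
    rcases eq_or_ne i k with rfl | h
    · simp
    · simp [h]
  simp only [weakKernel, id]
  rw [e2, e3, sub_add_cancel, Pi.sub_apply, Pi.single_eq_same, map_smul, symSlot_apply, smul_smul]

/-- The pairings with the individual ξ_k add up to the pairing with their sum, which is the factor
produced by the outer derivative. -/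
theorem weakKernel_sum_zero (n : ℕ) (φ : Space d → ℂ) (V : Space d → CVec d)
    (U : Fin (n + 1) → Space d → CVec d) (p : Space d × (Fin (n + 1) → Space d)) :
    ∑ k, weakKernel a n φ V U k 0 p =
      (φ ((∑ i, p.2 i) + p.1) * (2 * Real.pi * Complex.I * dot (∑ i, p.2 i) (V p.1))) •
        symF a n p.2 (fun i => U i (p.2 i)) := by
  simp only [weakKernel, Pi.zero_apply, Pi.single_zero, add_zero]
  rw [← Finset.sum_smul, dot_sum_left, Finset.mul_sum, Finset.mul_sum]

/-- The weak form of `A_n` in Fourier variables. -/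
theorem weak_formula (hr : 1 ≤ r) (ha : SymbolClass r a) (n : ℕ)
    (U : Fin (n + 1) → Space d → CVec d) (hU : ∀ i, Rapid (U i)) {φ : Space d → ℂ}
    (hφ : Measurable φ) {C s : ℝ} (hC : 0 ≤ C) (hs : 0 ≤ s) (hφb : ∀ ξ, ‖φ ξ‖ ≤ C * lam s ξ) :
    ∫ ξ, φ ξ • ftA a n U ξ =
      ∫ ξ : Fin (n + 1) → Space d, φ (∑ i, ξ i) • symF a n ξ (fun i => U i (ξ i)) := by
  induction n generalizing φ C s with
  | zero =>
    have h := (volume_preserving_funUnique (Fin 1) (Space d)).integral_comp'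
      (fun ξ => φ ξ • ftA a 0 U ξ)
    rw [← h]
    congr 1
    funext ξ
    rw [symF_zero, Fin.sum_univ_one]
    rfl
  | succ n ih =>
    have hpi := Real.pi_pos
    set V := U (Fin.last (n + 1)) with hVdef
    set U' : Fin (n + 1) → Space d → CVec d := fun k => U k.castSucc with hU'def
    have hV : Rapid V := hU _
    have hU' : ∀ i, Rapid (U' i) := fun i => hU _
    have hF := rapid_ftA ha n U' hU'
    have hk : ∀ k i, Rapid (Function.update U' k (convN V (U' k)) i) := fun k =>
      rapid_update hU' k (hV.convN (hU' k))
    have hint : ∀ {W : Space d → CVec d}, Rapid W → Integrable fun ξ => φ ξ • W ξ := by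
      intro W hW
      refine ((hW.integrable_norm s).const_mul C).mono' (hφ.smul hW.1).aestronglyMeasurable
        (Filter.Eventually.of_forall fun ξ => ?_)
      rw [norm_smul, ← mul_assoc]
      exact mul_le_mul_of_nonneg_right (hφb ξ) (norm_nonneg _)
    have hK0 : ∀ k, Integrable (weakKernel a n φ V U' k 0) (volume.prod volume) := fun k =>
      integrable_weakKernel hr ha hφ hC hs hφb hV hU' k measurable_const fun η => Or.inl rfl
    have hK1 : ∀ k, Integrable (weakKernel a n φ V U' k id) (volume.prod volume) := fun k =>
      integrable_weakKernel hr ha hφ hC hs hφb hV hU' k measurable_id fun η => Or.inr rfl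
    have hT1 : ∫ ξ, φ ξ • convN V (ftA a n U') ξ =
        ∫ p, ∑ k, weakKernel a n φ V U' k 0 p ∂(volume.prod volume) := by
      rw [hV.integral_smul_convN hF hφ hC hs hφb,
        integral_prod _ (integrable_finsetSum _ fun k _ => hK0 k)]
      congr 1
      funext η
      simp only [weakKernel_sum_zero]
      -- With η fixed, the induction hypothesis is used for φ(· + η) times the pairing with V(η).
      -- This test function grows with order s + 1, which is why φ, C and s must vary in the
      -- induction.
      refine ih U' hU' (φ := fun ξ => φ (ξ + η) * (2 * Real.pi * Complex.I * dot ξ (V η)))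
        (C := C * 2 ^ s * lam s η * (2 * Real.pi) * ‖V η‖) (s := s + 1) ?_ ?_ (by positivity) ?_
      · exact (hφ.comp (measurable_id.add_const η)).mul
          ((measurable_id.dot measurable_const).const_mul _)
      · have := lam_nonneg s η
        positivity
      · intro ξ
        rw [norm_mul, norm_mul, norm_two_pi_I, lam_add]
        have l1 := lam_nonneg s η
        have l2 := lam_nonneg s ξ
        have h3 := (hφb (ξ + η)).trans (mul_le_mul_of_nonneg_left (lam_add_arg_le hs _ _) hC)
        refine (mul_le_mul h3 (mul_le_mul_of_nonneg_left (norm_dot_le_lam ξ (V η)) (by positivity))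
          (by positivity) (by positivity)).trans_eq ?_
        ring
    have hT2 : ∀ k, ∫ ξ, φ ξ • ftA a n (Function.update U' k (convN V (U' k))) ξ =
        ∫ p, weakKernel a n φ V U' k id p ∂(volume.prod volume) := fun k => by
      rw [ih _ (hk k) hφ hC hs hφb]
      exact integral_smul_ftA_update hr ha hφ hC hs hφb hV hU' k
    have hL : ∀ ξ, φ ξ • ftA a (n + 1) U ξ = φ ξ • convN V (ftA a n U') ξ -
        ∑ k, φ ξ • ftA a n (Function.update U' k (convN V (U' k))) ξ := fun ξ => by
      rw [ftA, Pi.sub_apply, Finset.sum_apply, smul_sub, Finset.smul_sum]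
    simp_rw [hL]
    rw [integral_sub (hint (hV.convN hF))
      (integrable_finsetSum _ fun k _ => hint (rapid_ftA ha n _ (hk k))),
      integral_finsetSum _ fun k _ => hint (rapid_ftA ha n _ (hk k)), hT1,
      Finset.sum_congr rfl fun k _ => hT2 k, ← integral_finsetSum _ fun k _ => hK1 k,
      ← integral_sub (integrable_finsetSum _ fun k _ => hK0 k)
        (integrable_finsetSum _ fun k _ => hK1 k),
      -- The variable η becomes the last entry of an (n + 2)-tuple of frequencies; both kinds of
      -- terms now have the same test factor, and their difference is the recursion `symF_succ`.
      ← Measure.volume_eq_prod,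
      ← (volume_preserving_piFinSuccAbove (fun _ : Fin (n + 2) => Space d)
        (Fin.last (n + 1))).integral_comp']
    congr 1
    funext ξ
    have e : MeasurableEquiv.piFinSuccAbove (fun _ : Fin (n + 2) => Space d) (Fin.last (n + 1)) ξ =
        (ξ (Fin.last (n + 1)), fun i => ξ i.castSucc) := by
      refine Prod.ext rfl ?_
      funext i
      exact congrArg ξ (Fin.succAbove_last_apply i)
    rw [e, symF_succ, Finset.smul_sum, ← Finset.sum_sub_distrib]
    refine Finset.sum_congr rfl fun k _ => ?_
    simp only [weakKernel, Pi.zero_apply, Pi.single_zero, add_zero, id]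
    rw [← smul_sub, smul_smul, ← Fin.sum_univ_castSucc]

end WeakForm

/-! ### The convolution estimate -/

section ConvolutionEstimate

open scoped ENNReal

variable {d : ℕ}

theorem lintegral_pi_prod_eq (n : ℕ) (g : Fin n → Space d → ℝ≥0∞) (hg : ∀ j, Measurable (g j)) :
    ∫⁻ y : Fin n → Space d, ∏ j, g j (y j) = ∏ j, ∫⁻ x, g j x := by
  induction n with
  | zero => simp [volume_pi]
  | succ n ih =>
    have h := volume_preserving_piFinSuccAbove (fun _ : Fin (n + 1) => Space d) 0
    rw [← h.symm.lintegral_comp_emb (MeasurableEquiv.measurableEmbedding _)]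
    simp only [Fin.prod_univ_succ]
    have h1 : ∀ p : Space d × (Fin n → Space d),
        (MeasurableEquiv.piFinSuccAbove (fun _ : Fin (n + 1) => Space d) 0).symm p =
          Fin.cons p.1 p.2 := fun p => Fin.insertNth_zero' p.1 p.2
    simp only [h1, Fin.cons_zero, Fin.cons_succ]
    have hm : Measurable fun y : Fin n → Space d => ∏ j, g (Fin.succ j) (y j) :=
      Finset.measurable_prod _ fun j _ => (hg (Fin.succ j)).comp (measurable_pi_apply j)
    rw [Measure.volume_eq_prod, lintegral_prod_mul (hg 0).aemeasurable hm.aemeasurable, ih _ fun j => hg j.succ]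

theorem lintegral_enorm_mul_le {F G : Space d → CVec d} (hF : AEStronglyMeasurable F volume)
    (hG : AEStronglyMeasurable G volume) :
    ∫⁻ x, ‖F x‖ₑ * ‖G x‖ₑ ≤ eLpNorm F 2 volume * eLpNorm G 2 volume := by
  have h := eLpNorm_smul_le_mul_eLpNorm (μ := volume) (p := 2) (q := 2) (r := 1) hG hF.norm
  rw [eLpNorm_one_eq_lintegral_enorm, eLpNorm_norm] at h
  simpa [enorm_smul] using h

/-- Young's inequality for one L² factor and n factors in L¹, paired with G. For fixed values of the
other variables, Cauchy–Schwarz in ξ_k involves only a translate of G, whose L² norm is unchanged.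
-/
theorem lintegral_convolution_le {n : ℕ} (k : Fin (n + 1)) {F G : Space d → CVec d}
    (hF : Measurable F) (hG : Measurable G) (g : Fin n → Space d → ℝ≥0∞)
    (hg : ∀ j, Measurable (g j)) :
    ∫⁻ ξ : Fin (n + 1) → Space d, ‖F (ξ k)‖ₑ * (∏ j, g j (ξ (k.succAbove j))) * ‖G (∑ i, ξ i)‖ₑ ≤
      eLpNorm F 2 volume * eLpNorm G 2 volume * ∏ j, ∫⁻ x, g j x := by
  have h := volume_preserving_piFinSuccAbove (fun _ : Fin (n + 1) => Space d) k
  rw [← h.symm.lintegral_comp_emb (MeasurableEquiv.measurableEmbedding _)]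
  have h1 : ∀ p : Space d × (Fin n → Space d),
      (MeasurableEquiv.piFinSuccAbove (fun _ : Fin (n + 1) => Space d) k).symm p =
        k.insertNth p.1 p.2 := fun p => rfl
  simp only [h1, Fin.sum_univ_succAbove _ k, Fin.insertNth_apply_same,
    Fin.insertNth_apply_succAbove]
  have hm : Measurable fun p : Space d × (Fin n → Space d) => ∏ j, g j (p.2 j) :=
    Finset.measurable_prod _ fun j _ => (hg j).comp ((measurable_pi_apply j).comp measurable_snd)
  have hs : Measurable fun p : Space d × (Fin n → Space d) => p.1 + ∑ j, p.2 j :=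
    measurable_fst.add (Finset.measurable_sum _ fun j _ =>
      (measurable_pi_apply j).comp measurable_snd)
  have hFm : Measurable fun p : Space d × (Fin n → Space d) => ‖F p.1‖ₑ :=
    (hF.comp measurable_fst).enorm
  have hGm : Measurable fun p : Space d × (Fin n → Space d) => ‖G (p.1 + ∑ j, p.2 j)‖ₑ :=
    (hG.comp hs).enorm
  have hH : Measurable fun p : Space d × (Fin n → Space d) =>
      ‖F p.1‖ₑ * (∏ j, g j (p.2 j)) * ‖G (p.1 + ∑ j, p.2 j)‖ₑ := (hFm.mul hm).mul hGm
  rw [Measure.volume_eq_prod, lintegral_prod_symm _ hH.aemeasurable, ← lintegral_pi_prod_eq n g hg,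
    ← lintegral_const_mul]
  · refine lintegral_mono fun y => ?_
    have e1 : ∀ x, ‖F x‖ₑ * (∏ j, g j (y j)) * ‖G (x + ∑ j, y j)‖ₑ =
        (∏ j, g j (y j)) * (‖F x‖ₑ * ‖G (x + ∑ j, y j)‖ₑ) := fun x => by ring
    simp only [e1]
    have hGy : Measurable fun x => G (x + ∑ j, y j) := hG.comp (measurable_id.add_const _)
    have hFG : Measurable fun x => ‖F x‖ₑ * ‖G (x + ∑ j, y j)‖ₑ := hF.enorm.mul hGy.enorm
    rw [lintegral_const_mul _ hFG, mul_comm]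
    refine mul_le_mul_left ((lintegral_enorm_mul_le hF.aestronglyMeasurable
      hGy.aestronglyMeasurable).trans_eq ?_) _
    congr 1
    exact eLpNorm_comp_measurePreserving hG.aestronglyMeasurable
      (measurePreserving_add_right volume (∑ j, y j))
  · exact Finset.measurable_prod _ fun j _ => (hg j).comp (measurable_pi_apply j)

end ConvolutionEstimate

/-! ### The weighted density and its duality bound -/

section Density

open scoped ENNReal

variable {d : ℕ} {r q : ℝ} {a : Space d → (CVec d →L[ℂ] CVec d)}

/-- The sum is at most n + 1 times its largest term. Unlike `rpow_sum_lam_le`, this loads only one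
frequency at a time. -/
theorem rpow_sum_lam_le_sum {n : ℕ} {s : ℝ} (hs : 0 ≤ s) (ξ : Fin (n + 1) → Space d) :
    (∑ i, lam 1 (ξ i)) ^ s ≤ (n + 1 : ℝ) ^ s * ∑ k, lam s (ξ k) := by
  obtain ⟨k, -, hk⟩ := Finset.exists_max_image Finset.univ (fun i => lam 1 (ξ i))
    Finset.univ_nonempty
  have h : ∑ i, lam 1 (ξ i) ≤ (n + 1 : ℝ) * lam 1 (ξ k) := by
    refine (Finset.sum_le_sum fun i hi => hk i hi).trans_eq ?_
    simp
  refine (Real.rpow_le_rpow (Finset.sum_nonneg fun _ _ => lam_nonneg _ _) h hs).trans ?_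
  rw [Real.mul_rpow (by positivity) (lam_nonneg _ _), ← lam_eq_rpow]
  refine mul_le_mul_of_nonneg_left ?_ (by positivity)
  exact Finset.single_le_sum (f := fun i => lam s (ξ i)) (fun _ _ => lam_nonneg _ _)
    (Finset.mem_univ k)

/-- The weighted symbol, whose push-forward under `ξ ↦ ∑ i, ξ i` is `λ_{q-r}` times the Fourier
transform of `A_n`. -/
noncomputable def dens (a : Space d → (CVec d →L[ℂ] CVec d)) (s : ℝ) {n : ℕ}
    (V : Fin (n + 1) → Space d → CVec d) (ξ : Fin (n + 1) → Space d) : CVec d :=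
  lam s (∑ i, ξ i) • symF a n ξ (fun i => V i (ξ i))

theorem measurable_sum_apply {n : ℕ} : Measurable fun ξ : Fin n → Space d => ∑ i, ξ i :=
  Finset.measurable_sum _ fun i _ => measurable_pi_apply i

theorem SymbolClass.measurable_dens (ha : SymbolClass r a) (s : ℝ) {n : ℕ}
    {V : Fin (n + 1) → Space d → CVec d} (hV : ∀ i, Measurable (V i)) :
    Measurable (dens a s V) :=
  ((measurable_lam s).comp measurable_sum_apply).smul
    (ha.measurable_symF measurable_id (measurable_pi_iff.2 fun i =>
      (hV i).comp (measurable_pi_apply i)))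

/-- As q ≥ r, the output weight is at most M^{q-r} with M the total weight, so altogether the power
M^{q-1} has to be distributed. It goes to one slot k at a time, giving λ_q there and λ_1 in all
others. -/
theorem norm_dens_le (hr : 1 ≤ r) (hrq : r ≤ q) (ha : SymbolClass r a) (n : ℕ) :
    ∃ C : ℝ, 0 ≤ C ∧ ∀ (V : Fin (n + 1) → Space d → CVec d) (ξ : Fin (n + 1) → Space d),
      ‖dens a (q - r) V ξ‖ ≤ C * ∑ k, ‖lam q (ξ k) • V k (ξ k)‖ *
        ∏ j : Fin n, ‖lam 1 (ξ (k.succAbove j)) • V (k.succAbove j) (ξ (k.succAbove j))‖ := by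
  obtain ⟨C, hC0, hC⟩ := symF_bound hr ha n
  refine ⟨C * (n + 1 : ℝ) ^ (q - 1), by positivity, fun V ξ => ?_⟩
  have hM0 : 0 < ∑ i, lam 1 (ξ i) := Finset.sum_pos (fun _ _ => lam_pos _ _) Finset.univ_nonempty
  have h1 : lam (q - r) (∑ i, ξ i) ≤ (∑ i, lam 1 (ξ i)) ^ (q - r) := by
    rw [lam_eq_rpow]
    exact Real.rpow_le_rpow (lam_nonneg _ _) (lam_one_sum_le _ ξ Finset.univ_nonempty)
      (by linarith)
  have h2 : (∑ i, lam 1 (ξ i)) ^ (q - r) * (∑ i, lam 1 (ξ i)) ^ (r - 1) =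
      (∑ i, lam 1 (ξ i)) ^ (q - 1) := by
    rw [← Real.rpow_add hM0]; congr 1; ring
  have hP : 0 ≤ ∏ i, (lam 1 (ξ i) * ‖V i (ξ i)‖) :=
    Finset.prod_nonneg fun _ _ => mul_nonneg (lam_nonneg _ _) (norm_nonneg _)
  have hn : ∀ (t : ℝ) (k : Fin (n + 1)), ‖lam t (ξ k) • V k (ξ k)‖ = lam t (ξ k) * ‖V k (ξ k)‖ :=
    fun t k => by rw [norm_smul, Real.norm_of_nonneg (lam_nonneg _ _)]
  have h3 : ∑ k, ‖lam q (ξ k) • V k (ξ k)‖ *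
      ∏ j : Fin n, ‖lam 1 (ξ (k.succAbove j)) • V (k.succAbove j) (ξ (k.succAbove j))‖ =
      (∑ k, lam (q - 1) (ξ k)) * ∏ i, (lam 1 (ξ i) * ‖V i (ξ i)‖) := by
    rw [Finset.sum_mul]
    refine Finset.sum_congr rfl fun k _ => ?_
    rw [Fin.prod_univ_succAbove _ k]
    simp only [hn]
    rw [← mul_assoc, ← mul_assoc, ← lam_add, sub_add_cancel]
  rw [h3, dens, norm_smul, Real.norm_of_nonneg (lam_nonneg _ _)]
  calc lam (q - r) (∑ i, ξ i) * ‖symF a n ξ fun i => V i (ξ i)‖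
      ≤ (∑ i, lam 1 (ξ i)) ^ (q - r) *
          (C * ((∑ i, lam 1 (ξ i)) ^ (r - 1) * ∏ i, (lam 1 (ξ i) * ‖V i (ξ i)‖))) :=
        mul_le_mul h1 (hC _ _) (norm_nonneg _) (Real.rpow_nonneg hM0.le _)
    _ = C * ((∑ i, lam 1 (ξ i)) ^ (q - 1) * ∏ i, (lam 1 (ξ i) * ‖V i (ξ i)‖)) := by
        rw [← h2]; ring
    _ ≤ C * (((n + 1 : ℝ) ^ (q - 1) * ∑ k, lam (q - 1) (ξ k)) *
          ∏ i, (lam 1 (ξ i) * ‖V i (ξ i)‖)) :=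
        mul_le_mul_of_nonneg_left (mul_le_mul_of_nonneg_right
          (rpow_sum_lam_le_sum (by linarith) ξ) hP) hC0
    _ = _ := by ring

theorem enorm_dens_le (hr : 1 ≤ r) (hrq : r ≤ q) (ha : SymbolClass r a) (n : ℕ) :
    ∃ C : ℝ, 0 ≤ C ∧ ∀ (V : Fin (n + 1) → Space d → CVec d) (ξ : Fin (n + 1) → Space d),
      ‖dens a (q - r) V ξ‖ₑ ≤ ENNReal.ofReal C * ∑ k, ‖lam q (ξ k) • V k (ξ k)‖ₑ *
        ∏ j : Fin n, ‖lam 1 (ξ (k.succAbove j)) • V (k.succAbove j) (ξ (k.succAbove j))‖ₑ := by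
  obtain ⟨C, hC0, hC⟩ := norm_dens_le hr hrq ha n
  refine ⟨C, hC0, fun V ξ => ?_⟩
  rw [← ofReal_norm]
  refine (ENNReal.ofReal_le_ofReal (hC V ξ)).trans_eq ?_
  rw [ENNReal.ofReal_mul hC0, ENNReal.ofReal_sum_of_nonneg fun k _ =>
    mul_nonneg (norm_nonneg _) (Finset.prod_nonneg fun _ _ => norm_nonneg _)]
  congr 1
  refine Finset.sum_congr rfl fun k _ => ?_
  rw [ENNReal.ofReal_mul (norm_nonneg _), ENNReal.ofReal_prod_of_nonneg fun _ _ => norm_nonneg _]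
  simp only [ofReal_norm]

theorem lintegral_lam_one_smul_le {V : Space d → CVec d}
    (hV : AEStronglyMeasurable V volume) :
    ∫⁻ ξ, ‖lam 1 ξ • V ξ‖ₑ ≤ eLpNorm (lam (1 - q) : Space d → ℝ) 2 volume *
      eLpNorm (fun ξ => lam q ξ • V ξ) 2 volume := by
  have h := eLpNorm_smul_le_mul_eLpNorm (μ := volume) (p := 2) (q := 2) (r := 1)
    (f := fun ξ => lam q ξ • V ξ) ((measurable_lam q).aestronglyMeasurable.smul hV)
    (measurable_lam (d := d) (1 - q)).aestronglyMeasurable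
  rw [eLpNorm_one_eq_lintegral_enorm] at h
  refine (lintegral_congr fun ξ => ?_).trans_le h
  rw [Pi.smul_apply', smul_smul, ← lam_add, sub_add_cancel]

/-- Here q > 1 + d/2 enters: it makes the L² norm K of λ_{1-q} finite. The n factors of weight λ_1
are in L¹ at the cost of K each, and there are n + 1 choices of the distinguished slot. -/
theorem lintegral_inner_dens_le (hr : 1 ≤ r) (hq : 1 + (d : ℝ) / 2 < q) (hrq : r ≤ q)
    (ha : SymbolClass r a) (n : ℕ) : ∃ C : ℝ, 0 ≤ C ∧
      ∀ V : Fin (n + 1) → Space d → CVec d, (∀ i, Measurable (V i)) →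
        ∀ φ : Space d → CVec d, Measurable φ →
          ∫⁻ ξ, ‖inner ℂ (dens a (q - r) V ξ) (φ (∑ i, ξ i))‖ₑ ≤
            ENNReal.ofReal C * (∏ i, eLpNorm (fun ξ => lam q ξ • V i ξ) 2 volume) *
              eLpNorm φ 2 volume := by
  obtain ⟨C, hC0, hC⟩ := enorm_dens_le hr hrq ha n
  have hK : MemLp (lam (1 - q) : Space d → ℝ) 2 volume := by
    have := memLp_lam_neg (d := d) (t := q - 1) (by linarith)
    rwa [neg_sub] at this
  set K := eLpNorm (lam (1 - q) : Space d → ℝ) 2 volume with hKdef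
  have hKt : K ≠ ⊤ := hK.eLpNorm_lt_top.ne
  refine ⟨C * ((n + 1 : ℝ) * K.toReal ^ n), by positivity, fun V hV φ hφ => ?_⟩
  have hmW : ∀ (t : ℝ) (i : Fin (n + 1)), Measurable fun ξ => lam t ξ • V i ξ := fun t i =>
    (measurable_lam t).smul (hV i)
  have h1 : ∀ ξ : Fin (n + 1) → Space d, ‖inner ℂ (dens a (q - r) V ξ) (φ (∑ i, ξ i))‖ₑ ≤
      ENNReal.ofReal C * ∑ k, ‖lam q (ξ k) • V k (ξ k)‖ₑ *
        (∏ j : Fin n, ‖lam 1 (ξ (k.succAbove j)) • V (k.succAbove j) (ξ (k.succAbove j))‖ₑ) *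
          ‖φ (∑ i, ξ i)‖ₑ := fun ξ => by
    have h : ‖inner ℂ (dens a (q - r) V ξ) (φ (∑ i, ξ i))‖ₑ ≤
        ‖dens a (q - r) V ξ‖ₑ * ‖φ (∑ i, ξ i)‖ₑ := by
      simp only [← ofReal_norm]
      rw [← ENNReal.ofReal_mul (norm_nonneg _)]
      exact ENNReal.ofReal_le_ofReal (norm_inner_le_norm _ _)
    refine h.trans ((mul_le_mul_left (hC V ξ) _).trans_eq ?_)
    rw [mul_assoc, Finset.sum_mul]
  refine (lintegral_mono h1).trans ?_
  have hm : ∀ k : Fin (n + 1), Measurable fun ξ : Fin (n + 1) → Space d =>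
      ‖lam q (ξ k) • V k (ξ k)‖ₑ *
        (∏ j : Fin n, ‖lam 1 (ξ (k.succAbove j)) • V (k.succAbove j) (ξ (k.succAbove j))‖ₑ) *
          ‖φ (∑ i, ξ i)‖ₑ := fun k => by
    have hW : ∀ (t : ℝ) (i : Fin (n + 1)),
        Measurable fun ξ : Fin (n + 1) → Space d => ‖lam t (ξ i) • V i (ξ i)‖ₑ := fun t i =>
      ((hmW t i).comp (measurable_pi_apply i)).enorm
    have hφm : Measurable fun ξ : Fin (n + 1) → Space d => ‖φ (∑ i, ξ i)‖ₑ :=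
      (hφ.comp measurable_sum_apply).enorm
    exact ((hW q k).mul (Finset.measurable_prod _ fun j _ => hW 1 (k.succAbove j))).mul hφm
  rw [lintegral_const_mul _ (Finset.measurable_sum _ fun k _ => hm k),
    lintegral_finsetSum _ fun k _ => hm k]
  have h2 : ∀ k : Fin (n + 1), ∫⁻ ξ : Fin (n + 1) → Space d, ‖lam q (ξ k) • V k (ξ k)‖ₑ *
        (∏ j : Fin n, ‖lam 1 (ξ (k.succAbove j)) • V (k.succAbove j) (ξ (k.succAbove j))‖ₑ) *
          ‖φ (∑ i, ξ i)‖ₑ ≤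
      K ^ n * (∏ i, eLpNorm (fun ξ => lam q ξ • V i ξ) 2 volume) * eLpNorm φ 2 volume := fun k => by
    refine (lintegral_convolution_le k (hmW q k) hφ
      (fun j ξ => ‖lam 1 ξ • V (k.succAbove j) ξ‖ₑ)
      fun j => (hmW 1 (k.succAbove j)).enorm).trans ?_
    have h3 : ∏ j : Fin n, ∫⁻ ξ, ‖lam 1 ξ • V (k.succAbove j) ξ‖ₑ ≤
        ∏ j : Fin n, K * eLpNorm (fun ξ => lam q ξ • V (k.succAbove j) ξ) 2 volume :=
      Finset.prod_le_prod' fun j _ => lintegral_lam_one_smul_le (hV _).aestronglyMeasurable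
    refine (mul_le_mul_right h3 _).trans_eq ?_
    rw [Fin.prod_univ_succAbove _ k, Finset.prod_mul_distrib, Finset.prod_const, Finset.card_univ,
      Fintype.card_fin]
    ring
  refine (mul_le_mul_right (Finset.sum_le_sum fun k _ => h2 k) _).trans_eq ?_
  rw [Finset.sum_const, Finset.card_univ, Fintype.card_fin, nsmul_eq_mul, ENNReal.ofReal_mul hC0,
    ENNReal.ofReal_mul (by positivity), ENNReal.ofReal_pow ENNReal.toReal_nonneg,
    ENNReal.ofReal_toReal hKt]
  have : ENNReal.ofReal (n + 1 : ℝ) = ((n + 1 : ℕ) : ℝ≥0∞) := by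
    rw [← ENNReal.ofReal_natCast]; push_cast; rfl
  rw [this]
  ring

end Density

/-! ### The bounded extension -/

section WeightedIso

variable {d : ℕ}

theorem lam_neg_le_one {s : ℝ} (hs : 0 ≤ s) (ξ : Space d) : lam (-s) ξ ≤ 1 := by
  rw [lam_neg]
  exact inv_le_one_of_one_le₀ (one_le_lam hs ξ)

theorem MeasureTheory.MemLp.lam_neg_smul {s : ℝ} (hs : 0 ≤ s) {g : Space d → CVec d}
    (hg : MemLp g 2 volume) : MemLp (fun ξ => lam (-s) ξ • g ξ) 2 volume := by
  refine hg.of_le ((measurable_lam (-s)).aestronglyMeasurable.smul hg.1)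
    (Filter.Eventually.of_forall fun ξ => ?_)
  rw [norm_smul, Real.norm_of_nonneg (lam_nonneg _ _)]
  exact mul_le_of_le_one_left (norm_nonneg _) (lam_neg_le_one hs ξ)

/-- Divide by the weight and invert the transform; for s ≥ 0 the quotient is still in L². -/
theorem Sobolev.weighted_surjective {s : ℝ} (hs : 0 ≤ s) :
    Function.Surjective (Sobolev.weighted d s) := by
  intro g
  have hm := (Lp.memLp g).lam_neg_smul hs
  set f : L2Field d := 𝓕⁻ (hm.toLp _) with hf
  have hF : (𝓕 f : L2Field d) = hm.toLp _ := FourierTransform.fourier_fourierInv_eq _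
  have hae : (fun ξ => lam s ξ • (𝓕 f : L2Field d) ξ) =ᵐ[volume] g := by
    rw [hF]
    filter_upwards [hm.coeFn_toLp] with ξ hξ
    rw [hξ, smul_smul, ← lam_add, add_neg_cancel, lam_zero, one_smul]
  have hmem : f ∈ sobolevSubmodule d s := (Lp.memLp g).ae_eq hae.symm
  refine ⟨⟨f, hmem⟩, Lp.ext ?_⟩
  exact (MemLp.coeFn_toLp (Sobolev.memLp_weighted (⟨f, hmem⟩ : Sobolev d s))).trans hae

/-- The isometry `f ↦ λ_s · 𝓕 f` of `H^s` onto `L²`. -/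
noncomputable def Sobolev.weightedEquiv {s : ℝ} (hs : 0 ≤ s) : Sobolev d s ≃ₗᵢ[ℂ] L2Field d where
  toLinearEquiv := LinearEquiv.ofBijective (Sobolev.weighted d s)
    ⟨Sobolev.weighted_injective d s, Sobolev.weighted_surjective hs⟩
  norm_map' _ := rfl

theorem Sobolev.coeFn_weighted {s : ℝ} (f : Sobolev d s) :
    Sobolev.weighted d s f =ᵐ[volume] fun ξ => lam s ξ • (𝓕 (Sobolev.toL2 f) : L2Field d) ξ :=
  (Sobolev.memLp_weighted f).coeFn_toLp

theorem Sobolev.eLpNorm_weighted {s : ℝ} (f : Sobolev d s) :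
    eLpNorm (fun ξ => lam s ξ • (𝓕 (Sobolev.toL2 f) : L2Field d) ξ) 2 volume =
      ENNReal.ofReal ‖f‖ := by
  have h : ‖f‖ = ‖Sobolev.weighted d s f‖ := rfl
  rw [h, Lp.norm_def, ENNReal.ofReal_toReal (Lp.eLpNorm_ne_top _)]
  exact (eLpNorm_congr_ae (Sobolev.coeFn_weighted f)).symm

theorem fourier_Lp_add (f g : L2Field d) : (𝓕 (f + g) : L2Field d) = 𝓕 f + 𝓕 g :=
  (Lp.fourierTransformₗᵢ (Space d) (CVec d)).map_add f g

theorem fourier_Lp_smul (c : ℂ) (f : L2Field d) : (𝓕 (c • f) : L2Field d) = c • 𝓕 f :=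
  (Lp.fourierTransformₗᵢ (Space d) (CVec d)).map_smul c f

end WeightedIso

/-! ### Null sets under the sum map and the coordinate maps -/

section AlmostEverywhere

variable {d : ℕ}

/-- A surjective linear map pushes Lebesgue measure to a multiple of Lebesgue measure. This makes
φ(∑ ξ_i) independent, up to null sets, of the representative of φ. -/
theorem quasiMeasurePreserving_sum (n : ℕ) : Measure.QuasiMeasurePreserving
    (fun ξ : Fin (n + 1) → Space d => ∑ i, ξ i) volume volume := by
  let L : (Fin (n + 1) → Space d) →ₗ[ℝ] Space d := ∑ i, LinearMap.proj i
  have hL : ∀ ξ, L ξ = ∑ i, ξ i := fun ξ => by simp [L]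
  have hs : Function.Surjective L := fun x => ⟨Pi.single 0 x, by rw [hL]; simp⟩
  refine ⟨measurable_sum_apply, ?_⟩
  obtain ⟨c, -, hc⟩ := L.exists_map_addHaar_eq_smul_addHaar volume volume hs
  have : (fun ξ : Fin (n + 1) → Space d => ∑ i, ξ i) = L := funext fun ξ => (hL ξ).symm
  rw [this, hc]
  exact Measure.smul_absolutelyContinuous

theorem ae_sum_apply {n : ℕ} {p : Space d → Prop} (h : ∀ᵐ η ∂(volume : Measure (Space d)), p η) :
    ∀ᵐ ξ : Fin (n + 1) → Space d, p (∑ i, ξ i) :=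
  (quasiMeasurePreserving_sum n).ae h

theorem ae_eval {n : ℕ} (i : Fin n) {p : Space d → Prop}
    (h : ∀ᵐ η ∂(volume : Measure (Space d)), p η) : ∀ᵐ ξ : Fin n → Space d, p (ξ i) :=
  (Measure.quasiMeasurePreserving_eval (fun _ : Fin n => (volume : Measure (Space d))) i).ae h

end AlmostEverywhere

/-! ### Construction of the extension by duality -/

section Extension

variable {d : ℕ} {r q : ℝ} {a : Space d → (CVec d →L[ℂ] CVec d)} {n : ℕ}

/-- The Fourier transforms of a tuple of elements of `H^q`. -/
noncomputable def fourierTuple (v : Fin (n + 1) → Sobolev d q) (i : Fin (n + 1)) :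
    Space d → CVec d :=
  (𝓕 (Sobolev.toL2 (v i)) : L2Field d)

theorem measurable_fourierTuple (v : Fin (n + 1) → Sobolev d q) (i : Fin (n + 1)) :
    Measurable (fourierTuple v i) :=
  (Lp.stronglyMeasurable _).measurable

/-- The sesquilinear pairing of `λ_{q-r}` times the Fourier transform of `A_n v` with `φ`. -/
noncomputable def densPairing (a : Space d → (CVec d →L[ℂ] CVec d)) (s : ℝ)
    (v : Fin (n + 1) → Sobolev d q) (φ : L2Field d) : ℂ :=
  ∫ ξ : Fin (n + 1) → Space d, inner ℂ (dens a s (fourierTuple v) ξ) (φ (∑ i, ξ i))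

theorem densPairing_bound (hr : 1 ≤ r) (hq : 1 + (d : ℝ) / 2 < q) (hrq : r ≤ q)
    (ha : SymbolClass r a) (n : ℕ) : ∃ C : ℝ, 0 ≤ C ∧
      ∀ (v : Fin (n + 1) → Sobolev d q) (φ : L2Field d),
        Integrable (fun ξ : Fin (n + 1) → Space d =>
          inner ℂ (dens a (q - r) (fourierTuple v) ξ) (φ (∑ i, ξ i))) ∧
        ‖densPairing a (q - r) v φ‖ ≤ C * (∏ i, ‖v i‖) * ‖φ‖ := by
  obtain ⟨C, hC0, hC⟩ := lintegral_inner_dens_le hr hq hrq ha n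
  refine ⟨C, hC0, fun v φ => ?_⟩
  have h := hC (fourierTuple v) (measurable_fourierTuple v) φ
    (Lp.stronglyMeasurable φ).measurable
  have h1 : ∀ i, eLpNorm (fun ξ => lam q ξ • fourierTuple v i ξ) 2 volume = ENNReal.ofReal ‖v i‖ :=
    fun i => Sobolev.eLpNorm_weighted (v i)
  have h2 : eLpNorm φ 2 volume = ENNReal.ofReal ‖φ‖ := by
    rw [Lp.norm_def, ENNReal.ofReal_toReal (Lp.eLpNorm_ne_top _)]
  have hP : 0 ≤ ∏ i, ‖v i‖ := Finset.prod_nonneg fun _ _ => norm_nonneg _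
  simp only [h1] at h
  rw [h2, ← ENNReal.ofReal_prod_of_nonneg fun _ _ => norm_nonneg _, ← ENNReal.ofReal_mul hC0,
    ← ENNReal.ofReal_mul (mul_nonneg hC0 hP)] at h
  have hm : Measurable fun ξ : Fin (n + 1) → Space d =>
      (inner ℂ (dens a (q - r) (fourierTuple v) ξ) (φ (∑ i, ξ i)) : ℂ) :=
    (ha.measurable_dens _ (measurable_fourierTuple v)).inner
      ((Lp.stronglyMeasurable φ).measurable.comp measurable_sum_apply)
  refine ⟨⟨hm.aestronglyMeasurable, h.trans_lt ENNReal.ofReal_lt_top⟩, ?_⟩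
  have h3 := (enorm_integral_le_lintegral_enorm _).trans h
  rw [← ofReal_norm] at h3
  exact (ENNReal.ofReal_le_ofReal_iff
    (mul_nonneg (mul_nonneg hC0 hP) (norm_nonneg _))).1 h3

theorem dens_fourierTuple_update_add (s : ℝ) (v : Fin (n + 1) → Sobolev d q) (k : Fin (n + 1))
    (x y : Sobolev d q) :
    ∀ᵐ ξ : Fin (n + 1) → Space d, dens a s (fourierTuple (Function.update v k (x + y))) ξ =
      dens a s (fourierTuple (Function.update v k x)) ξ +
        dens a s (fourierTuple (Function.update v k y)) ξ := by
  have h : ∀ᵐ η ∂(volume : Measure (Space d)), (𝓕 (Sobolev.toL2 (x + y)) : L2Field d) η =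
      (𝓕 (Sobolev.toL2 x) : L2Field d) η + (𝓕 (Sobolev.toL2 y) : L2Field d) η := by
    rw [map_add, fourier_Lp_add]
    exact Lp.coeFn_add _ _
  have hu : ∀ (z : Sobolev d q) (ξ : Fin (n + 1) → Space d),
      (fun i => fourierTuple (Function.update v k z) i (ξ i)) =
        Function.update (fun i => fourierTuple v i (ξ i)) k
          ((𝓕 (Sobolev.toL2 z) : L2Field d) (ξ k)) := fun z ξ => by
    funext i
    rcases eq_or_ne i k with rfl | hi
    · simp [fourierTuple]
    · simp [fourierTuple, hi]
  filter_upwards [ae_eval k h] with ξ hξ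
  simp only [dens, hu]
  rw [hξ, symF_update_add, smul_add]

theorem dens_fourierTuple_update_smul (s : ℝ) (v : Fin (n + 1) → Sobolev d q) (k : Fin (n + 1))
    (c : ℂ) (x : Sobolev d q) :
    ∀ᵐ ξ : Fin (n + 1) → Space d, dens a s (fourierTuple (Function.update v k (c • x))) ξ =
      c • dens a s (fourierTuple (Function.update v k x)) ξ := by
  have h : ∀ᵐ η ∂(volume : Measure (Space d)), (𝓕 (Sobolev.toL2 (c • x)) : L2Field d) η =
      c • (𝓕 (Sobolev.toL2 x) : L2Field d) η := by
    rw [map_smul, fourier_Lp_smul]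
    exact Lp.coeFn_smul _ _
  have hu : ∀ (z : Sobolev d q) (ξ : Fin (n + 1) → Space d),
      (fun i => fourierTuple (Function.update v k z) i (ξ i)) =
        Function.update (fun i => fourierTuple v i (ξ i)) k
          ((𝓕 (Sobolev.toL2 z) : L2Field d) (ξ k)) := fun z ξ => by
    funext i
    rcases eq_or_ne i k with rfl | hi
    · simp [fourierTuple]
    · simp [fourierTuple, hi]
  filter_upwards [ae_eval k h] with ξ hξ
  simp only [dens, hu]
  rw [hξ, symF_update_smul, smul_comm]

/-- The Riesz theorem represents the bounded functional φ ↦ `densPairing` by a vector T v. Both this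
pairing and the inner product are conjugate-linear in the first argument, so T is complex
multilinear; the norm bound passes through the Riesz isometry. -/
theorem exists_weighted_extension (hr : 1 ≤ r) (hq : 1 + (d : ℝ) / 2 < q) (hrq : r ≤ q)
    (ha : SymbolClass r a) (n : ℕ) :
    ∃ T : ContinuousMultilinearMap ℂ (fun _ : Fin (n + 1) => Sobolev d q) (L2Field d),
      ∀ v φ, inner ℂ (T v) φ = densPairing a (q - r) v φ := by
  obtain ⟨C, hC0, hC⟩ := densPairing_bound hr hq hrq ha n
  let ℓ : (Fin (n + 1) → Sobolev d q) → (L2Field d →L[ℂ] ℂ) := fun v =>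
    LinearMap.mkContinuous
      { toFun := densPairing a (q - r) v
        map_add' := fun φ ψ => by
          simp only [densPairing]
          rw [← integral_add (hC v φ).1 (hC v ψ).1]
          refine integral_congr_ae ?_
          filter_upwards [ae_sum_apply (Lp.coeFn_add φ ψ)] with ξ hξ
          rw [hξ, Pi.add_apply, inner_add_right]
        map_smul' := fun c φ => by
          simp only [densPairing, RingHom.id_apply]
          rw [← integral_smul]
          refine integral_congr_ae ?_
          filter_upwards [ae_sum_apply (Lp.coeFn_smul c φ)] with ξ hξ
          rw [hξ, Pi.smul_apply, inner_smul_right, smul_eq_mul] }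
      (C * ∏ i, ‖v i‖) fun φ => (hC v φ).2
  let T0 : (Fin (n + 1) → Sobolev d q) → L2Field d := fun v =>
    (InnerProductSpace.toDual ℂ (L2Field d)).symm (ℓ v)
  have hT : ∀ v φ, inner ℂ (T0 v) φ = densPairing a (q - r) v φ := fun v φ =>
    InnerProductSpace.toDual_symm_apply
  let T : MultilinearMap ℂ (fun _ : Fin (n + 1) => Sobolev d q) (L2Field d) :=
    { toFun := T0
      map_update_add' := fun {inst} v k x y => by
        cases Subsingleton.elim inst (instDecidableEqFin (n + 1))
        refine ext_inner_right ℂ fun φ => ?_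
        rw [inner_add_left, hT, hT, hT]
        simp only [densPairing]
        rw [← integral_add (hC _ φ).1 (hC _ φ).1]
        refine integral_congr_ae ?_
        filter_upwards [dens_fourierTuple_update_add (a := a) (q - r) v k x y] with ξ hξ
        rw [hξ, inner_add_left]
      map_update_smul' := fun {inst} v k c x => by
        cases Subsingleton.elim inst (instDecidableEqFin (n + 1))
        refine ext_inner_right ℂ fun φ => ?_
        rw [inner_smul_left, hT, hT]
        simp only [densPairing]
        rw [← smul_eq_mul, ← integral_smul]
        refine integral_congr_ae ?_
        filter_upwards [dens_fourierTuple_update_smul (a := a) (q - r) v k c x] with ξ hξ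
        rw [hξ, inner_smul_left, smul_eq_mul] }
  refine ⟨T.mkContinuous C fun v => ?_, hT⟩
  have h1 : ‖T v‖ = ‖ℓ v‖ := LinearIsometryEquiv.norm_map _ _
  rw [h1]
  exact LinearMap.mkContinuous_norm_le _
    (mul_nonneg hC0 (Finset.prod_nonneg fun _ _ => norm_nonneg _)) _

theorem exists_extension (hr : 1 ≤ r) (hq : 1 + (d : ℝ) / 2 < q) (hrq : r ≤ q)
    (ha : SymbolClass r a) (n : ℕ) :
    ∃ B : ContinuousMultilinearMap ℂ (fun _ : Fin (n + 1) => Sobolev d q) (Sobolev d (q - r)),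
      ∀ v φ, inner ℂ (Sobolev.weighted d (q - r) (B v)) φ = densPairing a (q - r) v φ := by
  obtain ⟨T, hT⟩ := exists_weighted_extension hr hq hrq ha n
  have hs : 0 ≤ q - r := by linarith
  let e := (Sobolev.weightedEquiv (d := d) hs).symm.toContinuousLinearEquiv
  refine ⟨(e : L2Field d →L[ℂ] Sobolev d (q - r)).compContinuousMultilinearMap T, fun v φ => ?_⟩
  rw [← hT]
  congr 1
  exact (Sobolev.weightedEquiv (d := d) hs).apply_symm_apply (T v)

end Extension

/-! ### Agreement on `H^∞` -/

section Agreement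

variable {d : ℕ} {r q : ℝ} {a : Space d → (CVec d →L[ℂ] CVec d)} {n : ℕ}

theorem integrable_smul_symF (hr : 1 ≤ r) (ha : SymbolClass r a)
    {U : Fin (n + 1) → Space d → CVec d} (hU : ∀ i, Rapid (U i)) {φ : Space d → ℂ}
    (hφ : Measurable φ) {C s : ℝ} (hC : 0 ≤ C) (hs : 0 ≤ s) (hφb : ∀ ξ, ‖φ ξ‖ ≤ C * lam s ξ) :
    Integrable fun ξ : Fin (n + 1) → Space d =>
      φ (∑ i, ξ i) • symF a n ξ (fun i => U i (ξ i)) := by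
  obtain ⟨B, hB0, hB⟩ := symF_poly_bound hr ha n
  have hint : Integrable (fun ξ : Fin (n + 1) → Space d =>
      ∏ i, (lam (s + r) (ξ i) * ‖U i (ξ i)‖)) :=
    Integrable.fintype_prod fun i => (hU i).integrable_norm (s + r)
  refine (hint.const_mul (C * (n + 1 : ℝ) ^ s * B)).mono' (Measurable.aestronglyMeasurable ?_)
    (Filter.Eventually.of_forall fun ξ => ?_)
  · exact (hφ.comp measurable_sum_apply).smul (ha.measurable_symF measurable_id
      (measurable_pi_iff.2 fun i => (hU i).1.comp (measurable_pi_apply i)))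
  · rw [norm_smul]
    have hP : 0 ≤ ∏ i, lam s (ξ i) := Finset.prod_nonneg fun _ _ => lam_nonneg _ _
    have e1 := (hφb (∑ i, ξ i)).trans (mul_le_mul_of_nonneg_left (lam_sum_le hs ξ) hC)
    refine (mul_le_mul e1 (hB ξ _) (norm_nonneg _) (by positivity)).trans_eq ?_
    simp only [Finset.prod_mul_distrib, lam_add]
    ring

/-- Tested against a smooth compactly supported g and a fixed vector e, the left side is a pairing
of T with g e in L², hence a `densPairing`; the right side is the weak formula for the test function
g λ_{q-r}. The two integrands over tuples coincide almost everywhere. -/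
theorem ae_eq_of_inner_eq_densPairing (hr : 1 ≤ r) (hrq : r ≤ q) (ha : SymbolClass r a)
    {U : Fin (n + 1) → Space d → CVec d} (hU : ∀ i, Rapid (U i)) {v : Fin (n + 1) → Sobolev d q}
    (hv : ∀ i, fourierTuple v i =ᵐ[volume] U i) {T : L2Field d}
    (hT : ∀ φ, inner ℂ T φ = densPairing a (q - r) v φ) :
    T =ᵐ[volume] fun ξ => lam (q - r) ξ • ftA a n U ξ := by
  have hF := rapid_ftA ha n U hU
  refine ae_eq_of_integral_contDiff_smul_eq ((Lp.memLp _).locallyIntegrable (by norm_num))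
    ((hF.2 (q - r)).locallyIntegrable (by norm_num)) fun g hg hc => ?_
  obtain ⟨C, hC⟩ := hc.exists_bound_of_continuous hg.continuous
  have hC0 : 0 ≤ C := (norm_nonneg _).trans (hC 0)
  set φ : Space d → ℂ := fun ξ => ((g ξ * lam (q - r) ξ : ℝ) : ℂ) with hφdef
  have hφ : Measurable φ :=
    Complex.measurable_ofReal.comp (hg.continuous.measurable.mul (measurable_lam _))
  have hφb : ∀ ξ, ‖φ ξ‖ ≤ C * lam (q - r) ξ := fun ξ => by
    rw [hφdef]
    dsimp only
    rw [Complex.norm_real, norm_mul, Real.norm_of_nonneg (lam_nonneg _ _)]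
    exact mul_le_mul_of_nonneg_right (hC ξ) (lam_nonneg _ _)
  have h1 : ∫ ξ, g ξ • (lam (q - r) ξ • ftA a n U ξ) = ∫ ξ, φ ξ • ftA a n U ξ := by
    congr 1
    funext ξ
    rw [hφdef, smul_smul, ← Complex.coe_smul]
  rw [h1, weak_formula hr ha n U hU hφ hC0 (by linarith) hφb]
  refine ext_inner_left ℂ fun e => ?_
  have hge : MemLp (fun ξ => g ξ • e) 2 (volume : Measure (Space d)) :=
    (hg.continuous.smul continuous_const).memLp_of_hasCompactSupport hc.smul_right
  have hgT : Integrable fun ξ => g ξ • T ξ :=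
    ((Lp.memLp T).locallyIntegrable (by norm_num)).integrable_smul_left_of_hasCompactSupport
      hg.continuous hc
  have hI := integrable_smul_symF hr ha hU hφ hC0 (by linarith) hφb
  rw [← integral_inner hgT, ← integral_inner hI]
  have h2 : ∫ ξ, inner ℂ e (g ξ • T ξ) = inner ℂ (hge.toLp _) T := by
    rw [L2.inner_def]
    refine integral_congr_ae ?_
    filter_upwards [hge.coeFn_toLp] with ξ hξ
    rw [hξ, ← Complex.coe_smul, ← Complex.coe_smul, inner_smul_left, inner_smul_right,
      Complex.conj_ofReal]
  -- The defining identity has T in the conjugate-linear argument, so the pairing is conjugated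
  -- first.
  rw [h2, ← inner_conj_symm, hT, densPairing, ← integral_conj]
  refine integral_congr_ae ?_
  have h3 : ∀ᵐ ξ : Fin (n + 1) → Space d, ∀ i, fourierTuple v i (ξ i) = U i (ξ i) :=
    ae_all_iff.2 fun i => ae_eval i (hv i)
  filter_upwards [h3, ae_sum_apply hge.coeFn_toLp] with ξ h3 h4
  have h5 : (fun i => fourierTuple v i (ξ i)) = fun i => U i (ξ i) := funext h3
  rw [h4, inner_conj_symm, dens, h5, hφdef]
  dsimp only
  rw [← Complex.coe_smul, ← Complex.coe_smul, inner_smul_left, inner_smul_right, inner_smul_right,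
    Complex.conj_ofReal, Complex.ofReal_mul, mul_assoc]

theorem IsHInfty.fourierTuple_ae_eq {u : Fin (n + 1) → Space d → CVec d}
    (hu : ∀ i, IsHInfty (u i)) {v : Fin (n + 1) → Sobolev d q}
    (hv : ∀ i, Sobolev.toL2 (v i) =ᵐ[volume] u i) (i : Fin (n + 1)) :
    fourierTuple v i =ᵐ[volume] hat (u i) := by
  obtain ⟨-, h, -⟩ := hu i
  have h1 : Sobolev.toL2 (v i) = h.toLp (u i) := Lp.ext ((hv i).trans h.coeFn_toLp.symm)
  rw [hat, dif_pos h, fourierTuple, h1]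

theorem iterA_eq_fourierInv (ha : SymbolClass r a) {u : Fin (n + 1) → Space d → CVec d}
    (hu : ∀ i, IsHInfty (u i)) :
    iterA a n u = (𝓕⁻ (ftA a n fun i => hat (u i)) : Space d → CVec d) := by
  rw [← iterA_fourierInv ha n _ fun i => (hu i).rapid_hat]
  congr 1
  funext i
  exact (hu i).fourierInv_hat.symm

theorem isHInfty_iterA (ha : SymbolClass r a) {u : Fin (n + 1) → Space d → CVec d}
    (hu : ∀ i, IsHInfty (u i)) : IsHInfty (iterA a n u) := by
  rw [iterA_eq_fourierInv ha hu]
  exact (rapid_ftA ha n _ fun i => (hu i).rapid_hat).isHInfty_fourierInv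

/-- The positive weight cancels in the identity for the weighted transforms, and Fourier inversion
returns to the space side. -/
theorem toL2_ae_eq_iterA (hr : 1 ≤ r) (hrq : r ≤ q) (ha : SymbolClass r a)
    {u : Fin (n + 1) → Space d → CVec d} (hu : ∀ i, IsHInfty (u i))
    {v : Fin (n + 1) → Sobolev d q} (hv : ∀ i, Sobolev.toL2 (v i) =ᵐ[volume] u i)
    {w : Sobolev d (q - r)}
    (hw : ∀ φ, inner ℂ (Sobolev.weighted d (q - r) w) φ = densPairing a (q - r) v φ) :
    Sobolev.toL2 w =ᵐ[volume] iterA a n u := by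
  have hR := rapid_ftA ha n _ fun i => (hu i).rapid_hat
  have h1 := ae_eq_of_inner_eq_densPairing hr hrq ha (fun i => (hu i).rapid_hat)
    (IsHInfty.fourierTuple_ae_eq hu hv) hw
  have h2 : (𝓕 (Sobolev.toL2 w) : L2Field d) = hR.memLp.toLp _ := by
    refine Lp.ext ?_
    filter_upwards [h1, Sobolev.coeFn_weighted w, hR.memLp.coeFn_toLp] with ξ e1 e2 e3
    rw [e3]
    exact smul_right_injective _ (lam_pos (q - r) ξ).ne' (e2.symm.trans e1)
  have h3 : Sobolev.toL2 w = (𝓕⁻ (hR.memLp.toLp _) : L2Field d) := by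
    rw [← h2, FourierTransform.fourierInv_fourier_eq]
  rw [h3, iterA_eq_fourierInv ha hu]
  exact fourierInv_toLp_ae_eq hR.integrable hR.memLp

end Agreement

/-! ### Reality -/

section Conjugation

variable {d : ℕ}

/-- Coordinatewise complex conjugation on `ℂ^d`. -/
noncomputable def conjVec (d : ℕ) : CVec d ≃ₗᵢ[ℝ] CVec d :=
  LinearIsometryEquiv.piLpCongrRight 2 fun _ : Fin d => Complex.conjLIE

theorem conjVec_apply (c : CVec d) (j : Fin d) : conjVec d c j = (starRingEnd ℂ) (c j) := rfl

theorem conjVec_smul (z : ℂ) (c : CVec d) :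
    conjVec d (z • c) = (starRingEnd ℂ) z • conjVec d c := by
  ext j
  simp [conjVec_apply]

theorem conjVec_eq_self_iff (c : CVec d) : conjVec d c = c ↔ ∀ j, (c j).im = 0 := by
  simp only [← Complex.conj_eq_iff_im, ← conjVec_apply]
  exact ⟨fun h j => by rw [h], fun h => by ext j; exact h j⟩

theorem isRealField_iff {u : Space d → CVec d} :
    IsRealField u ↔ ∀ᵐ x ∂(volume : Measure (Space d)), conjVec d (u x) = u x := by
  simp only [IsRealField, conjVec_eq_self_iff]

theorem IsRealField.conjVec_eq {u : Space d → CVec d} (hu : Continuous u) (h : IsRealField u)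
    (x : Space d) : conjVec d (u x) = u x :=
  congrFun ((Continuous.ae_eq_iff_eq volume ((conjVec d).continuous.comp hu) hu).1
    (isRealField_iff.1 h)) x

theorem isRealField_of_forall {u : Space d → CVec d} (h : ∀ x, conjVec d (u x) = u x) :
    IsRealField u :=
  isRealField_iff.2 (Filter.Eventually.of_forall h)

/-- Real fields are the fixed points of conjugation, which is continuous on L². -/
theorem isClosed_isRealField (d : ℕ) : IsClosed {f : L2Field d | IsRealField f} := by
  let J := ((conjVec d).toContinuousLinearEquiv : CVec d →L[ℝ] CVec d)
  have h : {f : L2Field d | IsRealField f} = {f | J.compLpL 2 volume f = f} := by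
    ext f
    rw [Set.mem_ofPred_eq, Set.mem_ofPred_eq, isRealField_iff, Lp.ext_iff]
    constructor
    · intro h
      filter_upwards [J.coeFn_compLpL f, h] with x e1 e2
      exact e1.trans e2
    · intro h
      filter_upwards [J.coeFn_compLpL f, h] with x e1 e2
      exact e1.symm.trans e2
  rw [h]
  exact isClosed_eq (J.compLpL 2 volume).continuous continuous_id

end Conjugation

/-! ### Preservation of real fields by the recursion -/

section RealOperators

variable {d : ℕ} {r : ℝ} {a : Space d → (CVec d →L[ℂ] CVec d)}

/-- Conjugation is real-linear, so by uniqueness of derivatives it fixes the derivative of a field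
that it fixes. -/
theorem conjVec_nabla {u w : Space d → CVec d} (hw : Differentiable ℝ w)
    (hur : ∀ x, conjVec d (u x) = u x) (hwr : ∀ x, conjVec d (w x) = w x) (x : Space d) :
    conjVec d (nabla u w x) = nabla u w x := by
  have h1 : ∀ y, conjVec d (fderiv ℝ w x y) = fderiv ℝ w x y := fun y => by
    have h2 : (fun z => conjVec d (w z)) = w := funext hwr
    have h3 := ((conjVec d).toContinuousLinearEquiv : CVec d →L[ℝ] CVec d).hasFDerivAt.comp x
      (hw x).hasFDerivAt
    have h4 := h3.unique ((congrArg (fun f => HasFDerivAt f (fderiv ℝ w x) x) h2).mpr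
      (hw x).hasFDerivAt)
    exact congrArg (fun L => L y) h4
  simp only [nabla, map_sum, conjVec_smul, h1, ← conjVec_apply, hur]

theorem IsHInfty.nabla {u w : Space d → CVec d} (hu : IsHInfty u) (hw : IsHInfty w) :
    IsHInfty (nabla u w) := by
  rw [← hu.fourierInv_hat, ← hw.fourierInv_hat, nabla_fourierInv hu.rapid_hat hw.rapid_hat]
  exact (hu.rapid_hat.convN hw.rapid_hat).isHInfty_fourierInv

theorem IsHInfty.differentiable {u : Space d → CVec d} (hu : IsHInfty u) : Differentiable ℝ u :=
  hu.1.differentiable (by simp)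

theorem conjVec_iterA (ha : SymbolClass r a)
    (hA : ∀ u : Space d → CVec d, IsHInfty u → IsRealField u → IsRealField (fourierMult a u))
    (n : ℕ) (u : Fin (n + 1) → Space d → CVec d) (hu : ∀ i, IsHInfty (u i))
    (hr : ∀ i x, conjVec d (u i x) = u i x) (x : Space d) :
    conjVec d (iterA a n u x) = iterA a n u x := by
  induction n generalizing x with
  | zero =>
    -- The hypothesis gives reality almost everywhere; continuity makes it hold at every point, as
    -- differentiation in the next step requires.
    exact (hA (u 0) (hu 0) (isRealField_of_forall (hr 0))).conjVec_eq
      (isHInfty_iterA (n := 0) ha hu).1.continuous x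
  | succ n ih =>
    rw [iterA, Pi.sub_apply, Finset.sum_apply, map_sub, map_sum]
    congr 1
    · exact conjVec_nabla (isHInfty_iterA ha fun i => hu _).differentiable (hr _)
        (ih _ (fun i => hu _) fun i => hr _) x
    · refine Finset.sum_congr rfl fun k _ => ih _ (fun i => ?_) (fun i => ?_) x
      · rcases eq_or_ne i k with rfl | h
        · rw [Function.update_self]; exact (hu _).nabla (hu _)
        · rw [Function.update_of_ne h]; exact hu _
      · rcases eq_or_ne i k with rfl | h
        · rw [Function.update_self]
          exact conjVec_nabla (hu _).differentiable (hr _) (hr _)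
        · rw [Function.update_of_ne h]; exact hr _

end RealOperators

/-! ### Conjugation symmetry of the Fourier transform -/

section Symmetry

variable {d : ℕ}

theorem fourier_comp_neg_eq_conj (g : Space d → ℝ) (x : Space d) :
    (𝓕 (fun ξ => ((g (-ξ) : ℝ) : ℂ)) : Space d → ℂ) x =
      (starRingEnd ℂ) ((𝓕 (fun ξ => ((g ξ : ℝ) : ℂ)) : Space d → ℂ) x) := by
  rw [Real.fourier_eq', Real.fourier_eq', ← integral_conj, ← integral_neg_eq_self]
  congr 1
  funext ξ
  rw [smul_eq_mul, smul_eq_mul, map_mul, Complex.conj_ofReal, ← Complex.exp_conj, neg_neg]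
  congr 2
  simp [map_ofNat]

/-- The Fourier transform of a real field is conjugation symmetric. -/
theorem fourier_neg_ae_eq_conj {f : L2Field d} (hf : IsRealField f) :
    ∀ᵐ ξ ∂(volume : Measure (Space d)),
      (𝓕 f : L2Field d) (-ξ) = conjVec d ((𝓕 f : L2Field d) ξ) := by
  have hneg : MemLp (fun ξ => (𝓕 f : L2Field d) (-ξ)) 2 (volume : Measure (Space d)) :=
    (Lp.memLp _).comp_measurePreserving (Measure.measurePreserving_neg volume)
  have hconj : MemLp (fun ξ => conjVec d ((𝓕 f : L2Field d) ξ)) 2 (volume : Measure (Space d)) :=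
    ((conjVec d).toContinuousLinearEquiv : CVec d →L[ℝ] CVec d).comp_memLp' (Lp.memLp _)
  refine ae_eq_of_integral_contDiff_smul_eq (hneg.locallyIntegrable (by norm_num))
    (hconj.locallyIntegrable (by norm_num)) fun g hg hc => ?_
  have hg' : ContDiff ℝ ∞ fun ξ => g (-ξ) := hg.comp contDiff_neg
  have hc' : HasCompactSupport fun ξ => g (-ξ) := hc.comp_homeomorph (Homeomorph.neg _)
  have e1 := integral_smul_fourier_Lp f (toSchwartz g hg hc)
  have e2 := integral_smul_fourier_Lp f (toSchwartz _ hg' hc')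
  simp only [toSchwartz_apply, Complex.coe_smul] at e1 e2
  -- Reflection is moved to g and conjugation out of the integral, so the claim reduces to the
  -- symmetry of the transform of the real function g.
  have e3 : ∫ ξ, g ξ • (𝓕 f : L2Field d) (-ξ) = ∫ ξ, g (-ξ) • (𝓕 f : L2Field d) ξ := by
    rw [← integral_neg_eq_self]
    simp only [neg_neg]
  have e4 : ∫ ξ, g ξ • conjVec d ((𝓕 f : L2Field d) ξ) =
      conjVec d (∫ ξ, g ξ • (𝓕 f : L2Field d) ξ) := by
    refine Eq.trans ?_ ((conjVec d).toContinuousLinearEquiv.integral_comp_comm _)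
    congr 1
    funext ξ
    exact ((conjVec d).map_smul _ _).symm
  rw [e3, e4, e1, e2]
  have e5 := (conjVec d).toContinuousLinearEquiv.integral_comp_comm (μ := volume)
    (fun x => (𝓕 (toSchwartz g hg hc) : SchwartzMap (Space d) ℂ) x • f x)
  refine Eq.trans ?_ e5
  refine integral_congr_ae ?_
  filter_upwards [isRealField_iff.1 hf] with x hx
  change _ = conjVec d _
  rw [conjVec_smul, hx]
  congr 1
  exact fourier_comp_neg_eq_conj g x

theorem conj_chr (x ξ : Space d) : (starRingEnd ℂ) (chr x ξ) = chr x (-ξ) := by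
  rw [chr, chr, ← Complex.exp_conj]
  simp [map_ofNat]

theorem conjVec_fourierInv {W : Space d → CVec d}
    (hW : ∀ᵐ ξ ∂(volume : Measure (Space d)), W (-ξ) = conjVec d (W ξ)) (x : Space d) :
    conjVec d ((𝓕⁻ W : Space d → CVec d) x) = (𝓕⁻ W : Space d → CVec d) x := by
  rw [fourierInv_eq_chr]
  have e := (conjVec d).toContinuousLinearEquiv.integral_comp_comm (μ := volume)
    (fun ξ => chr x ξ • W ξ)
  refine e.symm.trans ?_
  rw [← integral_neg_eq_self (fun ξ => chr x ξ • W ξ)]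
  refine integral_congr_ae ?_
  filter_upwards [hW] with ξ hξ
  change conjVec d _ = _
  rw [conjVec_smul, conj_chr, hξ]

end Symmetry

/-! ### Approximation of real fields by Fourier cutoff -/

section Cutoff

variable {d : ℕ} {q : ℝ}

/-- Restriction of a field to the ball of radius `R`. -/
noncomputable def cutoff (R : ℝ) (V : Space d → CVec d) : Space d → CVec d :=
  (Metric.closedBall 0 R).indicator V

theorem lam_le_of_norm_le (s : ℝ) {R : ℝ} {ξ : Space d} (h : ‖ξ‖ ≤ R) :
    lam s ξ ≤ (1 + R ^ 2) ^ (|s| / 2) := by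
  refine (lam_mono (le_abs_self s) ξ).trans ?_
  exact Real.rpow_le_rpow (lam_base_pos ξ).le
    (by have := pow_le_pow_left₀ (norm_nonneg ξ) h 2; linarith) (by positivity)

/-- All weights are bounded on a ball, so plain square integrability suffices. -/
theorem rapid_cutoff (R : ℝ) {V : Space d → CVec d} (hm : Measurable V) (hV : MemLp V 2 volume) :
    Rapid (cutoff R V) := by
  have h1 : Measurable (cutoff R V) := hm.indicator Metric.isClosed_closedBall.measurableSet
  refine ⟨h1, fun s => hV.of_le_mul ((measurable_lam s).smul h1).aestronglyMeasurable
    (c := (1 + R ^ 2) ^ (|s| / 2)) (Filter.Eventually.of_forall fun ξ => ?_)⟩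
  rw [norm_smul, Real.norm_of_nonneg (lam_nonneg _ _), cutoff]
  by_cases h : ξ ∈ Metric.closedBall (0 : Space d) R
  · rw [Set.indicator_of_mem h]
    exact mul_le_mul_of_nonneg_right (lam_le_of_norm_le s (by simpa using h)) (norm_nonneg _)
  · rw [Set.indicator_of_notMem h, norm_zero, mul_zero]
    positivity

theorem cutoff_neg_eq (R : ℝ) {V : Space d → CVec d} {ξ : Space d}
    (h : V (-ξ) = conjVec d (V ξ)) : cutoff R V (-ξ) = conjVec d (cutoff R V ξ) := by
  by_cases hξ : ξ ∈ Metric.closedBall (0 : Space d) R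
  · have hξ' : -ξ ∈ Metric.closedBall (0 : Space d) R := by simpa using hξ
    rw [cutoff, Set.indicator_of_mem hξ, Set.indicator_of_mem hξ', h]
  · have hξ' : -ξ ∉ Metric.closedBall (0 : Space d) R := by simpa using hξ
    rw [cutoff, Set.indicator_of_notMem hξ, Set.indicator_of_notMem hξ', map_zero]

/-- Dominated convergence: at each point the difference vanishes once the ball contains it. -/
theorem tendsto_eLpNorm_sub_cutoff {V : Space d → CVec d} (hV : MemLp V 2 volume) :
    Filter.Tendsto (fun N : ℕ => eLpNorm (cutoff (N : ℝ) V - V) 2 volume) Filter.atTop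
      (nhds 0) := by
  have h1 : ∀ N : ℕ, AEStronglyMeasurable (cutoff (N : ℝ) V - V) volume := fun N =>
    (hV.1.indicator Metric.isClosed_closedBall.measurableSet).sub hV.1
  have h2 : ∀ f : Space d → CVec d,
      eLpNorm f 2 volume = (∫⁻ x, ‖f x‖ₑ ^ (2 : ℝ)) ^ (1 / (2 : ℝ)) := fun f => by
    rw [eLpNorm_eq_lintegral_rpow_enorm_toReal (by norm_num) (by norm_num)]
    norm_num
  have h3 : ∫⁻ x, ‖V x‖ₑ ^ (2 : ℝ) ≠ ⊤ := by
    have := hV.2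
    rw [h2] at this
    intro h
    rw [h] at this
    norm_num at this
  have h4 : Filter.Tendsto (fun N : ℕ => ∫⁻ x, ‖(cutoff (N : ℝ) V - V) x‖ₑ ^ (2 : ℝ)) Filter.atTop
      (nhds (∫⁻ _ : Space d, 0)) := by
    refine tendsto_lintegral_of_dominated_convergence' (fun x => ‖V x‖ₑ ^ (2 : ℝ))
      (fun N => (h1 N).enorm.pow_const _) (fun N => Filter.Eventually.of_forall fun x => ?_) h3
      (Filter.Eventually.of_forall fun x => ?_)
    · refine ENNReal.rpow_le_rpow ?_ (by norm_num)
      rw [Pi.sub_apply, cutoff]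
      by_cases h : x ∈ Metric.closedBall (0 : Space d) N
      · rw [Set.indicator_of_mem h]; simp
      · rw [Set.indicator_of_notMem h]; simp
    · obtain ⟨M, hM⟩ := exists_nat_ge ‖x‖
      refine tendsto_const_nhds.congr' ?_
      filter_upwards [Filter.eventually_ge_atTop M] with N hN
      have h : x ∈ Metric.closedBall (0 : Space d) N := by
        rw [mem_closedBall_zero_iff]
        exact hM.trans (by exact_mod_cast hN)
      rw [Pi.sub_apply, cutoff, Set.indicator_of_mem h, sub_self, enorm_zero,
        ENNReal.zero_rpow_of_pos (by norm_num)]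
  simp only [h2]
  rw [lintegral_zero] at h4
  have h5 := (ENNReal.continuous_rpow_const (y := 1 / (2 : ℝ))).tendsto 0 |>.comp h4
  rwa [ENNReal.zero_rpow_of_pos (by norm_num)] at h5

/-- Real elements of `H^q` are limits in `H^q` of real elements of `H^∞`. -/
theorem exists_real_approximation (hq : 0 ≤ q) (v : Sobolev d q)
    (hv : IsRealField (Sobolev.toL2 v)) :
    ∃ (w : ℕ → Sobolev d q) (u : ℕ → Space d → CVec d),
      Filter.Tendsto w Filter.atTop (nhds v) ∧ (∀ N, IsHInfty (u N)) ∧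
        (∀ N x, conjVec d (u N x) = u N x) ∧ ∀ N, Sobolev.toL2 (w N) =ᵐ[volume] u N := by
  set V := ((𝓕 (Sobolev.toL2 v) : L2Field d) : Space d → CVec d) with hVdef
  have hR : ∀ N : ℕ, Rapid (cutoff (N : ℝ) V) := fun N =>
    rapid_cutoff _ (Lp.stronglyMeasurable _).measurable (Lp.memLp _)
  have hmem : ∀ N, (hR N).memLp_fourierInv.toLp _ ∈ sobolevSubmodule d q := fun N =>
    (hR N).isHInfty_fourierInv.2.2 q hq
  obtain ⟨w, hw⟩ : ∃ w : ℕ → Sobolev d q, ∀ N,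
      Sobolev.toL2 (w N) = (hR N).memLp_fourierInv.toLp _ := ⟨fun N => ⟨_, hmem N⟩, fun _ => rfl⟩
  refine ⟨w, fun N => 𝓕⁻ (cutoff (N : ℝ) V), ?_,
    fun N => (hR N).isHInfty_fourierInv, fun N => conjVec_fourierInv ?_,
    fun N => by rw [hw]; exact (hR N).memLp_fourierInv.coeFn_toLp⟩
  -- The cutoff commutes with the weight, so the H^q distance to v is the L² distance between λ_q 𝓕
  -- v and its cutoff.
  · rw [tendsto_iff_norm_sub_tendsto_zero]
    have h0 := tendsto_eLpNorm_sub_cutoff (Sobolev.memLp_weighted v)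
    have h1 := (ENNReal.tendsto_toReal ENNReal.zero_ne_top).comp h0
    rw [ENNReal.toReal_zero] at h1
    refine h1.congr fun N => ?_
    have h2 : ∀ f : Sobolev d q, ‖f‖ = ‖Sobolev.weighted d q f‖ := fun _ => rfl
    rw [h2, map_sub, Function.comp, Lp.norm_def]
    congr 1
    refine eLpNorm_congr_ae ?_
    have h4 := Sobolev.coeFn_weighted (w N)
    rw [hw, (hR N).fourier_toLp_fourierInv (hR N).memLp_fourierInv] at h4
    filter_upwards [h4, (hR N).memLp.coeFn_toLp, Sobolev.coeFn_weighted v,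
      Lp.coeFn_sub (Sobolev.weighted d q (w N)) (Sobolev.weighted d q v)] with ξ e1 e2 e3 e4
    rw [e4, Pi.sub_apply, Pi.sub_apply, e1, e2, e3]
    congr 1
    rw [cutoff, cutoff]
    by_cases h : ξ ∈ Metric.closedBall (0 : Space d) N
    · rw [Set.indicator_of_mem h, Set.indicator_of_mem h]
    · rw [Set.indicator_of_notMem h, Set.indicator_of_notMem h, smul_zero]
  · filter_upwards [fourier_neg_ae_eq_conj hv] with ξ hξ
    exact cutoff_neg_eq _ hξ

theorem Sobolev.continuous_toL2 (hq : 0 ≤ q) :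
    Continuous (Sobolev.toL2 : Sobolev d q →ₗ[ℂ] L2Field d) := by
  refine AddMonoidHomClass.continuous_of_bound _ 1 fun f => ?_
  rw [one_mul]
  have h1 : ‖Sobolev.toL2 f‖ = ‖(𝓕 (Sobolev.toL2 f) : L2Field d)‖ :=
    ((Lp.fourierTransformₗᵢ (Space d) (CVec d)).norm_map _).symm
  have h2 : ‖f‖ = ‖Sobolev.weighted d q f‖ := rfl
  rw [h1, h2]
  refine Lp.norm_le_norm_of_ae_le ?_
  filter_upwards [Sobolev.coeFn_weighted f] with ξ hξ
  rw [hξ, norm_smul, Real.norm_of_nonneg (lam_nonneg _ _)]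
  exact le_mul_of_one_le_left (norm_nonneg _) (one_le_lam hq ξ)

end Cutoff

/-! ### The main theorem -/

theorem mainTheorem5 (d : ℕ) (r q : ℝ) (hr : 1 ≤ r) (hq : 1 + (d : ℝ) / 2 < q) (hrq : r ≤ q)
    (a : Space d → (CVec d →L[ℂ] CVec d)) (ha : SymbolClass r a) (n : ℕ) :
    ∃ B : ContinuousMultilinearMap ℂ (fun _ : Fin (n + 1) => Sobolev d q) (Sobolev d (q - r)),
      (∀ u : Fin (n + 1) → Space d → CVec d, (∀ i, IsHInfty (u i)) →
        IsHInfty (iterA a n u) ∧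
        ∀ v : Fin (n + 1) → Sobolev d q, (∀ i, (Sobolev.toL2 (v i)) =ᵐ[volume] u i) →
          (Sobolev.toL2 (B v)) =ᵐ[volume] iterA a n u) ∧
      ((∀ u : Space d → CVec d, IsHInfty u → IsRealField u → IsRealField (fourierMult a u)) →
        ∀ v : Fin (n + 1) → Sobolev d q, (∀ i, IsRealField (Sobolev.toL2 (v i))) →
          IsRealField (Sobolev.toL2 (B v))) := by
  obtain ⟨B, hB⟩ := exists_extension hr hq hrq ha n
  refine ⟨B, fun u hu => ⟨isHInfty_iterA ha hu, fun v hv => toL2_ae_eq_iterA hr hrq ha hu hv (hB v)⟩,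
    fun hA v hv => ?_⟩
  -- Real arguments are replaced by real elements of H^∞, on which the extension is given by
  -- `iterA`; continuity of the extension and closedness of the real fields in L² then give the
  -- limit.
  choose w u hw hu hur hwu using fun i => exists_real_approximation (by linarith) (v i) (hv i)
  have hlim : Filter.Tendsto (fun N => Sobolev.toL2 (B fun i => w i N)) Filter.atTop
      (nhds (Sobolev.toL2 (B v))) :=
    ((Sobolev.continuous_toL2 (by linarith)).tendsto _).comp
      ((B.cont.tendsto v).comp (tendsto_pi_nhds.2 hw))
  refine (isClosed_isRealField d).mem_of_tendsto hlim (Filter.Eventually.of_forall fun N => ?_)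
  have h1 := toL2_ae_eq_iterA hr hrq ha (fun i => hu i N) (fun i => hwu i N)
    (hB fun i => w i N)
  refine isRealField_iff.2 ?_
  filter_upwards [h1] with x hx
  rw [hx]
  exact conjVec_iterA ha hA n _ (fun i => hu i N) (fun i => hur i N) x
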